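/- **Theorem (Localized order of convergence).** Let $d\ge 1$ and let $\Omega\subset\mathbb R^d$ be a polygonal domain: a connected open set with $\Omega=\operatorname{int}\overline\Omega$ whose closure is a finite union of convex polytopes. Let $V\in C^2(\overline\Omega)$, $\pi=e^{-V}$, and $0<\kappa_*\le\kappa^*$, $M,K\ge 0$. Write $C^2_0(\Omega)$ for the functions in $C^2(\overline\Omega)$ that vanish on $\partial\Omega$. *Meshes.* An admissible mesh $\mathcal T$ of $\Omega$ consists of finitely many pairwise disjoint non-empty open convex polytopes $\Omega_i$ with $\bigcup_i\overline\Omega_i=\overline\Omega$, and distinct nodes $x_i\in\overline\Omega_i$. Write $i\sim j$ if $i\ne j$ and $\sigma_{ij}=\partial\Omega_i\cap\partial\Omega_j$ has positive $(d-1)$-dimensional measure; then $x_j-x_i$ has to be orthogonal to $\sigma_{ij}$. The boundary of every $\Omega_i$ is the union of the interfaces $\sigma_{ij}$, $j\sim i$, and of finitely many boundary interfaces $\sigma$ of positive $(d-1)$-dimensional measure. Each of the latter is the intersection of $\partial\Omega_i\cap\partial\Omega$ with a hyperplane, it does not contain $x_i$, and it contains the foot $y_\sigma$ of the perpendicular from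 $x_i$ to this hyperplane; we also write $\sigma=\sigma_{ij}$, $x_j=y_\sigma$, $j\sim i$. Let $m_{ij}$ be the $(d-1)$-dimensional measure of $\sigma_{ij}$, $h_{ij}=|x_i-x_j|$, $\nu_{ij}=(x_j-x_i)/h_{ij}$ the unit normal, $d_{i,ij}$ the distance of $x_i$ from the hyperplane spanned by $\sigma_{ij}$, and $\sum_{i\sim j}$ the sum over all interfaces, each taken once. For a coefficient $\kappa$ with cell averages $\bar\kappa_i$ put $$\kappa_{ij}=\frac{\bar\kappa_i\bar\kappa_j}{\bar\kappa_i\frac{d_{i,ij}}{h_{ij}}+\bar\kappa_j\frac{d_{j,ij}}{h_{ij}}}$$ on interior interfaces and $\kappa_{ij}=\bar\kappa_i$ on boundary interfaces of $\Omega_i$. For discrete functions $v$ that vanish at the boundary nodes let $$\|v\|_{H_{\mathcal T}}^2=\sum_{i\sim j}\frac{m_{ij}}{h_{ij}}\kappa_{ij}(v_j-v_i)^2 ,$$ and let $(\mathcal R_{\mathcal T}w)_i=w(x_i)$. *Consistency.* Let $\varphi:[0,\infty)\to[0,\infty)$. A family $(\mathcal T_h)_{h\in H}$, $H\subset(0,\infty)$,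 of meshes is $\varphi$-consistent on a set $B\subset C^2_0(\Omega)$ if for every $w\in B$ there is $c(w)\ge 0$ with $$\sum_{i\sim j}\frac{h_{ij}}{m_{ij}}\kappa_{ij}^{-1}\Big|\int_{\sigma_{ij}}\kappa\nabla w\cdot\nu_{ij}-\kappa_{ij}\frac{m_{ij}}{h_{ij}}\big((\mathcal R_{\mathcal T_h}w)_j-(\mathcal R_{\mathcal T_h}w)_i\big)\Big|^2\le c(w)\,\varphi(h)^2\qquad\text{for all }h\in H.$$ *Claim.* There is a constant $C$ that depends only on $\kappa_*,\kappa^*,d,\pi$ (including its domain $\Omega$), $M$ and $K$ such that the following holds. Let $\kappa\in C^1(\overline\Omega)$ with $\kappa_*\le\kappa\le\kappa^*$. Let $S$ be a symmetric mean on $(0,\infty)$ of class $C^2$, that is, $S\in C^2((0,\infty)^2)$, $S(x,y)=S(y,x)$ and $\min(x,y)\le S(x,y)\le\max(x,y)$. Let $(\mathcal T_h)_{h\in H}$ be a family of admissible meshes whose cells satisfy $\operatorname{diam}\Omega_i\le h$ and which is $\varphi$-consistent on $B$ with constants $c(\cdot)$. Let $u\in C^2_0(\Omega)$ solve $$-\nabla\cdot(\kappa\nabla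 u)-\nabla\cdot(\kappa u\nabla V)=f\quad\text{a.e. in }\Omega,$$ with $U:=u/\pi\in B$, $\|U\|_{C^2(\overline\Omega)}\le M$ and $c(U)\le K$. Let $u^{\mathcal T_h}$, with value $0$ at the boundary nodes, solve $$-\sum_{j:\,j\sim i}\frac{m_{ij}}{h_{ij}}\kappa_{ij}\,S(\pi_i,\pi_j)\Big(\frac{u_j^{\mathcal T_h}}{\pi_j}-\frac{u_i^{\mathcal T_h}}{\pi_i}\Big)=\int_{\Omega_i}f\quad\text{for every cell }\Omega_i,\qquad \pi_i=\pi(x_i).$$ Then for every $h\in H$ $$\|u^{\mathcal T_h}-\mathcal R_{\mathcal T_h}u\|_{H_{\mathcal T_h}}^2\le C\,\big(\varphi(h)^2+h^2\big).$$ -/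

import Mathlib

open MeasureTheory

noncomputable section

namespace StolarskyFV

/-- The Euclidean space `ℝ^d`. -/
abbrev Sp (d : ℕ) : Type := EuclideanSpace ℝ (Fin d)

/-- The `(d-1)`-dimensional surface measure on `ℝ^d`, normalised so that it is Lebesgue measure on
hyperplanes. -/
abbrev surf (d : ℕ) : Measure (Sp d) := μHE[d - 1]

/-- A polygonal (polyhedral) domain: a connected open set without slits whose closure is a finite
union of convex polytopes. -/
structure IsPolygonalDomain {d : ℕ} (Ω : Set (Sp d)) : Prop where
  isOpen : IsOpen Ω
  isConnected : IsConnected Ω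
  interior_closure : interior (closure Ω) = Ω
  polytopes : ∃ P : Set (Finset (Sp d)), P.Finite ∧ closure Ω = ⋃ s ∈ P, convexHull ℝ (s : Set (Sp d))

/-- The space `C²_0`: functions that are `C²` up to the boundary and vanish on the boundary. -/
def C20 {d : ℕ} (Ω : Set (Sp d)) : Set (Sp d → ℝ) :=
  {w | ContDiffOn ℝ 2 w (closure Ω) ∧ ∀ x ∈ frontier Ω, w x = 0}

/-- `‖w‖_{C²(closure Ω)} ≤ M`. -/
def C2NormLE {d : ℕ} (Ω : Set (Sp d)) (w : Sp d → ℝ) (M : ℝ) : Prop :=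
  ∀ k : ℕ, k ≤ 2 → ∀ x ∈ closure Ω, ‖iteratedFDerivWithin ℝ k w (closure Ω) x‖ ≤ M

/-- The divergence of a vector field. -/
def divergence {d : ℕ} (F : Sp d → Sp d) (x : Sp d) : ℝ :=
  ∑ k : Fin d, fderiv ℝ F x (EuclideanSpace.single k 1) k

/-- `u` solves `-∇·(κ∇u) - ∇·(κu∇V) = f` in `Ω` (almost everywhere; `f` is a class in `L²`). -/
def SolvesFPE {d : ℕ} (Ω : Set (Sp d)) (κ V f u : Sp d → ℝ) : Prop :=
  ∀ᵐ x ∂(volume.restrict Ω),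
    -divergence (fun z => κ z • gradient u z) x
      - divergence (fun z => (κ z * u z) • gradient V z) x = f x

/-- A symmetric mean on the positive reals, of class `C²`. -/
structure IsSmoothMean (S : ℝ → ℝ → ℝ) : Prop where
  symm : ∀ x y, 0 < x → 0 < y → S x y = S y x
  min_le : ∀ x y, 0 < x → 0 < y → min x y ≤ S x y
  le_max : ∀ x y, 0 < x → 0 < y → S x y ≤ max x y
  smooth : ContDiffOn ℝ 2 (fun p : ℝ × ℝ => S p.1 p.2) (Set.Ioi 0 ×ˢ Set.Ioi 0)

/-- The data of a finite volume mesh: the cells `Ω_i`, the nodes `x_i`, and for every cell the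
boundary nodes `y_σ`. The interfaces are determined by these data, see `face` and `bface`. -/
structure Mesh (d : ℕ) where
  /-- number of cells -/
  N : ℕ
  /-- the control volumes -/
  cell : Fin N → Set (Sp d)
  /-- the nodes of the cells -/
  node : Fin N → Sp d
  /-- the nodes on the boundary interfaces of a cell, one for each of these interfaces -/
  bnode : Fin N → Finset (Sp d)

namespace Mesh

variable {d : ℕ} (T : Mesh d)

/-- `σ_ij = ∂Ω_i ∩ ∂Ω_j`. -/
def face (i j : Fin T.N) : Set (Sp d) := frontier (T.cell i) ∩ frontier (T.cell j)

/-- `i ∼ j` for cells: `σ_ij` is a genuine `(d-1)`-dimensional interface. -/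
def Adj (i j : Fin T.N) : Prop := i ≠ j ∧ 0 < surf d (T.face i j)

/-- The boundary interface `σ` of the cell `i` with `y_σ = y`: the part of `∂Ω_i ∩ ∂Ω` in the
hyperplane through `y` that is orthogonal to `y - x_i`. -/
def bface (Ω : Set (Sp d)) (i : Fin T.N) (y : Sp d) : Set (Sp d) :=
  frontier (T.cell i) ∩ frontier Ω ∩ {p | inner ℝ (p - y) (y - T.node i) = 0}

/-- Admissible finite volume meshes of `Ω`. Cells may touch in sets of dimension less than `d - 1`
without being neighbours. As the cells are open and disjoint, the closures of two of them meet
exactly in `face i j`. -/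
structure IsAdmissible (Ω : Set (Sp d)) : Prop where
  polytope : ∀ i, ∃ s : Finset (Sp d), T.cell i = interior (convexHull ℝ (s : Set (Sp d)))
  nonempty : ∀ i, (T.cell i).Nonempty
  disjoint : ∀ i j, i ≠ j → Disjoint (T.cell i) (T.cell j)
  cover : ⋃ i, closure (T.cell i) = closure Ω
  boundary : ∀ i, frontier (T.cell i) =
    (⋃ j ∈ {j | T.Adj i j}, T.face i j) ∪ ⋃ y ∈ T.bnode i, T.bface Ω i y
  node_mem : ∀ i, T.node i ∈ closure (T.cell i)
  node_injective : Function.Injective T.node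
  orthogonal : ∀ i j, T.Adj i j → ∀ p ∈ T.face i j, ∀ q ∈ T.face i j,
    inner ℝ (T.node j - T.node i) (p - q) = 0
  bnode_mem : ∀ i, ∀ y ∈ T.bnode i, y ∈ T.bface Ω i y
  bnode_pos : ∀ i, ∀ y ∈ T.bnode i, 0 < surf d (T.bface Ω i y)
  node_notMem : ∀ i, ∀ y ∈ T.bnode i, T.node i ∉ T.bface Ω i y

/-- The mean of `κ` over a cell. -/
def kbar (κ : Sp d → ℝ) (i : Fin T.N) : ℝ := ⨍ x in T.cell i, κ x

/-- `d_{i,ij}`: the distance of `x_i` from (the hyperplane spanned by) `σ_ij`. -/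
def dist1 (i j : Fin T.N) : ℝ :=
  Metric.infDist (T.node i) (affineSpan ℝ (T.face i j) : Set (Sp d))

/-- `h_ij`. -/
def hh (i j : Fin T.N) : ℝ := dist (T.node i) (T.node j)

/-- `h_ij` for a boundary node `x_j = y`. -/
def bh (i : Fin T.N) (y : Sp d) : ℝ := dist (T.node i) y

/-- `m_ij`. -/
def m (i j : Fin T.N) : ℝ := (surf d).real (T.face i j)

/-- `m_σ` for a boundary interface. -/
def bm (Ω : Set (Sp d)) (i : Fin T.N) (y : Sp d) : ℝ := (surf d).real (T.bface Ω i y)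

/-- `κ_ij` for neighbouring cells. On a boundary interface of the cell `i` the coefficient is
`kbar κ i`. -/
def kap (κ : Sp d → ℝ) (i j : Fin T.N) : ℝ :=
  T.kbar κ i * T.kbar κ j /
    (T.kbar κ i * (T.dist1 i j / T.hh i j) + T.kbar κ j * (T.dist1 j i / T.hh i j))

/-- `∫_{σ_ij} κ ∇w · ν_ij`. The unit normal of `σ_ij` pointing from cell `i` to cell `j` is
`(x_j - x_i) / h_ij`. -/
def flux (Ω : Set (Sp d)) (κ w : Sp d → ℝ) (i j : Fin T.N) : ℝ :=
  ∫ x in T.face i j,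
    κ x * fderivWithin ℝ w (closure Ω) x ((T.hh i j)⁻¹ • (T.node j - T.node i)) ∂(surf d)

/-- `∫_σ κ ∇w · ν` for a boundary interface; the outer unit normal is `(y - x_i) / |y - x_i|`. -/
def bflux (Ω : Set (Sp d)) (κ w : Sp d → ℝ) (i : Fin T.N) (y : Sp d) : ℝ :=
  ∫ x in T.bface Ω i y,
    κ x * fderivWithin ℝ w (closure Ω) x ((T.bh i y)⁻¹ • (y - T.node i)) ∂(surf d)

open Classical in
/-- The cells adjacent to the cell `i`. -/
def nbrs (i : Fin T.N) : Finset (Fin T.N) := Finset.univ.filter fun j => T.Adj i j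

/-- The sum of an edge function over all interfaces: each interior one once (indexed by `i < j`),
and all boundary ones. -/
def edgeSum (w : Fin T.N → Fin T.N → ℝ) (wb : Fin T.N → Sp d → ℝ) : ℝ :=
  (∑ i, ∑ j ∈ (T.nbrs i).filter (fun j => i < j), w i j) + ∑ i, ∑ y ∈ T.bnode i, wb i y

/-- `‖v‖²_{H_T}` of a discrete function `v` on the cells, extended by zero to the boundary nodes. -/
def normSq (Ω : Set (Sp d)) (κ : Sp d → ℝ) (v : Fin T.N → ℝ) : ℝ :=
  T.edgeSum (fun i j => T.m i j / T.hh i j * T.kap κ i j * (v j - v i) ^ 2)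
    (fun i y => T.bm Ω i y / T.bh i y * T.kbar κ i * (0 - v i) ^ 2)

/-- The quantity in the definition of `φ`-consistency, with `R_T w` the evaluation of `w` at the
nodes. -/
def consistencyError (Ω : Set (Sp d)) (κ w : Sp d → ℝ) : ℝ :=
  T.edgeSum
    (fun i j => T.hh i j / T.m i j * (T.kap κ i j)⁻¹ *
      |T.flux Ω κ w i j - T.kap κ i j * (T.m i j / T.hh i j) * (w (T.node j) - w (T.node i))| ^ 2)
    (fun i y => T.bh i y / T.bm Ω i y * (T.kbar κ i)⁻¹ *
      |T.bflux Ω κ w i y - T.kbar κ i * (T.bm Ω i y / T.bh i y) * (w y - w (T.node i))| ^ 2)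

/-- `v` solves the finite volume scheme with homogeneous Dirichlet condition
`- ∑_{j ∼ i} (m_ij / h_ij) κ_ij S(π_i, π_j) (v_j / π_j - v_i / π_i) = ∫_{Ω_i} f`, where `p` is the
function `π` and `v` vanishes at the boundary nodes. -/
def SolvesScheme (Ω : Set (Sp d)) (κ p f : Sp d → ℝ) (S : ℝ → ℝ → ℝ) (v : Fin T.N → ℝ) : Prop :=
  ∀ i,
    -((∑ j ∈ T.nbrs i, T.m i j / T.hh i j * T.kap κ i j * S (p (T.node i)) (p (T.node j)) *
        (v j / p (T.node j) - v i / p (T.node i)))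
      + ∑ y ∈ T.bnode i, T.bm Ω i y / T.bh i y * T.kbar κ i * S (p (T.node i)) (p y) *
        (0 / p y - v i / p (T.node i)))
      = ∫ x in T.cell i, f x

end Mesh

/-- The family of meshes `T h`, `h ∈ H`, is `φ`-consistent on `B`; `c w` is the constant that the
definition provides for `w ∈ B`. -/
def IsPhiConsistent {d : ℕ} (Ω : Set (Sp d)) (κ : Sp d → ℝ) (H : Set ℝ) (T : ℝ → Mesh d)
    (φ : ℝ → ℝ) (B : Set (Sp d → ℝ)) (c : (Sp d → ℝ) → ℝ) : Prop :=
  ∀ w ∈ B, 0 ≤ c w ∧ ∀ h ∈ H, (T h).consistencyError Ω κ w ≤ c w * φ h ^ 2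

end StolarskyFV

end

noncomputable section

namespace StolarskyFV

/-! ### Surface measure on hyperplanes and separation of convex sets. -/

variable {d : ℕ}

/-! With `U = u / π` the equation reads `-∇·(κ π ∇U) = f`. By Gauss' theorem on a cell, the exact
fluxes `∫_σ κ π ∇U · ν` balance the same source as the scheme, so `e = u^T / π - U` (at the nodes)
solves the scheme with the residual `r_ij = ∫ κ π ∇U · ν - (m_ij / h_ij) κ_ij S_ij (U_j - U_i)`.
This residual is `S_ij` times the consistency error of `U` plus `∫ κ (π - S_ij) ∇U · ν`. As `S_ij`
lies between two nodal values of `π` and `π` is Lipschitz with some constant `L`, the last integral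
is at most `κ^* L h M m_ij`. Testing with `e`, Young's inequality and `∑ m_ij h_ij ≤ d |closure Ω|`
bound the discrete `H¹` seminorm of `e` by `φ(h)² + h²` (`energy_estimate`, `scheme_error_le`).

The error of the theorem is `π e`. A discrete product rule leaves a term with `e` itself, which a
discrete Poincaré inequality controls (`normSq_mul_le`, `poincare`). The latter comes from Gauss'
theorem for the field `x - x₀` and summation by parts against `e²`, so its constant involves only
the diameter of `Ω` and no regularity of the mesh.

Two geometric facts carry the rest. Gauss' theorem on a convex polytope
(`HasFaces.integral_divergence`) follows by integrating by parts against cutoffs built from the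
gauge and computing the integrals over cones above the faces; the mesh axioms supply these faces
(`hasFaces`). The Lipschitz bound for `π` on the possibly nonconvex `closure Ω`
(`IsPolygonalDomain.exists_lipschitz`) rests on linear regularity of pairs of polytopes, a
consequence of a Hoffman bound (`hoffman_stdSimplex`). -/

/-- The hyperplane `⟨ν, x⟩ = c`. -/
def hyperplane (ν : Sp d) (c : ℝ) : Set (Sp d) := {x | inner ℝ ν x = c}

theorem range_add_orthogonal {ν p : Sp d} {c : ℝ} (hp : p ∈ hyperplane ν c) :
    Set.range (fun w : (Submodule.span ℝ {ν})ᗮ => p + (w : Sp d)) = hyperplane ν c := by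
  ext x
  constructor
  · rintro ⟨w, rfl⟩
    have : inner ℝ ν (w : Sp d) = 0 := Submodule.mem_orthogonal_singleton_iff_inner_right.1 w.2
    have h2 : inner ℝ ν p = c := hp
    simp [hyperplane, inner_add_right, this, h2]
  · intro hx
    have h1 : inner ℝ ν x = c := hx
    have h2 : inner ℝ ν p = c := hp
    refine ⟨⟨x - p, Submodule.mem_orthogonal_singleton_iff_inner_right.2 ?_⟩, by simp⟩
    rw [inner_sub_right, h1, h2, sub_self]

theorem hyperplane_nonempty {ν : Sp d} (hν : ν ≠ 0) (c : ℝ) : (hyperplane ν c).Nonempty := by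
  refine ⟨(c / ‖ν‖ ^ 2) • ν, ?_⟩
  have : ‖ν‖ ≠ 0 := norm_ne_zero_iff.2 hν
  simp only [hyperplane, Set.mem_ofPred_eq, inner_smul_right, real_inner_self_eq_norm_sq]
  field_simp

theorem finrank_orthogonal_span {ν : Sp d} (hν : ν ≠ 0) :
    Module.finrank ℝ (Submodule.span ℝ {ν})ᗮ = d - 1 := by
  have h := (Submodule.span ℝ {ν}).finrank_add_finrank_orthogonal
  rw [finrank_span_singleton hν, finrank_euclideanSpace_fin] at h
  omega

/-- The surface measure on a hyperplane in terms of Lebesgue measure on its direction. -/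
theorem surf_inter_hyperplane {ν p : Sp d} {c : ℝ} (hν : ν ≠ 0) (hp : p ∈ hyperplane ν c)
    (A : Set (Sp d)) : surf d (A ∩ hyperplane ν c) =
      volume ((fun w : (Submodule.span ℝ {ν})ᗮ => p + (w : Sp d)) ⁻¹' A) := by
  have hiso : Isometry (fun w : (Submodule.span ℝ {ν})ᗮ => p + (w : Sp d)) :=
    (isometry_add_left p).comp isometry_subtype_coe
  rw [← range_add_orthogonal hp, ← InnerProductSpace.euclideanHausdorffMeasure_eq_volume,
    hiso.euclideanHausdorffMeasure_preimage, finrank_orthogonal_span hν]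

theorem surf_lt_top {ν : Sp d} {c : ℝ} (hν : ν ≠ 0) {A : Set (Sp d)} (hA : Bornology.IsBounded A)
    (hAH : A ⊆ hyperplane ν c) : surf d A < ⊤ := by
  obtain ⟨p, hp⟩ := hyperplane_nonempty hν c
  rw [← Set.inter_eq_left.2 hAH, surf_inter_hyperplane hν hp]
  have hiso : Isometry (fun w : (Submodule.span ℝ {ν})ᗮ => p + (w : Sp d)) :=
    (isometry_add_left p).comp isometry_subtype_coe
  exact (hiso.antilipschitz.isBounded_preimage hA).measure_lt_top

/-- Seen from `q`, the intersection is an affine subspace of the direction space that misses `0`,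
hence proper and Lebesgue null. -/
theorem surf_affineSubspace_inter {ν q : Sp d} {c : ℝ} (hν : ν ≠ 0) (B : AffineSubspace ℝ (Sp d))
    (hq : q ∈ hyperplane ν c) (hqB : q ∉ B) : surf d ((B : Set (Sp d)) ∩ hyperplane ν c) = 0 := by
  rw [surf_inter_hyperplane hν hq]
  let j : (Submodule.span ℝ {ν})ᗮ →ᵃ[ℝ] Sp d :=
    (Submodule.subtype _).toAffineMap + AffineMap.const ℝ _ q
  have : (fun w : (Submodule.span ℝ {ν})ᗮ => q + (w : Sp d)) ⁻¹' (B : Set (Sp d)) =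
      (B.comap j : Set _) := by
    ext w
    simp [j, add_comm]
  rw [this]
  refine Measure.addHaar_affineSubspace _ _ fun h => hqB ?_
  have h0 : (0 : (Submodule.span ℝ {ν})ᗮ) ∈ B.comap j := by rw [h]; trivial
  simpa [j] using h0

theorem coe_mk'_eq_hyperplane {ν p : Sp d} {c : ℝ} (hp : p ∈ hyperplane ν c) :
    (AffineSubspace.mk' p (Submodule.span ℝ {ν})ᗮ : Set (Sp d)) = hyperplane ν c := by
  ext x
  have h2 : inner ℝ ν p = c := hp
  simp [AffineSubspace.mem_mk', Submodule.mem_orthogonal_singleton_iff_inner_right,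
    inner_sub_right, hyperplane, h2, sub_eq_zero]

/-- A subset of positive measure spans the hyperplane. -/
theorem affineSpan_eq_hyperplane {ν : Sp d} {c : ℝ} (hν : ν ≠ 0) {A : Set (Sp d)}
    (hAH : A ⊆ hyperplane ν c) (hA : 0 < surf d A) :
    (affineSpan ℝ A : Set (Sp d)) = hyperplane ν c := by
  apply Set.Subset.antisymm
  · obtain ⟨p, hp⟩ := hyperplane_nonempty hν c
    rw [← coe_mk'_eq_hyperplane hp]
    exact affineSpan_le.2 (by rwa [coe_mk'_eq_hyperplane hp])
  · intro q hq
    by_contra hqB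
    have h := surf_affineSubspace_inter hν (affineSpan ℝ A) hq hqB
    have : A ⊆ (affineSpan ℝ A : Set (Sp d)) ∩ hyperplane ν c :=
      Set.subset_inter (subset_affineSpan ℝ A) hAH
    exact hA.ne' (measure_mono_null this h)

/-- Two hyperplanes that share a set of positive surface measure coincide. -/
theorem hyperplane_eq_of_surf_pos {ν w : Sp d} {c s : ℝ} (hν : ν ≠ 0)
    (h : 0 < surf d (hyperplane w s ∩ hyperplane ν c)) : ∃ t : ℝ, w = t • ν ∧ s = t * c := by
  by_cases hw : w = 0
  · refine ⟨0, by simp [hw], ?_⟩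
    obtain ⟨x, hx, -⟩ := nonempty_of_measure_ne_zero h.ne'
    have : inner ℝ w x = s := hx
    simpa [hw] using this.symm
  have hsub : hyperplane ν c ⊆ hyperplane w s := by
    intro q hq
    by_contra hqB
    obtain ⟨p, hp⟩ := hyperplane_nonempty hw s
    rw [← coe_mk'_eq_hyperplane hp] at h hqB
    exact h.ne' (surf_affineSubspace_inter hν _ hq hqB)
  obtain ⟨p, hp⟩ := hyperplane_nonempty hν c
  have hwp : inner ℝ w p = s := hsub hp
  have : w ∈ (Submodule.span ℝ {ν})ᗮᗮ := by
    rw [Submodule.mem_orthogonal']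
    intro u hu
    have h1 : p + u ∈ hyperplane ν c := by
      rw [← range_add_orthogonal hp]; exact ⟨⟨u, hu⟩, rfl⟩
    have h2 : inner ℝ w (p + u) = s := hsub h1
    rw [inner_add_right, hwp] at h2
    linarith
  rw [Submodule.orthogonal_orthogonal] at this
  obtain ⟨t, rfl⟩ := Submodule.mem_span_singleton.1 this
  have hp' : inner ℝ ν p = c := hp
  exact ⟨t, rfl, by rw [← hwp, real_inner_smul_left, hp']⟩

/-- The frontier of a convex open set has null intersection with the hyperplanes that meet the
set. -/
theorem surf_frontier_inter_hyperplane {C : Set (Sp d)} (hCo : IsOpen C) (hC : Convex ℝ C)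
    {ν : Sp d} {c : ℝ} (hν : ν ≠ 0) (h : (C ∩ hyperplane ν c).Nonempty) :
    surf d (frontier C ∩ hyperplane ν c) = 0 := by
  obtain ⟨p, hpC, hp⟩ := h
  rw [surf_inter_hyperplane hν hp]
  set j : (Submodule.span ℝ {ν})ᗮ → Sp d := fun w => p + (w : Sp d) with hj
  have hjc : Continuous j := by fun_prop
  have hconv : Convex ℝ (j ⁻¹' C) := by
    have : j ⁻¹' C = (Submodule.subtype (Submodule.span ℝ {ν})ᗮ) ⁻¹' ((fun z => p + z) ⁻¹' C) := rfl
    rw [this]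
    exact (hC.translate_preimage_right p).linear_preimage _
  refine measure_mono_null ?_ (hconv.addHaar_frontier volume)
  intro w hw
  have hw' : j w ∈ closure C ∧ j w ∉ C := by
    simpa [hCo.frontier_eq] using hw
  rw [(hCo.preimage hjc).frontier_eq]
  refine ⟨?_, hw'.2⟩
  -- The section of the frontier must be shown to lie in the closure of the section. The segment
  -- from `p ∈ C` to `j w` runs inside `C` before its end, so `t • w` approaches `w` through the
  -- section.
  have hlim : Filter.Tendsto (fun t : ℝ => t • w) (nhdsWithin 1 (Set.Iio 1)) (nhds w) := by
    have : Filter.Tendsto (fun t : ℝ => t • w) (nhds 1) (nhds ((1 : ℝ) • w)) :=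
      (continuous_id.smul continuous_const).tendsto 1
    rw [one_smul] at this
    exact this.mono_left nhdsWithin_le_nhds
  refine mem_closure_of_tendsto hlim ?_
  filter_upwards [Ioo_mem_nhdsLT (show (0 : ℝ) < 1 by norm_num)] with t ht
  have := hC.openSegment_interior_closure_subset_interior (x := p) (y := j w)
    (by rwa [hCo.interior_eq]) hw'.1
  rw [hCo.interior_eq] at this
  apply this
  refine ⟨1 - t, t, by linarith [ht.2], ht.1, by ring, ?_⟩
  simp only [hj, Submodule.coe_smul]
  module

theorem lt_or_gt_of_disjoint_hyperplane {C : Set (Sp d)} (hC : Convex ℝ C) {ν : Sp d} {c : ℝ}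
    (h : ¬ (C ∩ hyperplane ν c).Nonempty) :
    (∀ x ∈ C, inner ℝ ν x < c) ∨ ∀ x ∈ C, c < inner ℝ ν x := by
  by_contra! hcon
  obtain ⟨⟨x, hx, hxc⟩, y, hy, hyc⟩ := hcon
  have hcont : ContinuousOn (fun z : Sp d => inner ℝ ν z) C := by fun_prop
  obtain ⟨z, hz, hzc⟩ := hC.isPreconnected.intermediate_value hy hx hcont ⟨hyc, hxc⟩
  exact h ⟨z, hz, hzc⟩

/-- Two disjoint open convex sets whose closures share a piece of positive surface measure of a
hyperplane lie on different sides of it. -/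
theorem opposite_sides {A B : Set (Sp d)} (hAo : IsOpen A) (hBo : IsOpen B) (hA : Convex ℝ A)
    (hB : Convex ℝ B) (hAB : Disjoint A B) {ν : Sp d} {c : ℝ} (hν : ν ≠ 0)
    (h : 0 < surf d (closure A ∩ closure B ∩ hyperplane ν c)) :
    ((∀ x ∈ A, inner ℝ ν x < c) ∧ ∀ x ∈ B, c < inner ℝ ν x) ∨
      ((∀ x ∈ A, c < inner ℝ ν x) ∧ ∀ x ∈ B, inner ℝ ν x < c) := by
  obtain ⟨f, s, hfA, hfB⟩ := geometric_hahn_banach_open_open hA hAo hB hBo hAB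
  set w : Sp d := (InnerProductSpace.toDual ℝ (Sp d)).symm f with hw
  have hfw : ∀ x, f x = inner ℝ w x := fun x => by simp [hw]
  have h1 : ∀ x ∈ closure A, f x ≤ s := fun x hx =>
    closure_minimal (t := {x | f x ≤ s}) (fun y hy => (hfA y hy).le)
      (isClosed_le f.continuous continuous_const) hx
  have h2 : ∀ x ∈ closure B, s ≤ f x := fun x hx =>
    closure_minimal (t := {x | s ≤ f x}) (fun y hy => (hfB y hy).le)
      (isClosed_le continuous_const f.continuous) hx
  -- On the shared piece both separation inequalities hold, so it lies in the separating hyperplane,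
  -- which must therefore be the given one.
  have hpos : 0 < surf d (hyperplane w s ∩ hyperplane ν c) := by
    refine h.trans_le (measure_mono ?_)
    rintro x ⟨⟨hxA, hxB⟩, hx⟩
    exact ⟨by rw [hyperplane, Set.mem_ofPred_eq, ← hfw]; exact le_antisymm (h1 x hxA) (h2 x hxB), hx⟩
  obtain ⟨t, hwt, hst⟩ := hyperplane_eq_of_surf_pos hν hpos
  have hfx : ∀ x, f x = t * inner ℝ ν x := fun x => by rw [hfw, hwt, real_inner_smul_left]
  have hnA : A.Nonempty := by
    obtain ⟨x, ⟨hx, -⟩, -⟩ := nonempty_of_measure_ne_zero h.ne'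
    exact closure_nonempty_iff.1 ⟨x, hx⟩
  -- The sign of `t` decides the side; `t = 0` would make both `f` and `s` vanish, against `f < s`
  -- on the nonempty `A`.
  rcases lt_trichotomy t 0 with ht | ht | ht
  · right
    constructor
    · intro x hx
      have := hfA x hx
      rw [hfx, hst] at this
      exact (mul_lt_mul_left_of_neg ht).1 this
    · intro x hx
      have := hfB x hx
      rw [hfx, hst] at this
      exact (mul_lt_mul_left_of_neg ht).1 this
  · obtain ⟨x, hx⟩ := hnA
    have := hfA x hx
    rw [hfx, hst, ht] at this
    simp at this
  · left
    constructor
    · intro x hx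
      have := hfA x hx
      rw [hfx, hst] at this
      exact lt_of_mul_lt_mul_left this ht.le
    · intro x hx
      have := hfB x hx
      rw [hfx, hst] at this
      exact lt_of_mul_lt_mul_left this ht.le

theorem hyperplane_neg (ν : Sp d) (c : ℝ) : hyperplane (-ν) (-c) = hyperplane ν c := by
  ext x
  simp [hyperplane]

/-- A convex set that contains a neighbourhood of `p` in a hyperplane and a point below it contains
the lower half of a neighbourhood of `p`. -/
theorem eventually_mem_of_inner_le {K : Set (Sp d)} (hK : Convex ℝ K) {ν p a : Sp d} {c : ℝ}
    (hp : p ∈ hyperplane ν c) (ha : a ∈ K) (hac : inner ℝ ν a < c)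
    (hev : ∀ᶠ q in nhdsWithin p (hyperplane ν c), q ∈ K) :
    ∀ᶠ x in nhds p, inner ℝ ν x ≤ c → x ∈ K := by
  have hp' : inner ℝ ν p = c := hp
  -- `q x`, defined below, is the central projection of `x` from `a` onto the hyperplane, and `x` is
  -- the combination of `q x` and `a` in which `a` has the weight `t x`, zero at `p`.
  set t : Sp d → ℝ := fun x => (c - inner ℝ ν x) / (c - inner ℝ ν a) with ht
  have hden : c - inner ℝ ν a ≠ 0 := by linarith
  have htc : Continuous t := by
    rw [ht]; fun_prop
  have ht0 : t p = 0 := by simp [ht, hp']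
  set q : Sp d → Sp d := fun x => (1 - t x)⁻¹ • (x - t x • a) with hq
  have hqp : q p = p := by simp [hq, ht0]
  have hqc : ContinuousAt q p := by
    have h1 : ContinuousAt (fun x => (1 - t x)⁻¹) p :=
      ContinuousAt.inv₀ (by fun_prop) (by simp [ht0])
    have h2 : ContinuousAt (fun x => x - t x • a) p := by fun_prop
    exact h1.smul h2
  have ht1 : ∀ᶠ x in nhds p, t x < 1 :=
    htc.continuousAt.eventually_lt continuousAt_const (by simp [ht0])
  have hqH : ∀ᶠ x in nhds p, q x ∈ hyperplane ν c := by
    filter_upwards [ht1] with x hx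
    have h1 : (1 - t x) ≠ 0 := by linarith
    simp only [hq, hyperplane, Set.mem_ofPred_eq, inner_smul_right, inner_sub_right]
    have h2 : t x * (c - inner ℝ ν a) = c - inner ℝ ν x := div_mul_cancel₀ _ hden
    rw [inv_mul_eq_iff_eq_mul₀ h1]
    linarith
  have hqK : ∀ᶠ x in nhds p, q x ∈ K := by
    have : Filter.Tendsto q (nhds p) (nhdsWithin p (hyperplane ν c)) := by
      refine tendsto_nhdsWithin_iff.2 ⟨?_, hqH⟩
      have := hqc.tendsto
      rwa [hqp] at this
    exact this.eventually hev
  filter_upwards [ht1, hqK] with x hx1 hxK hxc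
  have h0 : 0 ≤ t x := div_nonneg (by linarith) (by linarith)
  have h1 : (1 - t x) ≠ 0 := by linarith
  have : x = (1 - t x) • q x + t x • a := by
    simp only [hq]
    rw [smul_inv_smul₀ h1]
    abel
  rw [this]
  exact hK hxK ha (by linarith) h0 (by ring)

/-- Almost every point of the common face of two convex sets on different sides of a hyperplane
is an interior point of their union. -/
theorem surf_inter_diff_interior_union {K L : Set (Sp d)} (hK : Convex ℝ K) (hL : Convex ℝ L)
    {ν a b : Sp d} {c : ℝ} (hν : ν ≠ 0) (ha : a ∈ K) (hac : inner ℝ ν a < c) (hb : b ∈ L)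
    (hbc : c < inner ℝ ν b) :
    surf d ((K ∩ L ∩ (interior (K ∪ L))ᶜ) ∩ hyperplane ν c) = 0 := by
  obtain ⟨p, hp⟩ := hyperplane_nonempty hν c
  rw [surf_inter_hyperplane hν hp]
  set j : (Submodule.span ℝ {ν})ᗮ → Sp d := fun w => p + (w : Sp d) with hj
  have hiso : Isometry j := (isometry_add_left p).comp isometry_subtype_coe
  have hconv : Convex ℝ (j ⁻¹' (K ∩ L)) := by
    have : j ⁻¹' (K ∩ L) =
      (Submodule.subtype (Submodule.span ℝ {ν})ᗮ) ⁻¹' ((fun z => p + z) ⁻¹' (K ∩ L)) := rfl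
    rw [this]
    exact ((hK.inter hL).translate_preimage_right p).linear_preimage _
  -- Only the relative frontier of the convex common face is exceptional: at a relatively interior
  -- point `K` fills the lower and `L` the upper half of a neighbourhood.
  refine measure_mono_null ?_ (hconv.addHaar_frontier volume)
  rintro w ⟨hw, hwi⟩
  by_contra hfr
  have hint : w ∈ interior (j ⁻¹' (K ∩ L)) := by
    by_contra h
    exact hfr ⟨subset_closure hw, h⟩
  have hev : ∀ᶠ q in nhdsWithin (j w) (hyperplane ν c), q ∈ K ∩ L := by
    rw [← range_add_orthogonal hp, ← hiso.isEmbedding.map_nhds_eq]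
    exact Filter.eventually_map.2 (mem_interior_iff_mem_nhds.1 hint)
  have hjw : j w ∈ hyperplane ν c := by
    rw [← range_add_orthogonal hp]; exact ⟨w, rfl⟩
  have h1 := eventually_mem_of_inner_le hK hjw ha hac (hev.mono fun _ h => h.1)
  have h2 := eventually_mem_of_inner_le hL (ν := -ν) (c := -c) (by rwa [hyperplane_neg]) hb
    (by rw [inner_neg_left]; linarith) (by rw [hyperplane_neg]; exact hev.mono fun _ h => h.2)
  apply hwi
  rw [mem_interior_iff_mem_nhds]
  filter_upwards [h1, h2] with x hx1 hx2
  rcases le_total (inner ℝ ν x) c with h | h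
  · exact Or.inl (hx1 h)
  · exact Or.inr (hx2 (by rw [inner_neg_left]; linarith))

/-! ### Integration over cones. -/

/-- The part of the cone over `σ` with apex `x₀` that has heights in `δ I` above the apex in the
direction `ν`. -/
def cone (x₀ ν : Sp d) (δ : ℝ) (σ : Set (Sp d)) (I : Set ℝ) : Set (Sp d) :=
  {x | inner ℝ ν (x - x₀) / δ ∈ I ∧ x₀ + (inner ℝ ν (x - x₀) / δ)⁻¹ • (x - x₀) ∈ σ}

theorem measurableSet_cone (x₀ ν : Sp d) (δ : ℝ) {σ : Set (Sp d)} (hσ : MeasurableSet σ) {I : Set ℝ}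
    (hI : MeasurableSet I) : MeasurableSet (cone x₀ ν δ σ I) := by
  have h1 : Measurable fun x : Sp d => inner ℝ ν (x - x₀) / δ := by fun_prop
  have h2 : Measurable fun x : Sp d => x₀ + (inner ℝ ν (x - x₀) / δ)⁻¹ • (x - x₀) := by fun_prop
  exact (h1 hI).inter (h2 hσ)

/-- At relative height `t` the cone is the homothetic copy of `σ` with ratio `t`. Positive heights
exclude the apex, where the inverse would take its default value. -/
theorem cone_inter_slice {x₀ ν : Sp d} {δ : ℝ} (hν : ‖ν‖ = 1) (hδ : 0 < δ) {σ : Set (Sp d)}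
    (hσ : σ ⊆ hyperplane ν (inner ℝ ν x₀ + δ)) {I : Set ℝ} (hI : I ⊆ Set.Ioi 0) (A : Set (Sp d))
    (t : ℝ) (ht : t ∈ I) :
    A ∩ cone x₀ ν δ σ I ∩ AffineSubspace.mk' (t • (δ • ν) +ᵥ x₀) (Submodule.span ℝ {δ • ν})ᗮ =
      AffineMap.homothety x₀ t '' {y ∈ σ | x₀ + t • (y - x₀) ∈ A} := by
  have ht0 : t ≠ 0 := (hI ht).ne'
  have hνν : inner ℝ ν ν = 1 := by rw [real_inner_self_eq_norm_sq, hν]; norm_num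
  ext x
  simp only [Set.mem_inter_iff, SetLike.mem_coe, AffineSubspace.mem_mk', Set.mem_image,
    Set.mem_ofPred_eq, Submodule.mem_orthogonal_singleton_iff_inner_right, vsub_eq_sub, vadd_eq_add,
    AffineMap.homothety_apply, real_inner_smul_left]
  constructor
  · rintro ⟨⟨hxA, hxI, hxσ⟩, hx⟩
    have hxt : inner ℝ ν (x - x₀) / δ = t := by
      rcases mul_eq_zero.1 hx with h | h
      · exact absurd h hδ.ne'
      · rw [div_eq_iff hδ.ne']
        have : x - (t • δ • ν + x₀) = (x - x₀) - t • δ • ν := by abel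
        rw [this, inner_sub_right, inner_smul_right, inner_smul_right, hνν] at h
        linarith
    rw [hxt] at hxσ
    have hback : t • (x₀ + t⁻¹ • (x - x₀) - x₀) = x - x₀ := by
      rw [add_sub_cancel_left, smul_inv_smul₀ ht0]
    refine ⟨_, ⟨hxσ, ?_⟩, ?_⟩
    · rw [hback]; simpa using hxA
    · rw [hback]; simp
  · rintro ⟨y, ⟨hyσ, hyA⟩, rfl⟩
    have hy : inner ℝ ν y = inner ℝ ν x₀ + δ := hσ hyσ
    have h1 : inner ℝ ν (t • (y - x₀) + x₀ - x₀) / δ = t := by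
      rw [add_sub_cancel_right, inner_smul_right, inner_sub_right, hy]
      field_simp
      ring
    refine ⟨⟨by rwa [add_comm], ?_, ?_⟩, ?_⟩
    · rwa [h1]
    · rw [h1, add_sub_cancel_right, inv_smul_smul₀ ht0]
      simpa using hyσ
    · have : t • (y - x₀) + x₀ - (t • δ • ν + x₀) = t • (y - x₀) - t • δ • ν := by abel
      rw [this, inner_sub_right, inner_smul_right, inner_smul_right, inner_smul_right, hνν,
        inner_sub_right, hy]
      ring

theorem cone_inter_slice_of_notMem {x₀ ν : Sp d} {δ : ℝ} (hν : ‖ν‖ = 1) (hδ : 0 < δ)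
    {σ : Set (Sp d)} {I : Set ℝ} (A : Set (Sp d)) (t : ℝ) (ht : t ∉ I) :
    A ∩ cone x₀ ν δ σ I ∩ AffineSubspace.mk' (t • (δ • ν) +ᵥ x₀) (Submodule.span ℝ {δ • ν})ᗮ = ∅ := by
  have hνν : inner ℝ ν ν = 1 := by rw [real_inner_self_eq_norm_sq, hν]; norm_num
  rw [Set.eq_empty_iff_forall_notMem]
  rintro x ⟨⟨hxA, hxI, hxσ⟩, hx⟩
  apply ht
  convert hxI
  simp only [SetLike.mem_coe, AffineSubspace.mem_mk',
    Submodule.mem_orthogonal_singleton_iff_inner_right, vsub_eq_sub, vadd_eq_add,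
    real_inner_smul_left] at hx
  rcases mul_eq_zero.1 hx with h | h
  · exact absurd h hδ.ne'
  · rw [eq_div_iff hδ.ne']
    have : x - (t • δ • ν + x₀) = (x - x₀) - t • δ • ν := by abel
    rw [this, inner_sub_right, inner_smul_right, inner_smul_right, hνν] at h
    linarith

/-- Slice along `δ • ν`, so that `t = 1` is the plane of `σ`: the slicing vector contributes its
length `δ`, and the homothety with ratio `t` scales surface measure by `t ^ (d - 1)`. -/
theorem volume_inter_cone {x₀ ν : Sp d} {δ : ℝ} (hν : ‖ν‖ = 1) (hδ : 0 < δ) {σ : Set (Sp d)}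
    (hσm : MeasurableSet σ) (hσ : σ ⊆ hyperplane ν (inner ℝ ν x₀ + δ)) {I : Set ℝ}
    (hIm : MeasurableSet I) (hI : I ⊆ Set.Ioi 0) {A : Set (Sp d)} (hA : MeasurableSet A) :
    volume (A ∩ cone x₀ ν δ σ I) =
      ∫⁻ t in I, ENNReal.ofReal (δ * t ^ (d - 1)) * surf d {y ∈ σ | x₀ + t • (y - x₀) ∈ A} := by
  have hv : δ • ν ≠ 0 := smul_ne_zero hδ.ne' (by rintro rfl; simp at hν)
  have h := EuclideanGeometry.euclideanHausdorffMeasure_eq_lintegral x₀ hv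
    (hA.inter (measurableSet_cone x₀ ν δ hσm hIm))
  rw [InnerProductSpace.euclideanHausdorffMeasure_eq_volume] at h
  rw [h, ← lintegral_const_mul' _ _ enorm_ne_top, ← lintegral_indicator hIm]
  refine lintegral_congr fun t => ?_
  by_cases ht : t ∈ I
  · have ht0 : 0 < t := hI ht
    rw [Set.indicator_of_mem ht, cone_inter_slice hν hδ hσ hI A t ht, finrank_euclideanSpace_fin,
      euclideanHausdorffMeasure_homothety_image _ _ ht0.ne']
    rw [ENNReal.ofReal_mul hδ.le, mul_assoc, ENNReal.smul_def, smul_eq_mul]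
    congr 1
    · rw [enorm_smul, ← ofReal_norm ν, hν]
      simp [Real.enorm_eq_ofReal hδ.le]
    · congr 1
      rw [ENNReal.ofReal_pow ht0.le, ENNReal.coe_pow, ← Real.enorm_eq_ofReal ht0.le]
      rfl
  · rw [Set.indicator_of_notMem ht, cone_inter_slice_of_notMem hν hδ A t ht]
    simp

/-- Integration over a cone. -/
theorem setIntegral_cone {x₀ ν : Sp d} {δ : ℝ} (hν : ‖ν‖ = 1) (hδ : 0 < δ) {σ : Set (Sp d)}
    (hσc : IsCompact σ) (hσ : σ ⊆ hyperplane ν (inner ℝ ν x₀ + δ)) {r : ℝ} (hr : 0 ≤ r) (hr1 : r ≤ 1)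
    {f : Sp d → ℝ} (hf : Continuous f) :
    IntegrableOn f (cone x₀ ν δ σ (Set.Ioo r 1)) ∧
    ∫ x in cone x₀ ν δ σ (Set.Ioo r 1), f x =
      ∫ t in r..1, δ * (t ^ (d - 1) * ∫ y in σ, f (x₀ + t • (y - x₀)) ∂(surf d)) := by
  have hν0 : ν ≠ 0 := by rintro rfl; simp at hν
  have hI : Set.Ioo r 1 ⊆ Set.Ioi 0 := fun t ht => hr.trans_lt ht.1
  have hfin : surf d σ < ⊤ := surf_lt_top hν0 hσc.isBounded hσ
  have : IsFiniteMeasure ((surf d).restrict σ) := ⟨by rwa [Measure.restrict_apply_univ]⟩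
  set ρ : Measure ℝ := (volume.restrict (Set.Ioo r 1)).withDensity
    (fun t => ENNReal.ofReal (δ * t ^ (d - 1))) with hρ
  have hdm : Measurable fun t : ℝ => ENNReal.ofReal (δ * t ^ (d - 1)) := by fun_prop
  set Φ : ℝ × Sp d → Sp d := fun p => x₀ + p.1 • (p.2 - x₀) with hΦ
  have hΦc : Continuous Φ := by fun_prop
  -- Volume on the cone is the image of `δ t^(d-1) dt` times surface measure under `Φ`; the formula
  -- is then a change of variables followed by Fubini.
  have hmap : volume.restrict (cone x₀ ν δ σ (Set.Ioo r 1)) =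
      Measure.map Φ (ρ.prod ((surf d).restrict σ)) := by
    ext A hA
    rw [Measure.restrict_apply hA, volume_inter_cone hν hδ hσc.measurableSet hσ measurableSet_Ioo
      hI hA, Measure.map_apply hΦc.measurable hA, Measure.prod_apply (hΦc.measurable hA), hρ,
      lintegral_withDensity_eq_lintegral_mul _ hdm]
    · refine lintegral_congr fun t => ?_
      simp only [Pi.mul_apply]
      congr 1
      rw [Measure.restrict_apply]
      · congr 1
        ext y
        simp [hΦ, and_comm]
      · exact (hΦc.measurable.comp measurable_prodMk_left) hA
    · exact measurable_measure_prodMk_left (hΦc.measurable hA)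
  have hbd : IsCompact (Φ '' (Set.Icc r 1 ×ˢ σ)) := (isCompact_Icc.prod hσc).image hΦc
  have hint : IntegrableOn f (cone x₀ ν δ σ (Set.Ioo r 1)) := by
    refine (hf.continuousOn.integrableOn_compact hbd).mono_set ?_
    rintro x ⟨hx1, hx2⟩
    refine ⟨(_, _), ⟨Set.Ioo_subset_Icc_self hx1, hx2⟩, ?_⟩
    simp only [hΦ, add_sub_cancel_left]
    rw [smul_inv_smul₀ (hI hx1).ne']
    abel
  refine ⟨hint, ?_⟩
  rw [hmap, integral_map hΦc.measurable.aemeasurable hf.aestronglyMeasurable, integral_prod]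
  · rw [hρ, integral_withDensity_eq_integral_toReal_smul hdm (by simp),
      intervalIntegral.integral_of_le hr1, integral_Ioc_eq_integral_Ioo]
    refine setIntegral_congr_fun measurableSet_Ioo fun t ht => ?_
    have : 0 ≤ δ * t ^ (d - 1) := mul_nonneg hδ.le (pow_nonneg (hI ht).le _)
    simp only [ENNReal.toReal_ofReal this, smul_eq_mul, hΦ]
    ring
  · have := hint
    rw [IntegrableOn, hmap, integrable_map_measure hf.aestronglyMeasurable
      hΦc.measurable.aemeasurable] at this
    exact this

theorem volume_cone_of_null {x₀ ν : Sp d} {δ : ℝ} (hν : ‖ν‖ = 1) (hδ : 0 < δ) {σ : Set (Sp d)}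
    (hσm : MeasurableSet σ) (hσ : σ ⊆ hyperplane ν (inner ℝ ν x₀ + δ)) {I : Set ℝ}
    (hIm : MeasurableSet I) (hI : I ⊆ Set.Ioi 0) (h0 : surf d σ = 0) :
    volume (cone x₀ ν δ σ I) = 0 := by
  have := volume_inter_cone hν hδ hσm hσ hIm hI MeasurableSet.univ
  rw [Set.univ_inter] at this
  rw [this]
  simp [h0]

theorem continuous_faceIntegral {x₀ ν : Sp d} {c : ℝ} (hν : ν ≠ 0) {σ : Set (Sp d)}
    (hσc : IsCompact σ) (hσ : σ ⊆ hyperplane ν c) {f : Sp d → ℝ} (hf : Continuous f) :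
    Continuous fun t : ℝ => t ^ (d - 1) * ∫ y in σ, f (x₀ + t • (y - x₀)) ∂(surf d) := by
  have hfin : surf d σ < ⊤ := surf_lt_top hν hσc.isBounded hσ
  have : IsFiniteMeasure ((surf d).restrict σ) := ⟨by rwa [Measure.restrict_apply_univ]⟩
  refine (continuous_pow _).mul ?_
  have := continuous_parametric_integral_of_continuous (μ := (surf d).restrict σ)
    (f := fun (t : ℝ) (y : Sp d) => f (x₀ + t • (y - x₀))) (by fun_prop) hσc
  simpa [Measure.restrict_restrict hσc.measurableSet] using this

/-! ### Convex polytopes and their gauge. -/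

/-- The open polytope `C` has the faces `σ a` with the outer unit normals `ν a`. -/
structure HasFaces {ι : Type*} (C : Set (Sp d)) (ν : ι → Sp d) (c : ι → ℝ) (σ : ι → Set (Sp d)) :
    Prop where
  isOpen : IsOpen C
  convex : Convex ℝ C
  nonempty : C.Nonempty
  isBounded : Bornology.IsBounded C
  norm_normal : ∀ a, ‖ν a‖ = 1
  inner_lt : ∀ a, ∀ x ∈ C, inner ℝ (ν a) x < c a
  isClosed : ∀ a, IsClosed (σ a)
  subset : ∀ a, σ a ⊆ hyperplane (ν a) (c a)
  frontier_eq : frontier C = ⋃ a, σ a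
  null : ∀ a b, a ≠ b → surf d (σ a ∩ σ b) = 0

namespace HasFaces

variable {ι : Type*} {C : Set (Sp d)} {ν : ι → Sp d} {c : ι → ℝ} {σ : ι → Set (Sp d)}

theorem isCompact_face (h : HasFaces C ν c σ) (a : ι) : IsCompact (σ a) := by
  refine Metric.isCompact_of_isClosed_isBounded (h.isClosed a) (h.isBounded.closure.subset ?_)
  refine Set.Subset.trans ?_ frontier_subset_closure
  rw [h.frontier_eq]
  exact Set.subset_iUnion σ a

/-- The gauge of `C` with respect to the centre `x₀`. -/
def rho (C : Set (Sp d)) (x₀ x : Sp d) : ℝ := gauge ((fun z => x₀ + z) ⁻¹' C) (x - x₀)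

theorem preimage_mem_nhds (h : HasFaces C ν c σ) {x₀ : Sp d} (hx₀ : x₀ ∈ C) :
    (fun z => x₀ + z) ⁻¹' C ∈ nhds (0 : Sp d) := by
  refine (h.isOpen.preimage (by fun_prop)).mem_nhds ?_
  simpa using hx₀

theorem rho_nonneg (C : Set (Sp d)) (x₀ x : Sp d) : 0 ≤ rho C x₀ x := gauge_nonneg _

theorem rho_lipschitz (h : HasFaces C ν c σ) {x₀ : Sp d} (hx₀ : x₀ ∈ C) :
    ∃ D, LipschitzWith D (rho C x₀) := by
  obtain ⟨D, hD⟩ := (h.convex.translate_preimage_right x₀).lipschitz_gauge (h.preimage_mem_nhds hx₀)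
  refine ⟨D, LipschitzWith.of_dist_le_mul fun x y => ?_⟩
  have := hD.dist_le_mul (x - x₀) (y - x₀)
  rwa [dist_sub_right] at this

theorem rho_lt_one_iff (h : HasFaces C ν c σ) {x₀ x : Sp d} (hx₀ : x₀ ∈ C) :
    rho C x₀ x < 1 ↔ x ∈ C := by
  have := gauge_lt_one_iff_mem_interior (h.convex.translate_preimage_right x₀)
    (h.preimage_mem_nhds hx₀) (x := x - x₀)
  rw [rho, this, (h.isOpen.preimage (by fun_prop)).interior_eq]
  simp

theorem rho_eq_one_iff (h : HasFaces C ν c σ) {x₀ x : Sp d} (hx₀ : x₀ ∈ C) :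
    rho C x₀ x = 1 ↔ x ∈ frontier C := by
  have := gauge_eq_one_iff_mem_frontier (h.convex.translate_preimage_right x₀)
    (h.preimage_mem_nhds hx₀) (x := x - x₀)
  rw [rho, this]
  have h2 := (Homeomorph.addLeft x₀).preimage_frontier C
  rw [Homeomorph.coe_addLeft] at h2
  rw [← h2]
  simp

theorem rho_homothety (C : Set (Sp d)) (x₀ y : Sp d) {t : ℝ} (ht : 0 ≤ t) :
    rho C x₀ (x₀ + t • (y - x₀)) = t * rho C x₀ y := by
  rw [rho, rho, add_sub_cancel_left, gauge_smul_of_nonneg ht, smul_eq_mul]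

theorem height_pos (h : HasFaces C ν c σ) {x₀ : Sp d} (hx₀ : x₀ ∈ C) (a : ι) :
    0 < c a - inner ℝ (ν a) x₀ := sub_pos.2 (h.inner_lt a x₀ hx₀)

/-- Scaling by any factor above the gauge brings `x` into `C`, which lies below the plane of the
face. -/
theorem inner_div_le_rho (h : HasFaces C ν c σ) {x₀ : Sp d} (hx₀ : x₀ ∈ C) (a : ι) (x : Sp d) :
    inner ℝ (ν a) (x - x₀) / (c a - inner ℝ (ν a) x₀) ≤ rho C x₀ x := by
  have hδ := h.height_pos hx₀ a
  refine le_of_forall_gt_imp_ge_of_dense fun s hs => ?_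
  have hs0 : 0 < s := (rho_nonneg C x₀ x).trans_lt hs
  have h1 : rho C x₀ (x₀ + s⁻¹ • (x - x₀)) < 1 := by
    rw [rho_homothety _ _ _ (inv_nonneg.2 hs0.le), inv_mul_lt_iff₀ hs0]
    simpa using hs
  rw [h.rho_lt_one_iff hx₀] at h1
  have h2 := h.inner_lt a _ h1
  rw [inner_add_right, inner_smul_right, ← lt_sub_iff_add_lt', inv_mul_lt_iff₀ hs0] at h2
  rw [div_le_iff₀ hδ]
  exact h2.le

/-- Over a face the relative height is the gauge, since the gauge is homogeneous and equals `1` on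
the frontier. Hence the cones over the faces cover the shell described by `I`. -/
theorem mem_cone_iff (h : HasFaces C ν c σ) {x₀ : Sp d} (hx₀ : x₀ ∈ C) (a : ι) {I : Set ℝ}
    (hI : I ⊆ Set.Ioi 0) (x : Sp d) :
    x ∈ cone x₀ (ν a) (c a - inner ℝ (ν a) x₀) (σ a) I ↔
      rho C x₀ x ∈ I ∧ x₀ + (rho C x₀ x)⁻¹ • (x - x₀) ∈ σ a := by
  have hδ := h.height_pos hx₀ a
  constructor
  · rintro ⟨h1, h2⟩
    set t := inner ℝ (ν a) (x - x₀) / (c a - inner ℝ (ν a) x₀) with ht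
    have ht0 : 0 < t := hI h1
    have h3 : rho C x₀ (x₀ + t⁻¹ • (x - x₀)) = 1 := by
      rw [h.rho_eq_one_iff hx₀, h.frontier_eq]
      exact Set.mem_iUnion_of_mem a h2
    rw [rho_homothety _ _ _ (inv_nonneg.2 ht0.le), inv_mul_eq_one₀ ht0.ne'] at h3
    rw [← h3]
    exact ⟨h1, h2⟩
  · rintro ⟨h1, h2⟩
    have ht0 : 0 < rho C x₀ x := hI h1
    have h3 : inner ℝ (ν a) (x - x₀) / (c a - inner ℝ (ν a) x₀) = rho C x₀ x := by
      have h4 : inner ℝ (ν a) (x₀ + (rho C x₀ x)⁻¹ • (x - x₀)) = c a := h.subset a h2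
      rw [inner_add_right, inner_smul_right] at h4
      rw [div_eq_iff hδ.ne', ← h4]
      field_simp
      ring
    rw [cone, Set.mem_ofPred_eq, h3]
    exact ⟨h1, h2⟩

end HasFaces

/-! ### Gauge cutoffs and Gauss' theorem on polytopes. -/

namespace HasFaces

variable {ι : Type*} {C : Set (Sp d)} {ν : ι → Sp d} {c : ι → ℝ} {σ : ι → Set (Sp d)}

/-- The cutoff function that is `1` where the gauge is at most `r`, `0` outside `C`, and affine in
the gauge in between. -/
def cutoff (C : Set (Sp d)) (x₀ : Sp d) (r : ℝ) (x : Sp d) : ℝ :=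
  max (min ((1 - r)⁻¹ * (1 - rho C x₀ x)) 1) 0

theorem cutoff_nonneg (C : Set (Sp d)) (x₀ : Sp d) (r : ℝ) (x : Sp d) : 0 ≤ cutoff C x₀ r x :=
  le_max_right _ _

theorem cutoff_le_one (C : Set (Sp d)) (x₀ : Sp d) (r : ℝ) (x : Sp d) : cutoff C x₀ r x ≤ 1 :=
  max_le (min_le_right _ _) zero_le_one

theorem cutoff_eq_one {C : Set (Sp d)} {x₀ x : Sp d} {r : ℝ} (hr : r < 1) (hx : rho C x₀ x ≤ r) :
    cutoff C x₀ r x = 1 := by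
  have : 1 ≤ (1 - r)⁻¹ * (1 - rho C x₀ x) := by
    rw [inv_mul_eq_div, one_le_div (by linarith)]
    linarith
  rw [cutoff, min_eq_right this, max_eq_left zero_le_one]

theorem cutoff_eq_zero {C : Set (Sp d)} {x₀ x : Sp d} {r : ℝ} (hr : r < 1) (hx : 1 ≤ rho C x₀ x) :
    cutoff C x₀ r x = 0 := by
  refine max_eq_right ((min_le_left _ _).trans ?_)
  exact mul_nonpos_of_nonneg_of_nonpos (inv_nonneg.2 (by linarith)) (by linarith)

theorem cutoff_eq_of_mem {C : Set (Sp d)} {x₀ x : Sp d} {r : ℝ}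
    (hx : rho C x₀ x ∈ Set.Ioo r 1) : cutoff C x₀ r x = (1 - r)⁻¹ * (1 - rho C x₀ x) := by
  have hr : r < 1 := hx.1.trans hx.2
  rw [cutoff, min_eq_left, max_eq_left]
  · exact mul_nonneg (inv_nonneg.2 (by linarith)) (by linarith [hx.2])
  · rw [inv_mul_eq_div, div_le_one (by linarith)]
    linarith [hx.1]

theorem cutoff_lipschitz (h : HasFaces C ν c σ) {x₀ : Sp d} (hx₀ : x₀ ∈ C) (r : ℝ) :
    ∃ D, LipschitzWith D (cutoff C x₀ r) := by
  obtain ⟨D, hD⟩ := h.rho_lipschitz hx₀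
  have h1 : LipschitzWith (‖(1 - r)⁻¹‖₊ * D) fun x => (1 - r)⁻¹ * (1 - rho C x₀ x) := by
    refine LipschitzWith.of_dist_le_mul fun x y => ?_
    have := hD.dist_le_mul x y
    rw [Real.dist_eq] at this ⊢
    rw [← mul_sub, abs_mul]
    have h2 : |1 - rho C x₀ x - (1 - rho C x₀ y)| = |rho C x₀ x - rho C x₀ y| := by
      rw [abs_sub_comm]; congr 1; ring
    rw [h2, NNReal.coe_mul, coe_nnnorm, Real.norm_eq_abs, mul_assoc]
    gcongr
  exact ⟨_, (h1.min_const 1).max_const 0⟩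

theorem cutoff_hasCompactSupport (h : HasFaces C ν c σ) {x₀ : Sp d} (hx₀ : x₀ ∈ C) {r : ℝ}
    (hr : r < 1) : HasCompactSupport (cutoff C x₀ r) := by
  refine HasCompactSupport.intro h.isBounded.isCompact_closure fun x hx => cutoff_eq_zero hr ?_
  by_contra hlt
  exact hx (subset_closure ((h.rho_lt_one_iff hx₀).1 (not_le.1 hlt)))

/-- The cutoff attains its maximum `1` or its minimum `0` there, and Fermat's rule applies whether
or not it is differentiable. -/
theorem fderiv_cutoff_eq_zero {C : Set (Sp d)} {x₀ x : Sp d} {r : ℝ} (hr : r < 1)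
    (hx : rho C x₀ x ∉ Set.Ioo r 1) : fderiv ℝ (cutoff C x₀ r) x = 0 := by
  rw [Set.mem_Ioo, not_and_or, not_lt, not_lt] at hx
  rcases hx with hx | hx
  · refine IsLocalMax.fderiv_eq_zero (Filter.Eventually.of_forall fun y => ?_)
    rw [cutoff_eq_one hr hx]
    exact cutoff_le_one _ _ _ _
  · refine IsLocalMin.fderiv_eq_zero (Filter.Eventually.of_forall fun y => ?_)
    rw [cutoff_eq_zero hr hx]
    exact cutoff_nonneg _ _ _ _

theorem fderiv_cutoff_of_mem_cone (h : HasFaces C ν c σ) {x₀ x : Sp d} (hx₀ : x₀ ∈ C) {r : ℝ}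
    (hr0 : 0 ≤ r) (hr : r < 1) (a : ι)
    (hx : x ∈ cone x₀ (ν a) (c a - inner ℝ (ν a) x₀) (σ a) (Set.Ioo r 1))
    (hd : DifferentiableAt ℝ (cutoff C x₀ r) x) (v : Sp d) :
    fderiv ℝ (cutoff C x₀ r) x v =
      -((1 - r)⁻¹ * (inner ℝ (ν a) v / (c a - inner ℝ (ν a) x₀))) := by
  have hI : Set.Ioo r 1 ⊆ Set.Ioi 0 := fun t ht => hr0.trans_lt ht.1
  have hx2 := (h.mem_cone_iff hx₀ a hI x).1 hx
  set δ := c a - inner ℝ (ν a) x₀ with hδ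
  set ℓ : Sp d → ℝ := fun y => (1 - r)⁻¹ * (1 - inner ℝ (ν a) (y - x₀) / δ) with hℓ
  have hlin : HasFDerivAt ℓ ((1 - r)⁻¹ • -(δ⁻¹ • innerSL ℝ (ν a))) x := by
    have h1 : HasFDerivAt (fun y : Sp d => inner ℝ (ν a) (y - x₀)) (innerSL ℝ (ν a)) x := by
      have := (innerSL ℝ (ν a)).hasFDerivAt (x := x - x₀)
      exact this.comp x ((hasFDerivAt_id x).sub_const x₀)
    exact ((h1.mul_const δ⁻¹).const_sub 1).const_mul (1 - r)⁻¹
  have hpos : 0 < (1 - r)⁻¹ := inv_pos.2 (by linarith)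
  have hxρ : inner ℝ (ν a) (x - x₀) / δ = rho C x₀ x := by
    have h4 : inner ℝ (ν a) (x₀ + (rho C x₀ x)⁻¹ • (x - x₀)) = c a := h.subset a hx2.2
    have hρ0 : 0 < rho C x₀ x := hI hx2.1
    rw [inner_add_right, inner_smul_right] at h4
    have hδ0 : δ ≠ 0 := (h.height_pos hx₀ a).ne'
    rw [div_eq_iff hδ0, hδ, ← h4]
    field_simp
    ring
  -- The cutoff stays below the affine function `ℓ` near `x` and touches it at `x`, so
  -- differentiability forces equal derivatives. It does not matter whether `x` is interior to its
  -- cone.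
  have hmax : IsLocalMax (fun y => cutoff C x₀ r y - ℓ y) x := by
    have hev : ∀ᶠ y in nhds x, 0 ≤ ℓ y := by
      have h0 : 0 < ℓ x := mul_pos hpos (by rw [hxρ]; linarith [hx2.1.2])
      filter_upwards [hlin.continuousAt.eventually_const_lt h0] with y hy using hy.le
    filter_upwards [hev] with y hy
    have e1 : cutoff C x₀ r x = ℓ x := by
      rw [cutoff_eq_of_mem hx2.1, hℓ]
      simp only [hxρ]
    rw [e1, sub_self, sub_nonpos]
    refine max_le ((min_le_left _ _).trans ?_) hy
    have := h.inner_div_le_rho hx₀ a y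
    simp only [hℓ]
    gcongr
  have h0 := hmax.hasFDerivAt_eq_zero (hd.hasFDerivAt.sub hlin)
  rw [sub_eq_zero] at h0
  rw [h0]
  simp [div_eq_inv_mul]

variable [Fintype ι]

theorem lineDeriv_cutoff_ae (h : HasFaces C ν c σ) {x₀ : Sp d} (hx₀ : x₀ ∈ C) {r : ℝ} (hr0 : 0 ≤ r)
    (hr : r < 1) (v : Sp d) (g : Sp d → ℝ) :
    (fun x => lineDeriv ℝ (cutoff C x₀ r) x (-v) * g x) =ᵐ[volume]
      fun x => ∑ a, (cone x₀ (ν a) (c a - inner ℝ (ν a) x₀) (σ a) (Set.Ioo r 1)).indicator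
        (fun x => (1 - r)⁻¹ * (inner ℝ (ν a) v / (c a - inner ℝ (ν a) x₀)) * g x) x := by
  classical
  have hI : Set.Ioo r 1 ⊆ Set.Ioi 0 := fun t ht => hr0.trans_lt ht.1
  obtain ⟨D, hD⟩ := h.cutoff_lipschitz hx₀ r
  -- Two cones overlap in the cone over a null set, so almost every point lies in at most one of
  -- them.
  have hnull : ∀ᵐ x : Sp d, ∀ a b, a ≠ b →
      x ∉ cone x₀ (ν a) (c a - inner ℝ (ν a) x₀) (σ a ∩ σ b) (Set.Ioo r 1) := by
    rw [ae_all_iff]; intro a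
    rw [ae_all_iff]; intro b
    by_cases hab : a = b
    · exact Filter.Eventually.of_forall fun x hne => absurd hab hne
    have : volume (cone x₀ (ν a) (c a - inner ℝ (ν a) x₀) (σ a ∩ σ b) (Set.Ioo r 1)) = 0 := by
      refine volume_cone_of_null (h.norm_normal a) (h.height_pos hx₀ a)
        ((h.isClosed a).inter (h.isClosed b)).measurableSet ?_ measurableSet_Ioo hI (h.null a b hab)
      rw [add_sub_cancel]
      exact Set.inter_subset_left.trans (h.subset a)
    filter_upwards [measure_eq_zero_iff_ae_notMem.1 this] with x hx _ using hx
  filter_upwards [hD.ae_differentiableAt (μ := volume), hnull] with x hx hxn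
  rw [hx.lineDeriv_eq_fderiv]
  by_cases hρ : rho C x₀ x ∈ Set.Ioo r 1
  · have hpos : 0 < rho C x₀ x := hI hρ
    have h1 : x₀ + (rho C x₀ x)⁻¹ • (x - x₀) ∈ frontier C := by
      rw [← h.rho_eq_one_iff hx₀, rho_homothety _ _ _ (inv_nonneg.2 hpos.le),
        inv_mul_cancel₀ hpos.ne']
    rw [h.frontier_eq] at h1
    obtain ⟨a, ha⟩ := Set.mem_iUnion.1 h1
    have hxa := (h.mem_cone_iff hx₀ a hI x).2 ⟨hρ, ha⟩
    rw [Finset.sum_eq_single a]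
    · rw [Set.indicator_of_mem hxa, map_neg, h.fderiv_cutoff_of_mem_cone hx₀ hr0 hr a hxa hx,
        neg_neg]
    · intro b _ hba
      refine Set.indicator_of_notMem (fun hxb => hxn a b hba.symm ?_) _
      exact ⟨hxa.1, hxa.2, by
        have e1 := ((h.mem_cone_iff hx₀ b hI x).1 hxb).2
        have e2 : inner ℝ (ν a) (x - x₀) / (c a - inner ℝ (ν a) x₀) = rho C x₀ x := by
          have h4 : inner ℝ (ν a) (x₀ + (rho C x₀ x)⁻¹ • (x - x₀)) = c a := h.subset a ha
          rw [inner_add_right, inner_smul_right] at h4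
          rw [div_eq_iff (h.height_pos hx₀ a).ne', ← h4]
          field_simp
          ring
        rwa [e2]⟩
    · intro hna; exact absurd (Finset.mem_univ a) hna
  · rw [fderiv_cutoff_eq_zero hr hρ]
    symm
    simp only [zero_apply, zero_mul]
    refine Finset.sum_eq_zero fun a _ => Set.indicator_of_notMem (fun hxa => hρ ?_) _
    exact ((h.mem_cone_iff hx₀ a hI x).1 hxa).1

/-- After integration by parts only the derivative of the cutoff remains. It lives on the shell and
is constant on each cone, where its denominator cancels the factor `δ` of `setIntegral_cone`. -/
theorem integral_lineDeriv_mul_cutoff (h : HasFaces C ν c σ) {x₀ : Sp d} (hx₀ : x₀ ∈ C) {r : ℝ}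
    (hr0 : 0 ≤ r) (hr : r < 1) (v : Sp d) {g : Sp d → ℝ} {D : NNReal} (hg : LipschitzWith D g) :
    ∫ x, lineDeriv ℝ g x v * cutoff C x₀ r x =
      (1 - r)⁻¹ * ∫ t in r..1, ∑ a, inner ℝ (ν a) v *
        (t ^ (d - 1) * ∫ y in σ a, g (x₀ + t • (y - x₀)) ∂(surf d)) := by
  obtain ⟨D', hD'⟩ := h.cutoff_lipschitz hx₀ r
  rw [hg.integral_lineDeriv_mul_eq hD' (h.cutoff_hasCompactSupport hx₀ hr),
    integral_congr_ae (h.lineDeriv_cutoff_ae hx₀ hr0 hr v g)]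
  have key : ∀ a, IntegrableOn g (cone x₀ (ν a) (c a - inner ℝ (ν a) x₀) (σ a) (Set.Ioo r 1)) ∧ _ :=
    fun a => setIntegral_cone (h.norm_normal a) (h.height_pos hx₀ a) (h.isCompact_face a)
      (by rw [add_sub_cancel]; exact h.subset a) hr0 hr.le hg.continuous
  have hm : ∀ a, MeasurableSet (cone x₀ (ν a) (c a - inner ℝ (ν a) x₀) (σ a) (Set.Ioo r 1)) :=
    fun a => measurableSet_cone _ _ _ (h.isClosed a).measurableSet measurableSet_Ioo
  rw [integral_finsetSum]
  · rw [intervalIntegral.integral_finsetSum, Finset.mul_sum]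
    · refine Finset.sum_congr rfl fun a _ => ?_
      rw [integral_indicator (hm a), integral_const_mul, (key a).2,
        intervalIntegral.integral_const_mul, intervalIntegral.integral_const_mul]
      have := (h.height_pos hx₀ a).ne'
      field_simp
    · intro a _
      have hν0 : ν a ≠ 0 := by
        intro h0; have := h.norm_normal a; simp [h0] at this
      exact ((continuous_faceIntegral hν0 (h.isCompact_face a) (h.subset a)
        hg.continuous).const_mul _).intervalIntegrable _ _
  · intro a _
    exact (integrable_indicator_iff (hm a)).2 (Integrable.const_mul (key a).1 _)

/-- Gauss' theorem for a Lipschitz function on a polytope. -/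
theorem integral_lineDeriv (h : HasFaces C ν c σ) (v : Sp d) {g : Sp d → ℝ} {D : NNReal}
    (hg : LipschitzWith D g) :
    ∫ x in C, lineDeriv ℝ g x v = ∑ a, inner ℝ (ν a) v * ∫ y in σ a, g y ∂(surf d) := by
  obtain ⟨x₀, hx₀⟩ := h.nonempty
  set A : ℝ → ℝ := fun t => ∑ a, inner ℝ (ν a) v *
        (t ^ (d - 1) * ∫ y in σ a, g (x₀ + t • (y - x₀)) ∂(surf d)) with hA
  have hAc : Continuous A := by
    refine continuous_finsetSum _ fun a _ => ?_
    have hν0 : ν a ≠ 0 := by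
      intro h0; have := h.norm_normal a; simp [h0] at this
    exact (continuous_faceIntegral hν0 (h.isCompact_face a) (h.subset a) hg.continuous).const_mul _
  have hA1 : A 1 = ∑ a, inner ℝ (ν a) v * ∫ y in σ a, g y ∂(surf d) := by simp [hA]
  -- The mean of the continuous `A` over `(r, 1)` is a difference quotient of its primitive and
  -- tends to `A 1`.
  have hlim1 : Filter.Tendsto (fun r => (1 - r)⁻¹ * ∫ t in r..1, A t) (nhdsWithin 1 (Set.Iio 1))
      (nhds (A 1)) := by
    have hder : HasDerivAt (fun r => ∫ t in r..1, A t) (-A 1) 1 :=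
      intervalIntegral.integral_hasDerivAt_left (hAc.intervalIntegrable _ _)
        hAc.aestronglyMeasurable.stronglyMeasurableAtFilter hAc.continuousAt
    have h1 := (hasDerivAt_iff_tendsto_slope.1 hder).neg
    rw [neg_neg] at h1
    refine (h1.mono_left (nhdsWithin_mono _ fun x hx => ne_of_lt hx)).congr fun r => ?_
    rw [slope_def_field, intervalIntegral.integral_same, sub_zero, div_eq_inv_mul, ← neg_mul,
      ← inv_neg, neg_sub]
  -- As `r → 1` the cutoffs converge to the indicator of the open set `C`, dominated by the
  -- Lipschitz bound.
  have hlim2 : Filter.Tendsto (fun r => ∫ x, lineDeriv ℝ g x v * cutoff C x₀ r x)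
      (nhdsWithin 1 (Set.Iio 1)) (nhds (∫ x in C, lineDeriv ℝ g x v)) := by
    rw [← integral_indicator h.isOpen.measurableSet]
    have hfin : volume C < ⊤ := h.isBounded.measure_lt_top
    refine tendsto_integral_filter_of_dominated_convergence
      (C.indicator fun _ => (D : ℝ) * ‖v‖) ?_ ?_ ?_ ?_
    · refine Filter.Eventually.of_forall fun r => ?_
      obtain ⟨D', hD'⟩ := h.cutoff_lipschitz hx₀ r
      exact (aestronglyMeasurable_lineDeriv hg.continuous volume).mul
        hD'.continuous.aestronglyMeasurable
    · filter_upwards [self_mem_nhdsWithin] with r hr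
      refine Filter.Eventually.of_forall fun x => ?_
      by_cases hx : x ∈ C
      · rw [Set.indicator_of_mem hx, norm_mul]
        have h1 := norm_lineDeriv_le_of_lipschitz ℝ hg (x₀ := x) (v := v)
        have h2 : ‖cutoff C x₀ r x‖ ≤ 1 := by
          rw [Real.norm_eq_abs, abs_of_nonneg (cutoff_nonneg _ _ _ _)]
          exact cutoff_le_one _ _ _ _
        calc _ ≤ (D * ‖v‖) * 1 := by gcongr
          _ = _ := mul_one _
      · rw [Set.indicator_of_notMem hx, cutoff_eq_zero hr]
        · simp
        · by_contra hlt
          exact hx ((h.rho_lt_one_iff hx₀).1 (not_le.1 hlt))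
    · exact (integrableOn_const hfin.ne).integrable_indicator h.isOpen.measurableSet
    · refine Filter.Eventually.of_forall fun x => ?_
      by_cases hx : x ∈ C
      · rw [Set.indicator_of_mem hx]
        have hlt := (h.rho_lt_one_iff hx₀).2 hx
        refine tendsto_const_nhds.congr' ?_
        filter_upwards [Ioo_mem_nhdsLT hlt] with r hr
        rw [cutoff_eq_one hr.2 hr.1.le, mul_one]
      · rw [Set.indicator_of_notMem hx]
        refine tendsto_const_nhds.congr' ?_
        filter_upwards [self_mem_nhdsWithin] with r hr
        rw [cutoff_eq_zero hr, mul_zero]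
        by_contra hlt
        exact hx ((h.rho_lt_one_iff hx₀).1 (not_le.1 hlt))
  rw [← hA1]
  refine tendsto_nhds_unique hlim2 (hlim1.congr' ?_)
  filter_upwards [Ioo_mem_nhdsLT (show (0 : ℝ) < 1 by norm_num)] with r hr
  exact (h.integral_lineDeriv_mul_cutoff hx₀ hr.1.le hr.2 v hg).symm

/-- The divergence theorem on a polytope. -/
theorem integral_divergence (h : HasFaces C ν c σ) {F : Sp d → Sp d} {D : NNReal}
    (hF : LipschitzOnWith D F (closure C)) (hdiff : DifferentiableOn ℝ F C) :
    ∫ x in C, divergence F x = ∑ a, ∫ y in σ a, inner ℝ (F y) (ν a) ∂(surf d) := by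
  have hcomp : ∀ k : Fin d, LipschitzOnWith D (fun x => F x k) (closure C) := by
    intro k
    refine LipschitzOnWith.of_dist_le_mul fun x hx y hy => ?_
    refine le_trans ?_ (hF.dist_le_mul x hx y hy)
    rw [dist_eq_norm, dist_eq_norm]
    exact PiLp.norm_apply_le (F x - F y) k
  -- Extending each component to a Lipschitz function on the whole space changes neither the
  -- derivatives in the open `C` nor the values on the faces.
  choose g hgL hgE using fun k => (hcomp k).extend_real
  have hσC : ∀ a, σ a ⊆ closure C := fun a => by
    refine Set.Subset.trans ?_ frontier_subset_closure
    rw [h.frontier_eq]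
    exact Set.subset_iUnion σ a
  have h1 : ∀ x ∈ C, divergence F x = ∑ k, lineDeriv ℝ (g k) x (EuclideanSpace.single k 1) := by
    intro x hx
    refine Finset.sum_congr rfl fun k _ => ?_
    have hFd : HasFDerivAt F (fderiv ℝ F x) x :=
      (hdiff.differentiableAt (h.isOpen.mem_nhds hx)).hasFDerivAt
    have hk : HasFDerivAt (fun z => F z k)
        ((EuclideanSpace.proj k : Sp d →L[ℝ] ℝ).comp (fderiv ℝ F x)) x :=
      (EuclideanSpace.proj k : Sp d →L[ℝ] ℝ).hasFDerivAt.comp x hFd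
    have hgk : HasFDerivAt (g k) ((EuclideanSpace.proj k : Sp d →L[ℝ] ℝ).comp (fderiv ℝ F x)) x := by
      refine hk.congr_of_eventuallyEq ?_
      filter_upwards [h.isOpen.mem_nhds hx] with z hz
      exact (hgE k (subset_closure hz)).symm
    rw [(hgk.hasLineDerivAt _).lineDeriv]
    rfl
  have hfin : volume C < ⊤ := h.isBounded.measure_lt_top
  have hint : ∀ k : Fin d, IntegrableOn
      (fun x => lineDeriv ℝ (g k) x (EuclideanSpace.single k 1)) C := fun k =>
    Measure.integrableOn_of_bounded hfin.ne
      (aestronglyMeasurable_lineDeriv (hgL k).continuous volume)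
      (Filter.Eventually.of_forall fun x => norm_lineDeriv_le_of_lipschitz ℝ (hgL k))
  rw [setIntegral_congr_fun h.isOpen.measurableSet h1, integral_finsetSum _ fun k _ => hint k]
  simp_rw [fun k => h.integral_lineDeriv (EuclideanSpace.single k (1 : ℝ)) (hgL k)]
  rw [Finset.sum_comm]
  refine Finset.sum_congr rfl fun a _ => ?_
  have hν0 : ν a ≠ 0 := by
    intro h0; have := h.norm_normal a; simp [h0] at this
  have hfs : surf d (σ a) < ⊤ := surf_lt_top hν0 (h.isCompact_face a).isBounded (h.subset a)
  have : IsFiniteMeasure ((surf d).restrict (σ a)) := ⟨by rwa [Measure.restrict_apply_univ]⟩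
  have hgi : ∀ k, Integrable (g k) ((surf d).restrict (σ a)) := fun k => by
    have := (hgL k).continuous.continuousOn.integrableOn_compact (μ := (surf d).restrict (σ a))
      (h.isCompact_face a)
    rwa [IntegrableOn, Measure.restrict_restrict (h.isClosed a).measurableSet, Set.inter_self] at this
  simp_rw [← integral_const_mul]
  rw [← integral_finsetSum _ fun k _ => (hgi k).const_mul _]
  refine setIntegral_congr_fun (h.isClosed a).measurableSet fun y hy => ?_
  simp only [PiLp.inner_apply]
  refine Finset.sum_congr rfl fun k _ => ?_
  have hk : F y k = g k y := hgE k (hσC a hy)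
  rw [hk, Finset.sum_eq_single k]
  · simp [mul_comm]
  · intro i _ hik
    simp [hik]
  · simp

end HasFaces

/-! ### A Hoffman bound and linear regularity of pairs of polytopes. -/

section Hoffman

variable {E : Type*} [NormedAddCommGroup E] [NormedSpace ℝ E] {ι : Type*} [Fintype ι]

/-- On the compact face of the simplex supported in `J` the norm has a positive minimum; homogeneity
extends the bound to all nonnegative weights. -/
theorem exists_pos_mul_le_norm_sum (a : ι → E) (J : Finset ι)
    (hJ : ∀ τ ∈ stdSimplex ℝ ι, (∀ k ∉ J, τ k = 0) → ∑ k, τ k • a k ≠ 0) :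
    ∃ c > 0, ∀ ρ : ι → ℝ, (∀ k, 0 ≤ ρ k) → (∀ k ∉ J, ρ k = 0) →
      c * ∑ k, ρ k ≤ ‖∑ k, ρ k • a k‖ := by
  set Z : Set (ι → ℝ) := stdSimplex ℝ ι ∩ {τ | ∀ k ∉ J, τ k = 0} with hZ
  have hZc : IsCompact Z := by
    refine (isCompact_stdSimplex ℝ ι).inter_right ?_
    have : {τ : ι → ℝ | ∀ k ∉ J, τ k = 0} = ⋂ k, ⋂ (_ : k ∉ J), {τ | τ k = 0} := by
      ext; simp
    rw [this]
    exact isClosed_iInter fun k => isClosed_iInter fun _ =>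
      isClosed_eq (continuous_apply k) continuous_const
  have hcont : Continuous fun τ : ι → ℝ => ‖∑ k, τ k • a k‖ := by fun_prop
  have hsmall : ∃ c > 0, ∀ τ ∈ Z, c ≤ ‖∑ k, τ k • a k‖ := by
    rcases Z.eq_empty_or_nonempty with h | h
    · exact ⟨1, one_pos, by simp [h]⟩
    · obtain ⟨τ₀, h0, hmin⟩ := hZc.exists_isMinOn h hcont.continuousOn
      exact ⟨_, norm_pos_iff.2 (hJ τ₀ h0.1 h0.2), fun τ hτ => hmin hτ⟩
  obtain ⟨c, hc, hcZ⟩ := hsmall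
  refine ⟨c, hc, fun ρ hρ hρJ => ?_⟩
  rcases (Finset.sum_nonneg fun k _ => hρ k).eq_or_lt with h | h
  · rw [← h, mul_zero]; exact norm_nonneg _
  · set R := ∑ k, ρ k with hR
    have hmem : (fun k => R⁻¹ * ρ k) ∈ Z := by
      refine ⟨⟨fun k => mul_nonneg (inv_nonneg.2 h.le) (hρ k), ?_⟩, fun k hk => by simp [hρJ k hk]⟩
      rw [← Finset.mul_sum, ← hR, inv_mul_cancel₀ h.ne']
    have h1 := hcZ _ hmem
    simp_rw [mul_smul] at h1
    rw [← Finset.smul_sum, norm_smul, Real.norm_eq_abs, abs_of_pos (inv_pos.2 h),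
      inv_mul_eq_div, le_div_iff₀ h] at h1
    exact h1

/-- If `0` is a convex combination of the points `a k`, then a point of the standard simplex is close
to a solution of `∑ k, μ k • a k = 0` in the simplex if it nearly solves the equation. -/
theorem hoffman_stdSimplex (a : ι → E) {μ₀ : ι → ℝ} (hμ₀ : μ₀ ∈ stdSimplex ℝ ι)
    (h₀ : ∑ k, μ₀ k • a k = 0) :
    ∃ C : ℝ, 0 ≤ C ∧ ∀ l ∈ stdSimplex ℝ ι, ∃ μ ∈ stdSimplex ℝ ι, ∑ k, μ k • a k = 0 ∧
      ∑ k, |l k - μ k| ≤ C * ‖∑ k, l k • a k‖ := by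
  classical
  have hex : ∀ J : Finset ι, ∃ c > 0,
      (∀ τ ∈ stdSimplex ℝ ι, (∀ k ∉ J, τ k = 0) → ∑ k, τ k • a k ≠ 0) →
      ∀ ρ : ι → ℝ, (∀ k, 0 ≤ ρ k) → (∀ k ∉ J, ρ k = 0) → c * ∑ k, ρ k ≤ ‖∑ k, ρ k • a k‖ := by
    intro J
    by_cases hJ : ∀ τ ∈ stdSimplex ℝ ι, (∀ k ∉ J, τ k = 0) → ∑ k, τ k • a k ≠ 0
    · obtain ⟨c, hc, h⟩ := exists_pos_mul_le_norm_sum a J hJ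
      exact ⟨c, hc, fun _ => h⟩
    · exact ⟨1, one_pos, fun h => absurd h hJ⟩
  choose c hc hcJ using hex
  -- The support that will occur depends on `l`; summing over the finitely many possible ones gives
  -- a uniform constant.
  set B : ℝ := ∑ J, (c J)⁻¹ with hB
  have hB0 : 0 ≤ B := Finset.sum_nonneg fun J _ => (inv_pos.2 (hc J)).le
  refine ⟨2 * B, by positivity, fun l hl => ?_⟩
  -- Remove from `l` a solution `μ` of the equation below it with the largest total mass.
  set S : Set (ι → ℝ) := Set.Icc 0 l ∩ {μ | ∑ k, μ k • a k = 0} with hS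
  have hSc : IsCompact S :=
    isCompact_Icc.inter_right (isClosed_eq (by fun_prop) continuous_const)
  have hSn : S.Nonempty := ⟨0, ⟨le_rfl, hl.1⟩, by simp⟩
  obtain ⟨μ, hμS, hmax⟩ := hSc.exists_isMaxOn hSn
    (f := fun μ : ι → ℝ => ∑ k, μ k) (by fun_prop)
  have hμ0 : ∀ k, 0 ≤ μ k := hμS.1.1
  have hμl : ∀ k, μ k ≤ l k := hμS.1.2
  have hμa : ∑ k, μ k • a k = 0 := hμS.2
  set J : Finset ι := Finset.univ.filter fun k => l k - μ k ≠ 0 with hJ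
  have hJk : ∀ k ∉ J, l k - μ k = 0 := fun k hk => by
    by_contra h; exact hk (by simp [hJ, h])
  have hgood : ∀ τ ∈ stdSimplex ℝ ι, (∀ k ∉ J, τ k = 0) → ∑ k, τ k • a k ≠ 0 := by
    intro τ hτ hτJ hτa
    have hJn : J.Nonempty := by
      by_contra hne
      rw [Finset.not_nonempty_iff_eq_empty] at hne
      have h1 := hτ.2
      rw [Finset.sum_eq_zero fun k _ => hτJ k (by simp [hne])] at h1
      exact zero_ne_one h1
    -- Since `τ ≤ 1`, the smallest gap on `J` is a step along `τ` that stays below `l`. It would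
    -- raise the mass of `μ`, so the remainder supports no solution in the simplex.
    obtain ⟨k₀, hk₀, hmin⟩ := J.exists_min_image (fun k => l k - μ k) hJn
    set s := l k₀ - μ k₀ with hs
    have hs0 : 0 < s := lt_of_le_of_ne (sub_nonneg.2 (hμl k₀)) (by
      have := (Finset.mem_filter.1 hk₀).2
      exact fun h => this h.symm)
    have hτ1 : ∀ k, τ k ≤ 1 := fun k => by
      rw [← hτ.2]
      exact Finset.single_le_sum (fun i _ => hτ.1 i) (Finset.mem_univ k)
    have hmem : μ + s • τ ∈ S := by
      refine ⟨⟨fun k => add_nonneg (hμ0 k) (mul_nonneg hs0.le (hτ.1 k)), fun k => ?_⟩, ?_⟩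
      · simp only [Pi.add_apply, Pi.smul_apply, smul_eq_mul]
        by_cases hk : k ∈ J
        · have h1 := hmin k hk
          have h2 : s * τ k ≤ s * 1 := by gcongr; exact hτ1 k
          linarith
        · rw [hτJ k hk]; linarith [hμl k]
      · simp only [Set.mem_ofPred_eq, Pi.add_apply, Pi.smul_apply, smul_eq_mul, add_smul,
          Finset.sum_add_distrib, hμa, mul_smul, ← Finset.smul_sum, hτa, smul_zero, add_zero]
    have h2 : ∑ k, (μ + s • τ) k ≤ ∑ k, μ k := hmax hmem
    simp only [Pi.add_apply, Pi.smul_apply, smul_eq_mul, Finset.sum_add_distrib, ← Finset.mul_sum,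
      hτ.2] at h2
    linarith
  have hbound := hcJ J hgood (fun k => l k - μ k) (fun k => sub_nonneg.2 (hμl k)) hJk
  set R := ∑ k, (l k - μ k) with hR
  have hR0 : 0 ≤ R := Finset.sum_nonneg fun k _ => sub_nonneg.2 (hμl k)
  simp_rw [sub_smul, Finset.sum_sub_distrib, hμa, sub_zero] at hbound
  have hRB : R ≤ B * ‖∑ k, l k • a k‖ := by
    have h1 : R ≤ (c J)⁻¹ * ‖∑ k, l k • a k‖ := by
      rw [inv_mul_eq_div, le_div_iff₀ (hc J), mul_comm]; exact hbound
    refine h1.trans ?_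
    gcongr
    exact Finset.single_le_sum (f := fun J => (c J)⁻¹) (fun J _ => (inv_pos.2 (hc J)).le)
      (Finset.mem_univ J)
  -- The removed mass `R` is put back as a multiple of the given solution `μ₀`, which at most
  -- doubles the distance.
  refine ⟨fun k => μ k + R * μ₀ k, ⟨fun k => add_nonneg (hμ0 k) (mul_nonneg hR0 (hμ₀.1 k)), ?_⟩,
    ?_, ?_⟩
  · rw [Finset.sum_add_distrib, ← Finset.mul_sum, hμ₀.2, hR, Finset.sum_sub_distrib, hl.2]
    ring
  · simp_rw [add_smul, Finset.sum_add_distrib, mul_smul]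
    rw [← Finset.smul_sum, hμa, h₀, smul_zero, add_zero]
  · calc ∑ k, |l k - (μ k + R * μ₀ k)| ≤ ∑ k, ((l k - μ k) + R * μ₀ k) := by
          refine Finset.sum_le_sum fun k _ => ?_
          rw [← sub_sub]
          refine (abs_sub _ _).trans ?_
          rw [abs_of_nonneg (sub_nonneg.2 (hμl k)), abs_of_nonneg (mul_nonneg hR0 (hμ₀.1 k))]
      _ = 2 * R := by
          rw [Finset.sum_add_distrib, ← Finset.mul_sum, hμ₀.2, ← hR]; ring
      _ ≤ 2 * B * ‖∑ k, l k • a k‖ := by linarith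

theorem mem_convexHull_finset_iff (s : Finset E) (x : E) :
    x ∈ convexHull ℝ (s : Set E) ↔ ∃ w ∈ stdSimplex ℝ s, ∑ p, w p • (p : E) = x := by
  classical
  rw [Finset.mem_convexHull']
  constructor
  · rintro ⟨w, h0, h1, h2⟩
    refine ⟨fun p => w p, ⟨fun p => h0 p p.2, ?_⟩, ?_⟩
    · rw [Finset.sum_coe_sort s w]; exact h1
    · rw [Finset.sum_coe_sort s fun p => w p • p]; exact h2
  · rintro ⟨w, hw, hx⟩
    refine ⟨fun p => if h : p ∈ s then w ⟨p, h⟩ else 0, fun y hy => by simp [hy, hw.1], ?_, ?_⟩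
    · rw [← hw.2, ← Finset.sum_coe_sort]
      simp
    · rw [← hx, ← Finset.sum_coe_sort]
      simp

/-- Linear regularity of a pair of polytopes. -/
theorem exists_mem_inter_dist_le (s t : Finset E)
    (hst : (convexHull ℝ (s : Set E) ∩ convexHull ℝ (t : Set E)).Nonempty) :
    ∃ C : ℝ, 0 ≤ C ∧ ∀ x ∈ convexHull ℝ (s : Set E), ∀ y ∈ convexHull ℝ (t : Set E),
      ∃ z ∈ convexHull ℝ (s : Set E) ∩ convexHull ℝ (t : Set E), ‖x - z‖ ≤ C * ‖x - y‖ := by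
  have hprod : ∀ w ∈ stdSimplex ℝ s, ∀ v ∈ stdSimplex ℝ t,
      (fun k : s × t => w k.1 * v k.2) ∈ stdSimplex ℝ (s × t) := by
    intro w hw v hv
    refine ⟨fun k => mul_nonneg (hw.1 _) (hv.1 _), ?_⟩
    rw [Fintype.sum_prod_type]
    simp_rw [← Finset.mul_sum, hv.2, mul_one, hw.2]
  have hfst : ∀ w : s → ℝ, ∀ v ∈ stdSimplex ℝ t,
      ∑ k : s × t, (w k.1 * v k.2) • (k.1 : E) = ∑ p, w p • (p : E) := by
    intro w v hv
    rw [Fintype.sum_prod_type]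
    refine Finset.sum_congr rfl fun p _ => ?_
    simp only
    rw [← Finset.sum_smul, ← Finset.mul_sum, hv.2, mul_one]
  have hsnd : ∀ w ∈ stdSimplex ℝ s, ∀ v : t → ℝ,
      ∑ k : s × t, (w k.1 * v k.2) • (k.2 : E) = ∑ p, v p • (p : E) := by
    intro w hw v
    rw [Fintype.sum_prod_type_right]
    refine Finset.sum_congr rfl fun p _ => ?_
    simp only
    rw [← Finset.sum_smul, ← Finset.sum_mul, hw.2, one_mul]
  obtain ⟨z₀, hzs, hzt⟩ := hst
  obtain ⟨w₀, hw₀, hw₀z⟩ := (mem_convexHull_finset_iff s z₀).1 hzs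
  obtain ⟨v₀, hv₀, hv₀z⟩ := (mem_convexHull_finset_iff t z₀).1 hzt
  -- With product weights the differences `p - q` sum to `x - y`, and any solution of the system
  -- yields a common point of the hulls.
  obtain ⟨C, hC, hCl⟩ := hoffman_stdSimplex (fun k : s × t => (k.1 : E) - k.2)
    (hprod w₀ hw₀ v₀ hv₀) (by
      simp_rw [smul_sub]
      rw [Finset.sum_sub_distrib, hfst w₀ v₀ hv₀, hsnd w₀ hw₀ v₀, hw₀z, hv₀z, sub_self])
  set R : ℝ := ∑ p : s, ‖(p : E)‖ with hR
  have hR0 : 0 ≤ R := Finset.sum_nonneg fun _ _ => norm_nonneg _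
  refine ⟨R * C, mul_nonneg hR0 hC, fun x hx y hy => ?_⟩
  obtain ⟨w, hw, rfl⟩ := (mem_convexHull_finset_iff s x).1 hx
  obtain ⟨v, hv, rfl⟩ := (mem_convexHull_finset_iff t y).1 hy
  obtain ⟨μ, hμ, hμ0, hle⟩ := hCl _ (hprod w hw v hv)
  simp_rw [smul_sub] at hμ0 hle
  rw [Finset.sum_sub_distrib] at hμ0
  rw [Finset.sum_sub_distrib, hfst w v hv, hsnd w hw v] at hle
  refine ⟨∑ k : s × t, μ k • (k.1 : E), ⟨?_, ?_⟩, ?_⟩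
  · exact (convex_convexHull ℝ _).sum_mem (fun k _ => hμ.1 k) hμ.2
      fun k _ => subset_convexHull ℝ _ k.1.2
  · rw [sub_eq_zero.1 hμ0]
    exact (convex_convexHull ℝ _).sum_mem (fun k _ => hμ.1 k) hμ.2
      fun k _ => subset_convexHull ℝ _ k.2.2
  · rw [← hfst w v hv, ← Finset.sum_sub_distrib]
    simp_rw [← sub_smul]
    calc _ ≤ ∑ k : s × t, |w k.1 * v k.2 - μ k| * R := by
          refine (norm_sum_le _ _).trans (Finset.sum_le_sum fun k _ => ?_)
          rw [norm_smul, Real.norm_eq_abs]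
          gcongr
          exact Finset.single_le_sum (f := fun p : s => ‖(p : E)‖) (fun _ _ => norm_nonneg _)
            (Finset.mem_univ k.1)
      _ = R * ∑ k : s × t, |w k.1 * v k.2 - μ k| := by rw [← Finset.sum_mul, mul_comm]
      _ ≤ R * (C * ‖_‖) := by gcongr
      _ = _ := by rw [hfst w v hv, mul_assoc]

end Hoffman

/-! ### Lipschitz bounds on polygonal domains. -/

theorem ContDiffOn.exists_lipschitzOnWith_of_isCompact_of_convex {F : Type*} [NormedAddCommGroup F]
    [NormedSpace ℝ F] {f : Sp d → F} {K : Set (Sp d)} (hf : ContDiffOn ℝ 1 f K) (hK : IsCompact K)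
    (hc : Convex ℝ K) : ∃ L, LipschitzOnWith L f K := by
  refine LocallyLipschitzOn.exists_lipschitzOnWith_of_compact hK fun x hx => ?_
  obtain ⟨L, t, ht, hL⟩ := (hf x hx).exists_lipschitzOnWith hc
  exact ⟨L, t, ht, hL⟩

/-- A function that is Lipschitz on each of finitely many polytopes is Lipschitz on their union. -/
theorem exists_lipschitz_iUnion_polytopes {P : Set (Finset (Sp d))} (hP : P.Finite) {f : Sp d → ℝ}
    (hf : ∀ s ∈ P, ∃ L, LipschitzOnWith L f (convexHull ℝ (s : Set (Sp d)))) :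
    ∃ L : ℝ, 0 ≤ L ∧ ∀ x ∈ ⋃ s ∈ P, convexHull ℝ (s : Set (Sp d)),
      ∀ y ∈ ⋃ s ∈ P, convexHull ℝ (s : Set (Sp d)), |f x - f y| ≤ L * dist x y := by
  classical
  have hcpt : ∀ s : Finset (Sp d), IsCompact (convexHull ℝ (s : Set (Sp d))) := fun s =>
    s.finite_toSet.isCompact_convexHull ℝ
  have hpair : ∀ s t : Finset (Sp d), ∃ L : ℝ, 0 ≤ L ∧ (s ∈ P → t ∈ P →
      ∀ x ∈ convexHull ℝ (s : Set (Sp d)), ∀ y ∈ convexHull ℝ (t : Set (Sp d)),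
        |f x - f y| ≤ L * dist x y) := by
    intro s t
    by_cases hsP : s ∈ P
    swap
    · exact ⟨0, le_rfl, fun h => absurd h hsP⟩
    by_cases htP : t ∈ P
    swap
    · exact ⟨0, le_rfl, fun _ h => absurd h htP⟩
    obtain ⟨L₁, hL₁⟩ := hf s hsP
    obtain ⟨L₂, hL₂⟩ := hf t htP
    -- If the polytopes meet, the path from `x` to `y` is led through a common point at comparable
    -- distance; if not, their distance is positive and bounds on `f` suffice.
    by_cases hst : (convexHull ℝ (s : Set (Sp d)) ∩ convexHull ℝ (t : Set (Sp d))).Nonempty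
    · obtain ⟨C, hC, h⟩ := exists_mem_inter_dist_le s t hst
      refine ⟨L₁ * C + L₂ * (C + 1), by positivity, fun _ _ x hx y hy => ?_⟩
      obtain ⟨z, hz, hxz⟩ := h x hx y hy
      rw [← dist_eq_norm, ← dist_eq_norm] at hxz
      have h1 := hL₁.dist_le_mul x hx z hz.1
      have h2 := hL₂.dist_le_mul z hz.2 y hy
      have h3 : dist z y ≤ (C + 1) * dist x y := by
        have := dist_triangle z x y
        rw [dist_comm z x] at this
        linarith
      rw [← Real.dist_eq]
      calc dist (f x) (f y) ≤ dist (f x) (f z) + dist (f z) (f y) := dist_triangle _ _ _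
        _ ≤ L₁ * (C * dist x y) + L₂ * ((C + 1) * dist x y) := by
          refine add_le_add (h1.trans ?_) (h2.trans ?_) <;> gcongr
        _ = _ := by ring
    · have hdisj : Disjoint (convexHull ℝ (s : Set (Sp d))) (convexHull ℝ (t : Set (Sp d))) := by
        rw [Set.disjoint_iff_inter_eq_empty]; exact Set.not_nonempty_iff_eq_empty.1 hst
      obtain ⟨B₁, hB₁⟩ := (hcpt s).exists_bound_of_continuousOn hL₁.continuousOn
      obtain ⟨B₂, hB₂⟩ := (hcpt t).exists_bound_of_continuousOn hL₂.continuousOn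
      obtain ⟨r, hr, hrd⟩ := Metric.exists_pos_forall_lt_edist (hcpt s) (hcpt t).isClosed hdisj
      have hr' : (0 : ℝ) < r := by exact_mod_cast hr
      refine ⟨(|B₁| + |B₂|) / r, by positivity, fun _ _ x hx y hy => ?_⟩
      have h1 : (r : ℝ) ≤ dist x y := by
        have := hrd x hx y hy
        rw [edist_nndist] at this
        have h2 : r < nndist x y := by exact_mod_cast this
        rw [← coe_nndist]
        exact_mod_cast h2.le
      have h2 := hB₁ x hx
      have h3 := hB₂ y hy
      rw [Real.norm_eq_abs] at h2 h3
      calc |f x - f y| ≤ |f x| + |f y| := abs_sub _ _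
        _ ≤ |B₁| + |B₂| := add_le_add (h2.trans (le_abs_self _)) (h3.trans (le_abs_self _))
        _ = (|B₁| + |B₂|) / r * r := by field_simp
        _ ≤ _ := by gcongr
  choose L hL0 hL using hpair
  refine ⟨∑ s ∈ hP.toFinset, ∑ t ∈ hP.toFinset, L s t,
    Finset.sum_nonneg fun s _ => Finset.sum_nonneg fun t _ => hL0 s t, fun x hx y hy => ?_⟩
  simp only [Set.mem_iUnion] at hx hy
  obtain ⟨s, hs, hxs⟩ := hx
  obtain ⟨t, ht, hyt⟩ := hy
  refine (hL s t hs ht x hxs y hyt).trans ?_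
  gcongr
  refine le_trans ?_ (Finset.single_le_sum
    (f := fun s => ∑ t ∈ hP.toFinset, L s t) (fun s _ => Finset.sum_nonneg fun t _ => hL0 s t)
    (hP.mem_toFinset.2 hs))
  exact Finset.single_le_sum (f := fun t => L s t) (fun t _ => hL0 s t) (hP.mem_toFinset.2 ht)

theorem IsPolygonalDomain.isCompact_closure {Ω : Set (Sp d)} (hΩ : IsPolygonalDomain Ω) :
    IsCompact (closure Ω) := by
  obtain ⟨P, hP, h⟩ := hΩ.polytopes
  rw [h]
  exact hP.isCompact_biUnion fun s _ => s.finite_toSet.isCompact_convexHull ℝ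

/-- A function of class `C¹` up to the boundary of a polygonal domain is Lipschitz. -/
theorem IsPolygonalDomain.exists_lipschitz {Ω : Set (Sp d)} (hΩ : IsPolygonalDomain Ω)
    {f : Sp d → ℝ} (hf : ContDiffOn ℝ 1 f (closure Ω)) :
    ∃ L : ℝ, 0 ≤ L ∧ ∀ x ∈ closure Ω, ∀ y ∈ closure Ω, |f x - f y| ≤ L * dist x y := by
  obtain ⟨P, hP, h⟩ := hΩ.polytopes
  rw [h] at hf ⊢
  refine exists_lipschitz_iUnion_polytopes hP fun s hs => ?_
  exact ContDiffOn.exists_lipschitzOnWith_of_isCompact_of_convex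
    (hf.mono (Set.subset_biUnion_of_mem (u := fun s : Finset (Sp d) => convexHull ℝ (s : Set (Sp d))) hs))
    (s.finite_toSet.isCompact_convexHull ℝ) (convex_convexHull ℝ _)

theorem infDist_hyperplane {ν : Sp d} (hν : ‖ν‖ = 1) (c : ℝ) (x : Sp d) :
    Metric.infDist x (hyperplane ν c) = |c - inner ℝ ν x| := by
  have hνν : inner ℝ ν ν = 1 := by rw [real_inner_self_eq_norm_sq, hν]; norm_num
  have hν0 : ν ≠ 0 := by rintro rfl; simp at hν
  apply le_antisymm
  · have hmem : x + (c - inner ℝ ν x) • ν ∈ hyperplane ν c := by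
      simp [hyperplane, inner_add_right, inner_smul_right, hν]
    refine (Metric.infDist_le_dist_of_mem hmem).trans ?_
    rw [dist_self_add_right, norm_smul, hν, mul_one, Real.norm_eq_abs]
  · refine (Metric.le_infDist (hyperplane_nonempty hν0 c)).2 fun y hy => ?_
    have hy' : inner ℝ ν y = c := hy
    rw [← hy', ← inner_sub_right, dist_comm, dist_eq_norm]
    have := abs_real_inner_le_norm ν (y - x)
    rwa [hν, one_mul] at this

/-! ### Geometry of admissible meshes. -/

namespace Mesh

variable {T : Mesh d} {Ω : Set (Sp d)}

/-- The unit normal of `σ_ij` pointing from the cell `i` to the cell `j`. -/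
def nrm (T : Mesh d) (i j : Fin T.N) : Sp d := (T.hh i j)⁻¹ • (T.node j - T.node i)

/-- The outer unit normal of a boundary interface. -/
def bnrm (T : Mesh d) (i : Fin T.N) (y : Sp d) : Sp d := (T.bh i y)⁻¹ • (y - T.node i)

theorem face_comm (T : Mesh d) (i j : Fin T.N) : T.face i j = T.face j i := Set.inter_comm _ _

theorem Adj.symm {i j : Fin T.N} (h : T.Adj i j) : T.Adj j i :=
  ⟨h.1.symm, by rw [face_comm]; exact h.2⟩

theorem mem_nbrs {i j : Fin T.N} : j ∈ T.nbrs i ↔ T.Adj i j := by simp [nbrs]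

theorem hh_comm (T : Mesh d) (i j : Fin T.N) : T.hh i j = T.hh j i := dist_comm _ _

theorem m_comm (T : Mesh d) (i j : Fin T.N) : T.m i j = T.m j i := by rw [m, m, face_comm]

theorem nrm_comm (T : Mesh d) (i j : Fin T.N) : T.nrm j i = -T.nrm i j := by
  rw [nrm, nrm, hh_comm, ← smul_neg, neg_sub]

theorem kap_comm (T : Mesh d) (κ : Sp d → ℝ) (i j : Fin T.N) : T.kap κ i j = T.kap κ j i := by
  rw [kap, kap, hh_comm, mul_comm (T.kbar κ i) (T.kbar κ j), add_comm]

namespace IsAdmissible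

theorem isOpen_cell (hT : T.IsAdmissible Ω) (i : Fin T.N) : IsOpen (T.cell i) := by
  obtain ⟨s, hs⟩ := hT.polytope i
  rw [hs]; exact isOpen_interior

theorem convex_cell (hT : T.IsAdmissible Ω) (i : Fin T.N) : Convex ℝ (T.cell i) := by
  obtain ⟨s, hs⟩ := hT.polytope i
  rw [hs]; exact (convex_convexHull ℝ _).interior

theorem isBounded_cell (hT : T.IsAdmissible Ω) (i : Fin T.N) : Bornology.IsBounded (T.cell i) := by
  obtain ⟨s, hs⟩ := hT.polytope i
  rw [hs]
  exact (s.finite_toSet.isCompact_convexHull ℝ).isBounded.subset interior_subset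

theorem closure_cell_subset (hT : T.IsAdmissible Ω) (i : Fin T.N) :
    closure (T.cell i) ⊆ closure Ω := by
  rw [← hT.cover]; exact Set.subset_iUnion (fun i => closure (T.cell i)) i

theorem cell_subset (hΩ : IsPolygonalDomain Ω) (hT : T.IsAdmissible Ω) (i : Fin T.N) :
    T.cell i ⊆ Ω := by
  rw [← hΩ.interior_closure]
  exact interior_maximal (subset_closure.trans (hT.closure_cell_subset i)) (hT.isOpen_cell i)

theorem hh_pos (hT : T.IsAdmissible Ω) {i j : Fin T.N} (h : T.Adj i j) : 0 < T.hh i j :=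
  dist_pos.2 fun he => h.1 (hT.node_injective he)

theorem norm_nrm (hT : T.IsAdmissible Ω) {i j : Fin T.N} (h : T.Adj i j) : ‖T.nrm i j‖ = 1 := by
  have := hT.hh_pos h
  rw [nrm, norm_smul, norm_inv, Real.norm_eq_abs, abs_of_pos this, ← dist_eq_norm, dist_comm]
  exact inv_mul_cancel₀ this.ne'

theorem inner_nrm_node (hT : T.IsAdmissible Ω) {i j : Fin T.N} (h : T.Adj i j) :
    inner ℝ (T.nrm i j) (T.node j) - inner ℝ (T.nrm i j) (T.node i) = T.hh i j := by
  have := hT.hh_pos h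
  rw [← inner_sub_right, nrm, real_inner_smul_left, real_inner_self_eq_norm_sq, ← dist_eq_norm,
    dist_comm]
  change (T.hh i j)⁻¹ * T.hh i j ^ 2 = _
  field_simp

theorem bh_pos (hT : T.IsAdmissible Ω) {i : Fin T.N} {y : Sp d} (h : y ∈ T.bnode i) :
    0 < T.bh i y :=
  dist_pos.2 fun he => hT.node_notMem i y h (by rw [he]; exact hT.bnode_mem i y h)

theorem norm_bnrm (hT : T.IsAdmissible Ω) {i : Fin T.N} {y : Sp d} (h : y ∈ T.bnode i) :
    ‖T.bnrm i y‖ = 1 := by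
  have := hT.bh_pos h
  rw [bnrm, norm_smul, norm_inv, Real.norm_eq_abs, abs_of_pos this, ← dist_eq_norm, dist_comm]
  exact inv_mul_cancel₀ this.ne'

theorem inner_bnrm (hT : T.IsAdmissible Ω) {i : Fin T.N} {y : Sp d} (h : y ∈ T.bnode i) :
    inner ℝ (T.bnrm i y) y = inner ℝ (T.bnrm i y) (T.node i) + T.bh i y := by
  have := hT.bh_pos h
  rw [← sub_eq_iff_eq_add', ← inner_sub_right, bnrm, real_inner_smul_left,
    real_inner_self_eq_norm_sq, ← dist_eq_norm, dist_comm]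
  change (T.bh i y)⁻¹ * T.bh i y ^ 2 = _
  field_simp

theorem face_subset_closure (T : Mesh d) (i j : Fin T.N) : T.face i j ⊆ closure (T.cell i) :=
  Set.inter_subset_left.trans frontier_subset_closure

theorem face_subset_closure_right (T : Mesh d) (i j : Fin T.N) : T.face i j ⊆ closure (T.cell j) :=
  Set.inter_subset_right.trans frontier_subset_closure

theorem bface_subset_closure (T : Mesh d) (Ω : Set (Sp d)) (i : Fin T.N) (y : Sp d) :
    T.bface Ω i y ⊆ closure (T.cell i) := fun _ hx => frontier_subset_closure hx.1.1

/-- The position of two neighbouring cells with respect to their interface. -/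
theorem adj_position (hT : T.IsAdmissible Ω) {i j : Fin T.N} (h : T.Adj i j) :
    ∃ c : ℝ, T.face i j ⊆ hyperplane (T.nrm i j) c ∧
      (∀ x ∈ T.cell i, inner ℝ (T.nrm i j) x < c) ∧ (∀ x ∈ T.cell j, c < inner ℝ (T.nrm i j) x) ∧
      T.dist1 i j = c - inner ℝ (T.nrm i j) (T.node i) ∧
      T.dist1 j i = inner ℝ (T.nrm i j) (T.node j) - c ∧
      0 ≤ T.dist1 i j ∧ 0 ≤ T.dist1 j i := by
  obtain ⟨p, hp⟩ := nonempty_of_measure_ne_zero h.2.ne'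
  have hν := hT.norm_nrm h
  have hν0 : T.nrm i j ≠ 0 := by intro h0; simp [h0] at hν
  set c := inner ℝ (T.nrm i j) p with hc
  have hsub : T.face i j ⊆ hyperplane (T.nrm i j) c := by
    intro q hq
    have h1 := hT.orthogonal i j h q hq p hp
    rw [hyperplane, Set.mem_ofPred_eq, hc, ← sub_eq_zero, ← inner_sub_right, nrm,
      real_inner_smul_left, h1, mul_zero]
  have hpos : 0 < surf d (closure (T.cell i) ∩ closure (T.cell j) ∩ hyperplane (T.nrm i j) c) :=
    h.2.trans_le (measure_mono fun x hx =>
      ⟨⟨face_subset_closure T i j hx, face_subset_closure_right T i j hx⟩, hsub hx⟩)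
  have hle : ∀ k : Fin T.N, (∀ x ∈ T.cell k, inner ℝ (T.nrm i j) x < c) →
      inner ℝ (T.nrm i j) (T.node k) ≤ c := fun k hk =>
    closure_minimal (t := {x | inner ℝ (T.nrm i j) x ≤ c}) (fun x hx => (hk x hx).le)
      (isClosed_le (by fun_prop) continuous_const) (hT.node_mem k)
  have hge : ∀ k : Fin T.N, (∀ x ∈ T.cell k, c < inner ℝ (T.nrm i j) x) →
      c ≤ inner ℝ (T.nrm i j) (T.node k) := fun k hk =>
    closure_minimal (t := {x | c ≤ inner ℝ (T.nrm i j) x}) (fun x hx => (hk x hx).le)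
      (isClosed_le continuous_const (by fun_prop)) (hT.node_mem k)
  rcases opposite_sides (hT.isOpen_cell i) (hT.isOpen_cell j) (hT.convex_cell i) (hT.convex_cell j)
    (hT.disjoint i j h.1) hν0 hpos with ⟨h1, h2⟩ | ⟨h1, h2⟩
  · have e1 : T.dist1 i j = c - inner ℝ (T.nrm i j) (T.node i) := by
      rw [dist1, affineSpan_eq_hyperplane hν0 hsub h.2, infDist_hyperplane hν,
        abs_of_nonneg (by linarith [hle i h1])]
    have e2 : T.dist1 j i = inner ℝ (T.nrm i j) (T.node j) - c := by
      rw [dist1, face_comm, affineSpan_eq_hyperplane hν0 hsub h.2, infDist_hyperplane hν,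
        abs_sub_comm, abs_of_nonneg (by linarith [hge j h2])]
    exact ⟨c, hsub, h1, h2, e1, e2, by linarith [hle i h1], by linarith [hge j h2]⟩
  -- The reversed position is impossible, because the normal points from `x_i` to `x_j`.
  · have h3 := hge i h1
    have h4 := hle j h2
    have h5 := hT.inner_nrm_node h
    have h6 := hT.hh_pos h
    linarith

theorem dist1_add (hT : T.IsAdmissible Ω) {i j : Fin T.N} (h : T.Adj i j) :
    T.dist1 i j + T.dist1 j i = T.hh i j := by
  obtain ⟨c, -, -, -, h1, h2, -⟩ := hT.adj_position h
  rw [h1, h2, ← hT.inner_nrm_node h]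
  ring

theorem bface_subset_hyperplane (T : Mesh d) (Ω : Set (Sp d)) (i : Fin T.N) (y : Sp d) :
    T.bface Ω i y ⊆ hyperplane (T.bnrm i y) (inner ℝ (T.bnrm i y) y) := by
  rintro q ⟨-, hq⟩
  have hq' : inner ℝ (q - y) (y - T.node i) = 0 := hq
  rw [hyperplane, Set.mem_ofPred_eq, ← sub_eq_zero, ← inner_sub_right, bnrm, real_inner_smul_left,
    real_inner_comm, hq', mul_zero]

/-- A hyperplane that cuts the cell meets its frontier in a null set, so the plane of a boundary
interface misses the cell; the node, at distance `bh > 0`, decides the side. -/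
theorem inner_bnrm_lt (hT : T.IsAdmissible Ω) {i : Fin T.N} {y : Sp d} (h : y ∈ T.bnode i) :
    ∀ x ∈ T.cell i, inner ℝ (T.bnrm i y) x < inner ℝ (T.bnrm i y) y := by
  have hν := hT.norm_bnrm h
  have hν0 : T.bnrm i y ≠ 0 := by intro h0; simp [h0] at hν
  set c := inner ℝ (T.bnrm i y) y with hc
  have hpos : 0 < surf d (frontier (T.cell i) ∩ hyperplane (T.bnrm i y) c) :=
    (hT.bnode_pos i y h).trans_le (measure_mono fun x hx =>
      ⟨hx.1.1, bface_subset_hyperplane T Ω i y hx⟩)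
  have hne : ¬ (T.cell i ∩ hyperplane (T.bnrm i y) c).Nonempty := fun hne =>
    hpos.ne' (surf_frontier_inter_hyperplane (hT.isOpen_cell i) (hT.convex_cell i) hν0 hne)
  rcases lt_or_gt_of_disjoint_hyperplane (hT.convex_cell i) hne with h1 | h1
  · exact h1
  · have h2 : c ≤ inner ℝ (T.bnrm i y) (T.node i) :=
      closure_minimal (t := {x | c ≤ inner ℝ (T.bnrm i y) x}) (fun x hx => (h1 x hx).le)
        (isClosed_le continuous_const (by fun_prop)) (hT.node_mem i)
    have h3 := hT.inner_bnrm h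
    have h4 := hT.bh_pos h
    linarith

/-- Three disjoint cells cannot lie pairwise on opposite sides of one hyperplane. -/
theorem surf_face_inter_face (hT : T.IsAdmissible Ω) {i j k : Fin T.N} (hj : T.Adj i j)
    (hk : T.Adj i k) (hjk : j ≠ k) : surf d (T.face i j ∩ T.face i k) = 0 := by
  by_contra hne
  have hpos : 0 < surf d (T.face i j ∩ T.face i k) := pos_iff_ne_zero.2 hne
  obtain ⟨c, hsub, h1, h2, -⟩ := hT.adj_position hj
  have hν := hT.norm_nrm hj
  have hν0 : T.nrm i j ≠ 0 := by intro h0; simp [h0] at hν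
  obtain ⟨a, ha⟩ := hT.nonempty i
  obtain ⟨b, hb⟩ := hT.nonempty j
  obtain ⟨e, he⟩ := hT.nonempty k
  have g1 := opposite_sides (hT.isOpen_cell i) (hT.isOpen_cell k) (hT.convex_cell i)
    (hT.convex_cell k) (hT.disjoint i k hk.1) hν0 (c := c) (hpos.trans_le (measure_mono fun x hx =>
      ⟨⟨face_subset_closure T i j hx.1, face_subset_closure_right T i k hx.2⟩, hsub hx.1⟩))
  have g2 := opposite_sides (hT.isOpen_cell j) (hT.isOpen_cell k) (hT.convex_cell j)
    (hT.convex_cell k) (hT.disjoint j k hjk) hν0 (c := c) (hpos.trans_le (measure_mono fun x hx =>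
      ⟨⟨face_subset_closure_right T i j hx.1, face_subset_closure_right T i k hx.2⟩, hsub hx.1⟩))
  have f1 := h1 a ha
  have f2 := h2 b hb
  rcases g1 with ⟨-, g⟩ | ⟨g, -⟩
  · rcases g2 with ⟨g', -⟩ | ⟨-, g'⟩
    · linarith [g' b hb]
    · linarith [g e he, g' e he]
  · linarith [g a ha]

/-- Almost every point of an interior interface is interior to the union of the two closed cells. As
`Ω` has no slits, it belongs to `Ω` and not to its frontier. -/
theorem surf_face_inter_bface (hΩ : IsPolygonalDomain Ω) (hT : T.IsAdmissible Ω) {i j : Fin T.N}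
    (hj : T.Adj i j) (y : Sp d) : surf d (T.face i j ∩ T.bface Ω i y) = 0 := by
  obtain ⟨c, hsub, h1, h2, -⟩ := hT.adj_position hj
  have hν := hT.norm_nrm hj
  have hν0 : T.nrm i j ≠ 0 := by intro h0; simp [h0] at hν
  obtain ⟨a, ha⟩ := hT.nonempty i
  obtain ⟨b, hb⟩ := hT.nonempty j
  refine measure_mono_null ?_ (surf_inter_diff_interior_union (hT.convex_cell i).closure
    (hT.convex_cell j).closure hν0 (subset_closure ha) (h1 a ha) (subset_closure hb) (h2 b hb))
  rintro x ⟨hx, hxb⟩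
  refine ⟨⟨⟨face_subset_closure T i j hx, face_subset_closure_right T i j hx⟩, fun hint => ?_⟩,
    hsub hx⟩
  have hxΩ : x ∈ Ω := by
    rw [← hΩ.interior_closure]
    exact interior_mono (Set.union_subset (hT.closure_cell_subset i) (hT.closure_cell_subset j)) hint
  have hfr : x ∈ frontier Ω := hxb.1.2
  rw [hΩ.isOpen.frontier_eq] at hfr
  exact hfr.2 hxΩ

/-- A common part of positive measure makes the two planes equal, and then also the feet of the
perpendiculars from the node. -/
theorem surf_bface_inter_bface (hT : T.IsAdmissible Ω) {i : Fin T.N} {y z : Sp d}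
    (hy : y ∈ T.bnode i) (hz : z ∈ T.bnode i) (hyz : y ≠ z) :
    surf d (T.bface Ω i y ∩ T.bface Ω i z) = 0 := by
  by_contra hne
  have hν := hT.norm_bnrm hy
  have hν' := hT.norm_bnrm hz
  have hν0 : T.bnrm i y ≠ 0 := by intro h0; simp [h0] at hν
  obtain ⟨t, ht, htc⟩ := hyperplane_eq_of_surf_pos hν0 (w := T.bnrm i z)
    (s := inner ℝ (T.bnrm i z) z) (c := inner ℝ (T.bnrm i y) y)
    ((pos_iff_ne_zero.2 hne).trans_le (measure_mono fun x hx =>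
      ⟨bface_subset_hyperplane T Ω i z hx.2, bface_subset_hyperplane T Ω i y hx.1⟩))
  have hby := hT.bh_pos hy
  have hbz := hT.bh_pos hz
  have e1 : T.bh i z = t * T.bh i y := by
    have h1 := hT.inner_bnrm hy
    have h2 := hT.inner_bnrm hz
    rw [htc, h1, ht, real_inner_smul_left] at h2
    linarith
  have ht0 : 0 < t := by
    by_contra hle
    have : t * T.bh i y ≤ 0 := mul_nonpos_of_nonpos_of_nonneg (not_lt.1 hle) hby.le
    linarith
  have ht1 : t = 1 := by
    rw [ht, norm_smul, hν, mul_one, Real.norm_eq_abs, abs_of_pos ht0] at hν'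
    exact hν'
  rw [ht1, one_smul] at ht
  rw [ht1, one_mul] at e1
  rw [bnrm, bnrm, e1] at ht
  have := smul_right_injective (Sp d) (inv_ne_zero hby.ne') ht
  exact hyz (sub_left_injective this).symm

/-- The interfaces of a cell. -/
theorem hasFaces (hΩ : IsPolygonalDomain Ω) (hT : T.IsAdmissible Ω) (i : Fin T.N) :
    HasFaces (ι := {j // j ∈ T.nbrs i} ⊕ {y // y ∈ T.bnode i}) (T.cell i)
      (Sum.elim (fun j => T.nrm i j) fun y => T.bnrm i y)
      (Sum.elim (fun j => inner ℝ (T.nrm i j) (T.node i) + T.dist1 i j)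
        fun y => inner ℝ (T.bnrm i y) (T.node i) + T.bh i y)
      (Sum.elim (fun j => T.face i j) fun y => T.bface Ω i y) where
  isOpen := hT.isOpen_cell i
  convex := hT.convex_cell i
  nonempty := hT.nonempty i
  isBounded := hT.isBounded_cell i
  norm_normal := by
    rintro (j | y)
    · exact hT.norm_nrm (mem_nbrs.1 j.2)
    · exact hT.norm_bnrm y.2
  inner_lt := by
    rintro (j | y)
    · obtain ⟨c, -, h1, -, h2, -⟩ := hT.adj_position (mem_nbrs.1 j.2)
      simp only [Sum.elim_inl]
      rw [h2, add_sub_cancel]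
      exact h1
    · simp only [Sum.elim_inr]
      rw [← hT.inner_bnrm y.2]
      exact hT.inner_bnrm_lt y.2
  isClosed := by
    rintro (j | y)
    · exact isClosed_frontier.inter isClosed_frontier
    · exact (isClosed_frontier.inter isClosed_frontier).inter
        (isClosed_eq (by fun_prop) continuous_const)
  subset := by
    rintro (j | y)
    · obtain ⟨c, h1, -, -, h2, -⟩ := hT.adj_position (mem_nbrs.1 j.2)
      simp only [Sum.elim_inl]
      rw [h2, add_sub_cancel]
      exact h1
    · simp only [Sum.elim_inr]
      rw [← hT.inner_bnrm y.2]
      exact bface_subset_hyperplane T Ω i y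
  frontier_eq := by
    rw [hT.boundary i, Set.iUnion_sum]
    congr 1
    · simp only [Sum.elim_inl]
      rw [Set.iUnion_subtype]
      simp [mem_nbrs]
    · simp only [Sum.elim_inr]
      rw [Set.iUnion_subtype]
  null := by
    rintro (j | y) (k | z) hne
    · exact hT.surf_face_inter_face (mem_nbrs.1 j.2) (mem_nbrs.1 k.2)
        fun h => hne (by rw [Subtype.ext h])
    · exact hT.surf_face_inter_bface hΩ (mem_nbrs.1 j.2) z
    · rw [Set.inter_comm]
      exact hT.surf_face_inter_bface hΩ (mem_nbrs.1 k.2) y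
    · exact hT.surf_bface_inter_bface y.2 z.2 fun h => hne (by rw [Subtype.ext h])

/-- The divergence theorem on a cell. -/
theorem integral_divergence_cell (hΩ : IsPolygonalDomain Ω) (hT : T.IsAdmissible Ω) (i : Fin T.N)
    {F : Sp d → Sp d} {D : NNReal} (hF : LipschitzOnWith D F (closure (T.cell i)))
    (hdiff : DifferentiableOn ℝ F (T.cell i)) :
    ∫ x in T.cell i, divergence F x =
      ∑ j ∈ T.nbrs i, ∫ x in T.face i j, inner ℝ (F x) (T.nrm i j) ∂(surf d) +
      ∑ y ∈ T.bnode i, ∫ x in T.bface Ω i y, inner ℝ (F x) (T.bnrm i y) ∂(surf d) := by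
  rw [(hT.hasFaces hΩ i).integral_divergence hF hdiff, Fintype.sum_sum_type]
  simp only [Sum.elim_inl, Sum.elim_inr]
  rw [← Finset.sum_coe_sort (T.nbrs i), ← Finset.sum_coe_sort (T.bnode i)]

theorem divergence_sub_const (x₀ x : Sp d) : divergence (fun z => z - x₀) x = d := by
  have : fderiv ℝ (fun z : Sp d => z - x₀) x = ContinuousLinearMap.id ℝ (Sp d) :=
    ((hasFDerivAt_id x).sub_const x₀).fderiv
  simp [divergence, this]

/-- The field `x - x₀` has divergence `d`. The choice `x₀ = x_i` yields the cell volume as a sum of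
pyramids; a common `x₀` for all cells yields the Poincaré inequality. -/
theorem sum_integral_sub_const (hΩ : IsPolygonalDomain Ω) (hT : T.IsAdmissible Ω) (i : Fin T.N)
    (x₀ : Sp d) :
    ∑ j ∈ T.nbrs i, ∫ x in T.face i j, inner ℝ (x - x₀) (T.nrm i j) ∂(surf d) +
      ∑ y ∈ T.bnode i, ∫ x in T.bface Ω i y, inner ℝ (x - x₀) (T.bnrm i y) ∂(surf d) =
    d * volume.real (T.cell i) := by
  rw [← hT.integral_divergence_cell hΩ i (F := fun x => x - x₀) (D := 1)]
  · simp_rw [divergence_sub_const]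
    simp [mul_comm]
  · exact (LipschitzWith.of_dist_le_mul fun x y => by simp).lipschitzOnWith
  · fun_prop

theorem surf_face_lt_top (hT : T.IsAdmissible Ω) {i j : Fin T.N} (h : T.Adj i j) :
    surf d (T.face i j) < ⊤ := by
  obtain ⟨c, hsub, -⟩ := hT.adj_position h
  have hν := hT.norm_nrm h
  have hν0 : T.nrm i j ≠ 0 := by intro h0; simp [h0] at hν
  exact surf_lt_top hν0 ((hT.isBounded_cell i).closure.subset (face_subset_closure T i j)) hsub

theorem surf_bface_lt_top (hT : T.IsAdmissible Ω) {i : Fin T.N} {y : Sp d} (h : y ∈ T.bnode i) :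
    surf d (T.bface Ω i y) < ⊤ := by
  have hν := hT.norm_bnrm h
  have hν0 : T.bnrm i y ≠ 0 := by intro h0; simp [h0] at hν
  exact surf_lt_top hν0 ((hT.isBounded_cell i).closure.subset (bface_subset_closure T Ω i y))
    (bface_subset_hyperplane T Ω i y)

theorem m_pos (hT : T.IsAdmissible Ω) {i j : Fin T.N} (h : T.Adj i j) : 0 < T.m i j :=
  ENNReal.toReal_pos h.2.ne' (hT.surf_face_lt_top h).ne

theorem bm_pos (hT : T.IsAdmissible Ω) {i : Fin T.N} {y : Sp d} (h : y ∈ T.bnode i) :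
    0 < T.bm Ω i y :=
  ENNReal.toReal_pos (hT.bnode_pos i y h).ne' (hT.surf_bface_lt_top h).ne

theorem measurableSet_face (T : Mesh d) (i j : Fin T.N) : MeasurableSet (T.face i j) :=
  (isClosed_frontier.inter isClosed_frontier).measurableSet

theorem isClosed_bface (T : Mesh d) (Ω : Set (Sp d)) (i : Fin T.N) (y : Sp d) :
    IsClosed (T.bface Ω i y) :=
  (isClosed_frontier.inter isClosed_frontier).inter (isClosed_eq (by fun_prop) continuous_const)

/-- The pyramids over the interfaces fill the cell. -/
theorem sum_m_mul_dist1 (hΩ : IsPolygonalDomain Ω) (hT : T.IsAdmissible Ω) (i : Fin T.N) :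
    ∑ j ∈ T.nbrs i, T.m i j * T.dist1 i j + ∑ y ∈ T.bnode i, T.bm Ω i y * T.bh i y =
      d * volume.real (T.cell i) := by
  rw [← hT.sum_integral_sub_const hΩ i (T.node i)]
  congr 1
  · refine Finset.sum_congr rfl fun j hj => ?_
    obtain ⟨c, hsub, -, -, h2, -⟩ := hT.adj_position (mem_nbrs.1 hj)
    rw [setIntegral_congr_fun (g := fun _ => T.dist1 i j) (measurableSet_face T i j), setIntegral_const,
      smul_eq_mul, m]
    intro x hx
    have : inner ℝ (T.nrm i j) x = c := hsub hx
    simp only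
    rw [real_inner_comm, inner_sub_right, this, h2]
  · refine Finset.sum_congr rfl fun y hy => ?_
    rw [setIntegral_congr_fun (g := fun _ => T.bh i y) (isClosed_bface T Ω i y).measurableSet,
      setIntegral_const, smul_eq_mul, bm]
    intro x hx
    have : inner ℝ (T.bnrm i y) x = _ := bface_subset_hyperplane T Ω i y hx
    simp only
    rw [real_inner_comm, inner_sub_right, this, hT.inner_bnrm hy, add_sub_cancel_left]

end IsAdmissible

end Mesh

/-! ### Summation by parts, discrete Poincaré inequality and energy estimate. -/

namespace Mesh

variable {T : Mesh d} {Ω : Set (Sp d)}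

theorem edgeSum_mono {w w' : Fin T.N → Fin T.N → ℝ} {b b' : Fin T.N → Sp d → ℝ}
    (hw : ∀ i j, T.Adj i j → w i j ≤ w' i j) (hb : ∀ i, ∀ y ∈ T.bnode i, b i y ≤ b' i y) :
    T.edgeSum w b ≤ T.edgeSum w' b' := by
  refine add_le_add (Finset.sum_le_sum fun i _ => Finset.sum_le_sum fun j hj => ?_)
    (Finset.sum_le_sum fun i _ => Finset.sum_le_sum fun y hy => hb i y hy)
  exact hw i j (mem_nbrs.1 (Finset.mem_filter.1 hj).1)

theorem edgeSum_congr {w w' : Fin T.N → Fin T.N → ℝ} {b b' : Fin T.N → Sp d → ℝ}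
    (hw : ∀ i j, T.Adj i j → w i j = w' i j) (hb : ∀ i, ∀ y ∈ T.bnode i, b i y = b' i y) :
    T.edgeSum w b = T.edgeSum w' b' :=
  le_antisymm (edgeSum_mono (fun i j h => (hw i j h).le) fun i y h => (hb i y h).le)
    (edgeSum_mono (fun i j h => (hw i j h).ge) fun i y h => (hb i y h).ge)

theorem edgeSum_add (w w' : Fin T.N → Fin T.N → ℝ) (b b' : Fin T.N → Sp d → ℝ) :
    T.edgeSum (fun i j => w i j + w' i j) (fun i y => b i y + b' i y) =
      T.edgeSum w b + T.edgeSum w' b' := by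
  simp only [edgeSum, Finset.sum_add_distrib]
  ring

theorem edgeSum_const_mul (c : ℝ) (w : Fin T.N → Fin T.N → ℝ) (b : Fin T.N → Sp d → ℝ) :
    T.edgeSum (fun i j => c * w i j) (fun i y => c * b i y) = c * T.edgeSum w b := by
  simp only [edgeSum, ← Finset.mul_sum]
  ring

theorem sum_nbrs (T : Mesh d) (g : Fin T.N → Fin T.N → ℝ) :
    ∑ i, ∑ j ∈ T.nbrs i, g i j =
      ∑ i, ∑ j ∈ (T.nbrs i).filter (fun j => i < j), (g i j + g j i) := by
  classical
  have hswap : ∑ i, ∑ j ∈ (T.nbrs i).filter (fun j => i < j), g j i =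
      ∑ i, ∑ j ∈ (T.nbrs i).filter (fun j => ¬ i < j), g i j := by
    rw [Finset.sum_sigma', Finset.sum_sigma']
    refine Finset.sum_bij' (fun p _ => ⟨p.2, p.1⟩) (fun p _ => ⟨p.2, p.1⟩) ?_ ?_ ?_ ?_ ?_
    · rintro ⟨i, j⟩ h
      simp only [Finset.mem_sigma, Finset.mem_univ, true_and, Finset.mem_filter, mem_nbrs] at h ⊢
      exact ⟨h.1.symm, h.2.not_gt⟩
    · rintro ⟨i, j⟩ h
      simp only [Finset.mem_sigma, Finset.mem_univ, true_and, Finset.mem_filter, mem_nbrs] at h ⊢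
      exact ⟨h.1.symm, lt_of_le_of_ne (not_lt.1 h.2) h.1.1.symm⟩
    · intros; rfl
    · intros; rfl
    · intros; rfl
  simp_rw [Finset.sum_add_distrib]
  rw [hswap, ← Finset.sum_add_distrib]
  exact Finset.sum_congr rfl fun i _ => (Finset.sum_filter_add_sum_filter_not _ _ _).symm

theorem sum_mul_nbrs (T : Mesh d) (e : Fin T.N → ℝ) (q : Fin T.N → Fin T.N → ℝ)
    (b : Fin T.N → Sp d → ℝ) :
    ∑ i, e i * (∑ j ∈ T.nbrs i, q i j + ∑ y ∈ T.bnode i, b i y) =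
      T.edgeSum (fun i j => e i * q i j + e j * q j i) (fun i y => e i * b i y) := by
  simp only [mul_add, Finset.sum_add_distrib, Finset.mul_sum, edgeSum]
  rw [sum_nbrs]
  simp only [Finset.sum_add_distrib]

/-- Summation by parts. -/
theorem sum_mul_flux (T : Mesh d) (e : Fin T.N → ℝ) {q : Fin T.N → Fin T.N → ℝ}
    {b : Fin T.N → Sp d → ℝ} (hq : ∀ i j, T.Adj i j → q j i = -q i j) :
    ∑ i, e i * (∑ j ∈ T.nbrs i, q i j + ∑ y ∈ T.bnode i, b i y) =
      -T.edgeSum (fun i j => q i j * (e j - e i)) (fun i y => b i y * (0 - e i)) := by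
  rw [sum_mul_nbrs, ← neg_one_mul, ← edgeSum_const_mul]
  refine edgeSum_congr (fun i j h => ?_) fun i y _ => by ring
  rw [hq i j h]
  ring

/-- Factor the difference of squares and apply Young's inequality, weighted so that the last
coefficient `1 / 6` is small enough to be absorbed in `poincare`. -/
theorem young_interior {D m h ei ej Φ : ℝ} (hm : 0 < m) (hh : 0 < h)
    (hΦ : |Φ| ≤ D * m) :
    -(Φ * (ej ^ 2 - ei ^ 2)) ≤
      3 * D ^ 2 * (m / h * (ej - ei) ^ 2) + 1 / 6 * (m * h * (ei ^ 2 + ej ^ 2)) := by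
  have h1 : -(Φ * (ej ^ 2 - ei ^ 2)) ≤ D * m * (|ej - ei| * |ej + ei|) := by
    calc -(Φ * (ej ^ 2 - ei ^ 2)) ≤ |Φ * (ej ^ 2 - ei ^ 2)| := neg_le_abs _
      _ = |Φ| * (|ej - ei| * |ej + ei|) := by
        rw [abs_mul, ← abs_mul (ej - ei)]; congr 2; ring
      _ ≤ _ := by gcongr
  have h2 : D * m * (|ej - ei| * |ej + ei|) ≤
      3 * D ^ 2 * (m / h * (ej - ei) ^ 2) + 1 / 12 * (m * h * (ej + ei) ^ 2) := by
    have h3 : 0 ≤ m / h * (6 * D * |ej - ei| - h * |ej + ei|) ^ 2 := by positivity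
    have h4 : m / h * (6 * D * |ej - ei| - h * |ej + ei|) ^ 2 =
        36 * D ^ 2 * (m / h * |ej - ei| ^ 2) - 12 * (D * m * (|ej - ei| * |ej + ei|)) +
          m * h * |ej + ei| ^ 2 := by
      field_simp
      ring
    rw [h4, sq_abs, sq_abs] at h3
    linarith
  have h5 : m * h * (ej + ei) ^ 2 ≤ m * h * (2 * (ei ^ 2 + ej ^ 2)) := by
    gcongr
    nlinarith [sq_nonneg (ej - ei)]
  linarith

namespace IsAdmissible

theorem hh_le (hT : T.IsAdmissible Ω) {D : ℝ}
    (hD : ∀ x ∈ closure Ω, ∀ y ∈ closure Ω, dist x y ≤ D) (i j : Fin T.N) : T.hh i j ≤ D :=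
  hD _ (hT.closure_cell_subset i (hT.node_mem i)) _ (hT.closure_cell_subset j (hT.node_mem j))

theorem abs_integral_face_le (hT : T.IsAdmissible Ω) {i j : Fin T.N} (h : T.Adj i j)
    {g : Sp d → ℝ} {B : ℝ} (hg : ∀ x ∈ T.face i j, |g x| ≤ B) :
    |∫ x in T.face i j, g x ∂(surf d)| ≤ B * T.m i j := by
  rw [← Real.norm_eq_abs]
  exact norm_setIntegral_le_of_norm_le_const (hT.surf_face_lt_top h) hg

theorem abs_integral_bface_le (hT : T.IsAdmissible Ω) {i : Fin T.N} {y : Sp d} (h : y ∈ T.bnode i)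
    {g : Sp d → ℝ} {B : ℝ} (hg : ∀ x ∈ T.bface Ω i y, |g x| ≤ B) :
    |∫ x in T.bface Ω i y, g x ∂(surf d)| ≤ B * T.bm Ω i y := by
  rw [← Real.norm_eq_abs]
  exact norm_setIntegral_le_of_norm_le_const (hT.surf_bface_lt_top h) hg

/-- The discrete Poincaré inequality, with weights `m_ij h_ij` on the left. -/
theorem poincare (hΩ : IsPolygonalDomain Ω) (hT : T.IsAdmissible Ω) {D : ℝ}
    (hD : ∀ x ∈ closure Ω, ∀ y ∈ closure Ω, dist x y ≤ D) (e : Fin T.N → ℝ) :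
    T.edgeSum (fun i j => T.m i j * T.hh i j * (e i ^ 2 + e j ^ 2))
        (fun i y => T.bm Ω i y * T.bh i y * e i ^ 2) ≤
      22 * D ^ 2 * T.edgeSum (fun i j => T.m i j / T.hh i j * (e j - e i) ^ 2)
        (fun i y => T.bm Ω i y / T.bh i y * (0 - e i) ^ 2) := by
  obtain ⟨x₀, hx₀⟩ := hΩ.isConnected.nonempty
  have hD0 : 0 ≤ D := dist_nonneg.trans (hD x₀ (subset_closure hx₀) x₀ (subset_closure hx₀))
  set Z := T.edgeSum (fun i j => T.m i j * T.hh i j * (e i ^ 2 + e j ^ 2))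
        (fun i y => T.bm Ω i y * T.bh i y * e i ^ 2) with hZ
  set Y := T.edgeSum (fun i j => T.m i j / T.hh i j * (e j - e i) ^ 2)
        (fun i y => T.bm Ω i y / T.bh i y * (0 - e i) ^ 2) with hY
  -- Up to the factor `d` this is the squared `L²` norm of the piecewise constant function `e`.
  set X := ∑ i, e i ^ 2 * (d * volume.real (T.cell i)) with hX
  have hX1 : X = T.edgeSum (fun i j => T.m i j * (T.dist1 i j * e i ^ 2 + T.dist1 j i * e j ^ 2))
      (fun i y => T.bm Ω i y * T.bh i y * e i ^ 2) := by
    rw [hX]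
    simp_rw [← hT.sum_m_mul_dist1 hΩ]
    rw [sum_mul_nbrs]
    refine edgeSum_congr (fun i j _ => ?_) fun i y _ => by ring
    rw [T.m_comm j i]
    ring
  -- In `X` the value `e_i` has only the weight `m_ij d_{i,ij}`, possibly zero. The missing share is
  -- moved to the other side of the interface at the cost of the jump.
  have hZX : Z ≤ 3 * X + 2 * D ^ 2 * Y := by
    rw [hX1, hY, hZ, ← edgeSum_const_mul, ← edgeSum_const_mul, ← edgeSum_add]
    refine edgeSum_mono (fun i j h => ?_) fun i y h => ?_
    · have hm := hT.m_pos h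
      have hh := hT.hh_pos h
      have hle := hT.hh_le hD i j
      obtain ⟨c, -, -, -, -, -, h1, h2⟩ := hT.adj_position h
      have hadd := hT.dist1_add h
      have key : T.hh i j * (e i ^ 2 + e j ^ 2) ≤
          3 * (T.dist1 i j * e i ^ 2 + T.dist1 j i * e j ^ 2) + 2 * T.hh i j * (e j - e i) ^ 2 := by
        have g1 : T.dist1 j i * e i ^ 2 ≤ T.dist1 j i * (2 * e j ^ 2 + 2 * (e j - e i) ^ 2) := by
          gcongr; nlinarith [sq_nonneg (2 * e j - e i)]
        have g2 : T.dist1 i j * e j ^ 2 ≤ T.dist1 i j * (2 * e i ^ 2 + 2 * (e j - e i) ^ 2) := by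
          gcongr; nlinarith [sq_nonneg (2 * e i - e j)]
        rw [← hadd]
        linarith
      have hD2 : T.m i j * T.hh i j ≤ D ^ 2 * (T.m i j / T.hh i j) := by
        rw [← mul_div_assoc, le_div_iff₀ hh]
        have : T.hh i j * T.hh i j ≤ D * D := mul_le_mul hle hle hh.le hD0
        nlinarith
      calc T.m i j * T.hh i j * (e i ^ 2 + e j ^ 2)
          = T.m i j * (T.hh i j * (e i ^ 2 + e j ^ 2)) := by ring
        _ ≤ T.m i j * (3 * (T.dist1 i j * e i ^ 2 + T.dist1 j i * e j ^ 2) +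
            2 * T.hh i j * (e j - e i) ^ 2) := by gcongr
        _ = 3 * (T.m i j * (T.dist1 i j * e i ^ 2 + T.dist1 j i * e j ^ 2)) +
            2 * (T.m i j * T.hh i j * (e j - e i) ^ 2) := by ring
        _ ≤ 3 * (T.m i j * (T.dist1 i j * e i ^ 2 + T.dist1 j i * e j ^ 2)) +
            2 * (D ^ 2 * (T.m i j / T.hh i j) * (e j - e i) ^ 2) := by gcongr
        _ = _ := by ring
    · have hm := hT.bm_pos h
      have hh := hT.bh_pos h
      have h1 : 0 ≤ T.bm Ω i y * T.bh i y * e i ^ 2 := by positivity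
      have h2 : 0 ≤ 2 * D ^ 2 * (T.bm Ω i y / T.bh i y * (0 - e i) ^ 2) := by positivity
      linarith
  -- Write `d |Ω_i|` as the flux of `x - x₀` out of the cell and sum by parts against `e²`; the flux
  -- through an interface is at most `D` times its measure.
  have hXYZ : X ≤ 3 * D ^ 2 * Y + 1 / 6 * Z := by
    have hx : ∀ x ∈ closure Ω, ∀ ν : Sp d, ‖ν‖ = 1 → |inner ℝ (x - x₀) ν| ≤ D := by
      intro x hx ν hν
      refine (abs_real_inner_le_norm _ _).trans ?_
      rw [hν, mul_one, ← dist_eq_norm]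
      exact hD x hx x₀ (subset_closure hx₀)
    rw [hX]
    simp_rw [← hT.sum_integral_sub_const hΩ _ x₀]
    rw [sum_mul_flux, hY, hZ, ← edgeSum_const_mul, ← edgeSum_const_mul, ← edgeSum_add,
      ← neg_one_mul, ← edgeSum_const_mul]
    · refine edgeSum_mono (fun i j h => ?_) fun i y h => ?_
      · rw [neg_one_mul]
        refine young_interior (hT.m_pos h) (hT.hh_pos h) (hT.abs_integral_face_le h fun x hxf => ?_)
        exact hx x (hT.closure_cell_subset i (face_subset_closure T i j hxf)) _ (hT.norm_nrm h)
      · have := young_interior (ei := e i) (ej := 0) (hT.bm_pos h) (hT.bh_pos h)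
          (hT.abs_integral_bface_le h (B := D) (g := fun x => inner ℝ (x - x₀) (T.bnrm i y))
            fun x hxf => hx x (hT.closure_cell_subset i (bface_subset_closure T Ω i y hxf)) _
              (hT.norm_bnrm h))
        simpa using this
    · intro i j _
      rw [T.face_comm, ← integral_neg, T.nrm_comm]
      simp only [inner_neg_right]
  -- Together the two bounds give `Z ≤ 11 D² Y + Z / 2`, whence the constant `22`.
  have : 0 ≤ D ^ 2 := sq_nonneg D
  linarith

/-- The two pyramids over an interface have heights that add up to `h_ij`, and all pyramids fill the
disjoint cells. -/
theorem edgeSum_m_mul_hh (hΩ : IsPolygonalDomain Ω) (hT : T.IsAdmissible Ω) :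
    T.edgeSum (fun i j => T.m i j * T.hh i j) (fun i y => T.bm Ω i y * T.bh i y) ≤
      d * volume.real (closure Ω) := by
  have h1 : T.edgeSum (fun i j => T.m i j * T.hh i j) (fun i y => T.bm Ω i y * T.bh i y) =
      ∑ i, 1 * (d * volume.real (T.cell i)) := by
    simp_rw [← hT.sum_m_mul_dist1 hΩ]
    rw [T.sum_mul_nbrs (fun _ => 1)]
    refine edgeSum_congr (fun i j h => ?_) fun i y _ => by ring
    rw [T.m_comm j i, ← hT.dist1_add h]
    ring
  rw [h1]
  simp_rw [one_mul, ← Finset.mul_sum]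
  gcongr
  rw [← measureReal_iUnion_fintype (fun i j hij => hT.disjoint i j hij)
    (fun i => (hT.isOpen_cell i).measurableSet) (fun i => (hT.isBounded_cell i).measure_lt_top.ne)]
  refine measureReal_mono (Set.iUnion_subset fun i => subset_closure.trans (hT.closure_cell_subset i))
    hΩ.isCompact_closure.measure_lt_top.ne

/-- Half of the energy is left for absorption. Splitting `r` into `s * c` and a remainder produces a
term of the consistency sum, with `s ≤ p₂`, and a multiple of `m h`. -/
theorem young_residual {m h k s p₁ p₂ k₁ G r c D : ℝ} (hm : 0 < m) (hh : 0 < h) (hk₁ : 0 < k₁)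
    (hk : k₁ ≤ k) (hp₁ : 0 < p₁) (hs₁ : p₁ ≤ s) (hs₂ : s ≤ p₂) (hr : |r - s * c| ≤ G * m) :
    r * D ≤ 1 / 2 * (m / h * k * s * D ^ 2) + p₂ * (h / m * k⁻¹ * |c| ^ 2) +
      G ^ 2 / (k₁ * p₁) * (m * h) := by
  have hk0 : 0 < k := hk₁.trans_le hk
  have hs0 : 0 < s := hp₁.trans_le hs₁
  have h1 : r * D ≤ 1 / 2 * (m / h * k * s * D ^ 2) + 1 / 2 * (h / (m * k * s) * r ^ 2) := by
    have h2 : 0 ≤ h / (m * k * s) * (m / h * k * s * D - r) ^ 2 := by positivity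
    have h3 : h / (m * k * s) * (m / h * k * s * D - r) ^ 2 =
        m / h * k * s * D ^ 2 - 2 * (r * D) + h / (m * k * s) * r ^ 2 := by
      field_simp
      ring
    rw [h3] at h2
    linarith
  have h4 : r ^ 2 ≤ 2 * (s ^ 2 * c ^ 2) + 2 * (G * m) ^ 2 := by
    have h5 : (r - s * c) ^ 2 ≤ (G * m) ^ 2 := sq_le_sq' (by linarith [(abs_le.1 hr).1]) (abs_le.1 hr).2
    nlinarith [sq_nonneg (r - 2 * (s * c))]
  have h6 : 1 / 2 * (h / (m * k * s) * r ^ 2) ≤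
      s * (h / m * k⁻¹ * |c| ^ 2) + G ^ 2 / (k * s) * (m * h) := by
    calc 1 / 2 * (h / (m * k * s) * r ^ 2)
        ≤ 1 / 2 * (h / (m * k * s) * (2 * (s ^ 2 * c ^ 2) + 2 * (G * m) ^ 2)) := by gcongr
      _ = _ := by
        rw [sq_abs]
        field_simp
  have h7 : s * (h / m * k⁻¹ * |c| ^ 2) ≤ p₂ * (h / m * k⁻¹ * |c| ^ 2) := by gcongr
  have h8 : G ^ 2 / (k * s) * (m * h) ≤ G ^ 2 / (k₁ * p₁) * (m * h) := by gcongr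
  linarith

/-- The energy estimate for the error of the scheme in terms of its residual. -/
theorem energy_estimate (hΩ : IsPolygonalDomain Ω) (hT : T.IsAdmissible Ω) {κ : Sp d → ℝ}
    {k₁ p₁ p₂ G : ℝ} (hk₁ : 0 < k₁) (hp₁ : 0 < p₁) (hk : ∀ i j, T.Adj i j → k₁ ≤ T.kap κ i j)
    (hkb : ∀ i, k₁ ≤ T.kbar κ i) {s : Fin T.N → Fin T.N → ℝ} {sb : Fin T.N → Sp d → ℝ}
    (hs : ∀ i j, T.Adj i j → p₁ ≤ s i j ∧ s i j ≤ p₂)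
    (hsb : ∀ i, ∀ y ∈ T.bnode i, p₁ ≤ sb i y ∧ sb i y ≤ p₂)
    (hsymm : ∀ i j, s i j = s j i) {r c : Fin T.N → Fin T.N → ℝ} {rb cb : Fin T.N → Sp d → ℝ}
    (hanti : ∀ i j, T.Adj i j → r j i = -r i j)
    (hr : ∀ i j, T.Adj i j → |r i j - s i j * c i j| ≤ G * T.m i j)
    (hrb : ∀ i, ∀ y ∈ T.bnode i, |rb i y - sb i y * cb i y| ≤ G * T.bm Ω i y) {e : Fin T.N → ℝ}
    (he : ∀ i, ∑ j ∈ T.nbrs i, T.m i j / T.hh i j * T.kap κ i j * s i j * (e j - e i) +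
      ∑ y ∈ T.bnode i, T.bm Ω i y / T.bh i y * T.kbar κ i * sb i y * (0 - e i) =
        ∑ j ∈ T.nbrs i, r i j + ∑ y ∈ T.bnode i, rb i y) :
    k₁ * p₁ * T.edgeSum (fun i j => T.m i j / T.hh i j * (e j - e i) ^ 2)
        (fun i y => T.bm Ω i y / T.bh i y * (0 - e i) ^ 2) ≤
      2 * p₂ * T.edgeSum (fun i j => T.hh i j / T.m i j * (T.kap κ i j)⁻¹ * |c i j| ^ 2)
        (fun i y => T.bh i y / T.bm Ω i y * (T.kbar κ i)⁻¹ * |cb i y| ^ 2) +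
      2 * (G ^ 2 / (k₁ * p₁)) * (d * volume.real (closure Ω)) := by
  set W := T.edgeSum (fun i j => T.m i j / T.hh i j * T.kap κ i j * s i j * (e j - e i) ^ 2)
    (fun i y => T.bm Ω i y / T.bh i y * T.kbar κ i * sb i y * (0 - e i) ^ 2) with hW
  -- Test the error equation with `e` and sum both sides by parts.
  have hWr : W = T.edgeSum (fun i j => r i j * (e j - e i)) (fun i y => rb i y * (0 - e i)) := by
    have h1 := T.sum_mul_flux e (b := rb) hanti
    simp_rw [← he] at h1
    rw [T.sum_mul_flux e] at h1
    · rw [← neg_inj.1 h1, hW]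
      exact edgeSum_congr (fun i j _ => by ring) fun i y _ => by ring
    · intro i j _
      rw [T.m_comm j i, T.hh_comm j i, T.kap_comm κ j i, hsymm j i]
      ring
  have hle : W ≤ 1 / 2 * W +
      p₂ * T.edgeSum (fun i j => T.hh i j / T.m i j * (T.kap κ i j)⁻¹ * |c i j| ^ 2)
        (fun i y => T.bh i y / T.bm Ω i y * (T.kbar κ i)⁻¹ * |cb i y| ^ 2) +
      G ^ 2 / (k₁ * p₁) *
        T.edgeSum (fun i j => T.m i j * T.hh i j) (fun i y => T.bm Ω i y * T.bh i y) := by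
    nth_rw 1 [hWr]
    rw [hW, ← edgeSum_const_mul, ← edgeSum_const_mul, ← edgeSum_const_mul, ← edgeSum_add,
      ← edgeSum_add]
    refine edgeSum_mono (fun i j h => ?_) fun i y h => ?_
    · exact young_residual (hT.m_pos h) (hT.hh_pos h) hk₁ (hk i j h) hp₁ (hs i j h).1 (hs i j h).2
        (hr i j h)
    · exact young_residual (hT.bm_pos h) (hT.bh_pos h) hk₁ (hkb i) hp₁ (hsb i y h).1 (hsb i y h).2
        (hrb i y h)
  have hvol := hT.edgeSum_m_mul_hh hΩ
  have hG : 0 ≤ G ^ 2 / (k₁ * p₁) := by positivity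
  have hvol' := mul_le_mul_of_nonneg_left hvol hG
  have hlow : k₁ * p₁ * T.edgeSum (fun i j => T.m i j / T.hh i j * (e j - e i) ^ 2)
        (fun i y => T.bm Ω i y / T.bh i y * (0 - e i) ^ 2) ≤ W := by
    have aux : ∀ m h k s D : ℝ, 0 < m → 0 < h → k₁ ≤ k → p₁ ≤ s →
        k₁ * p₁ * (m / h * D ^ 2) ≤ m / h * k * s * D ^ 2 := by
      intro m h k s D hm hh hk hs
      have : k₁ * p₁ ≤ k * s := mul_le_mul hk hs hp₁.le (hk₁.le.trans hk)
      calc k₁ * p₁ * (m / h * D ^ 2) ≤ k * s * (m / h * D ^ 2) := by gcongr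
        _ = _ := by ring
    rw [hW, ← edgeSum_const_mul]
    refine edgeSum_mono (fun i j h => ?_) fun i y h => ?_
    · exact aux _ _ _ _ _ (hT.m_pos h) (hT.hh_pos h) (hk i j h) (hs i j h).1
    · exact aux _ _ _ _ _ (hT.bm_pos h) (hT.bh_pos h) (hkb i) (hsb i y h).1
  linarith

/-- The weighted error is controlled by the error in the discrete `H¹` seminorm. -/
theorem normSq_mul_le (hΩ : IsPolygonalDomain Ω) (hT : T.IsAdmissible Ω) {κ : Sp d → ℝ}
    {D k₂ p₂ L : ℝ} (hD : ∀ x ∈ closure Ω, ∀ y ∈ closure Ω, dist x y ≤ D) (hk₂ : 0 ≤ k₂)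
    (hk : ∀ i j, T.Adj i j → T.kap κ i j ≤ k₂) (hkb : ∀ i, T.kbar κ i ≤ k₂) {p : Sp d → ℝ}
    (hp : ∀ x ∈ closure Ω, |p x| ≤ p₂)
    (hpL : ∀ x ∈ closure Ω, ∀ y ∈ closure Ω, |p x - p y| ≤ L * dist x y) (e : Fin T.N → ℝ) :
    T.normSq Ω κ (fun i => p (T.node i) * e i) ≤
      k₂ * (2 * p₂ ^ 2 + 44 * L ^ 2 * D ^ 2) *
        T.edgeSum (fun i j => T.m i j / T.hh i j * (e j - e i) ^ 2)
        (fun i y => T.bm Ω i y / T.bh i y * (0 - e i) ^ 2) := by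
  have hnode : ∀ i, T.node i ∈ closure Ω := fun i => hT.closure_cell_subset i (hT.node_mem i)
  have hpsq : ∀ i, p (T.node i) ^ 2 ≤ p₂ ^ 2 := fun i => by
    rw [← sq_abs]; exact pow_le_pow_left₀ (abs_nonneg _) (hp _ (hnode i)) 2
  have hpc := hT.poincare hΩ hD e
  have h1 : T.normSq Ω κ (fun i => p (T.node i) * e i) ≤
      k₂ * (2 * p₂ ^ 2) * T.edgeSum (fun i j => T.m i j / T.hh i j * (e j - e i) ^ 2)
        (fun i y => T.bm Ω i y / T.bh i y * (0 - e i) ^ 2) +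
      k₂ * (2 * L ^ 2) * T.edgeSum (fun i j => T.m i j * T.hh i j * (e i ^ 2 + e j ^ 2))
        (fun i y => T.bm Ω i y * T.bh i y * e i ^ 2) := by
    rw [normSq, ← edgeSum_const_mul, ← edgeSum_const_mul, ← edgeSum_add]
    refine edgeSum_mono (fun i j h => ?_) fun i y h => ?_
    · have hm := hT.m_pos h
      have hh := hT.hh_pos h
      have hdiff : (p (T.node j) - p (T.node i)) ^ 2 ≤ (L * T.hh i j) ^ 2 := by
        rw [← sq_abs]
        refine pow_le_pow_left₀ (abs_nonneg _) ?_ 2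
        rw [abs_sub_comm]
        exact hpL _ (hnode i) _ (hnode j)
      -- Discrete product rule: the difference is `p_j (e_j - e_i) + (p_j - p_i) e_i`, and `p_j -
      -- p_i` is at most `L h_ij`.
      have hsq : (p (T.node j) * e j - p (T.node i) * e i) ^ 2 ≤
          2 * p₂ ^ 2 * (e j - e i) ^ 2 + 2 * (L * T.hh i j) ^ 2 * (e i ^ 2 + e j ^ 2) := by
        have g1 : p (T.node j) ^ 2 * (e j - e i) ^ 2 ≤ p₂ ^ 2 * (e j - e i) ^ 2 :=
          mul_le_mul_of_nonneg_right (hpsq j) (sq_nonneg _)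
        have g2 : (p (T.node j) - p (T.node i)) ^ 2 * e i ^ 2 ≤ (L * T.hh i j) ^ 2 * e i ^ 2 :=
          mul_le_mul_of_nonneg_right hdiff (sq_nonneg _)
        have g3 : 0 ≤ (L * T.hh i j) ^ 2 * e j ^ 2 := by positivity
        nlinarith [sq_nonneg (p (T.node j) * (e j - e i) - (p (T.node j) - p (T.node i)) * e i)]
      calc T.m i j / T.hh i j * T.kap κ i j * (p (T.node j) * e j - p (T.node i) * e i) ^ 2
          ≤ T.m i j / T.hh i j * k₂ * (p (T.node j) * e j - p (T.node i) * e i) ^ 2 := by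
            gcongr; exact hk i j h
        _ ≤ T.m i j / T.hh i j * k₂ *
            (2 * p₂ ^ 2 * (e j - e i) ^ 2 + 2 * (L * T.hh i j) ^ 2 * (e i ^ 2 + e j ^ 2)) := by
            gcongr
        _ = _ := by field_simp
    · have hm := hT.bm_pos h
      have hh := hT.bh_pos h
      have hsq : (0 - p (T.node i) * e i) ^ 2 ≤ 2 * p₂ ^ 2 * (0 - e i) ^ 2 := by
        have g1 : p (T.node i) ^ 2 * e i ^ 2 ≤ p₂ ^ 2 * e i ^ 2 :=
          mul_le_mul_of_nonneg_right (hpsq i) (sq_nonneg _)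
        have g2 : 0 ≤ p₂ ^ 2 * e i ^ 2 := by positivity
        nlinarith
      have hnn : 0 ≤ k₂ * (2 * L ^ 2) * (T.bm Ω i y * T.bh i y * e i ^ 2) := by positivity
      calc T.bm Ω i y / T.bh i y * T.kbar κ i * (0 - p (T.node i) * e i) ^ 2
          ≤ T.bm Ω i y / T.bh i y * k₂ * (0 - p (T.node i) * e i) ^ 2 := by
            gcongr; exact hkb i
        _ ≤ T.bm Ω i y / T.bh i y * k₂ * (2 * p₂ ^ 2 * (0 - e i) ^ 2) := by gcongr
        _ = k₂ * (2 * p₂ ^ 2) * (T.bm Ω i y / T.bh i y * (0 - e i) ^ 2) := by ring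
        _ ≤ _ := by linarith
  have h2 : 0 ≤ k₂ * (2 * L ^ 2) := by positivity
  -- The Poincaré constant `22` times the factor `2` of the product rule gives `44`.
  have h3 := mul_le_mul_of_nonneg_left hpc h2
  linarith

end IsAdmissible

end Mesh

/-! ### The flux of the equation in terms of `u / π`. -/

/-- The vector that represents a linear form. -/
def vec (l : Sp d →L[ℝ] ℝ) : Sp d := ∑ k, l (EuclideanSpace.single k 1) • EuclideanSpace.single k 1

theorem inner_vec (l : Sp d →L[ℝ] ℝ) (v : Sp d) : inner ℝ (vec l) v = l v := by
  have hv : v = ∑ k, v k • EuclideanSpace.single k (1 : ℝ) := by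
    ext i
    simp [Pi.single_apply]
  conv_rhs => rw [hv]
  rw [vec, sum_inner, map_sum]
  refine Finset.sum_congr rfl fun k _ => ?_
  rw [real_inner_smul_left, map_smul, EuclideanSpace.inner_single_left, smul_eq_mul]
  simp [mul_comm]

theorem gradient_eq_vec (u : Sp d → ℝ) (x : Sp d) : gradient u x = vec (fderiv ℝ u x) := by
  refine ext_inner_right ℝ fun v => ?_
  rw [inner_vec, gradient, InnerProductSpace.toDual_symm_apply]

theorem contDiff_vec : ContDiff ℝ 1 (vec : (Sp d →L[ℝ] ℝ) → Sp d) := by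
  unfold vec
  fun_prop

/-- In the interior the flux of the Fokker-Planck equation is `κ π ∇(u / π)`. -/
theorem divergence_flux {Ω : Set (Sp d)} (hΩ : IsOpen Ω) {κ V u : Sp d → ℝ}
    (hκ : ContDiffOn ℝ 1 κ (closure Ω)) (hV : ContDiffOn ℝ 2 V (closure Ω))
    (hu : ContDiffOn ℝ 2 u (closure Ω)) {x : Sp d} (hx : x ∈ Ω) :
    divergence (fun z => (κ z * Real.exp (-V z)) •
        vec (fderivWithin ℝ (fun y => u y / Real.exp (-V y)) (closure Ω) z)) x =
      divergence (fun z => κ z • gradient u z) x +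
        divergence (fun z => (κ z * u z) • gradient V z) x := by
  have hnhds : ∀ z ∈ Ω, closure Ω ∈ nhds z := fun z hz =>
    Filter.mem_of_superset (hΩ.mem_nhds hz) subset_closure
  have hκd : ∀ z ∈ Ω, DifferentiableAt ℝ κ z := fun z hz =>
    (hκ.contDiffAt (hnhds z hz)).differentiableAt (by norm_num)
  have hVd : ∀ z ∈ Ω, DifferentiableAt ℝ V z := fun z hz =>
    (hV.contDiffAt (hnhds z hz)).differentiableAt (by norm_num)
  have hud : ∀ z ∈ Ω, DifferentiableAt ℝ u z := fun z hz =>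
    (hu.contDiffAt (hnhds z hz)).differentiableAt (by norm_num)
  have hgrad : ∀ w : Sp d → ℝ, ContDiffOn ℝ 2 w (closure Ω) → DifferentiableAt ℝ (gradient w) x := by
    intro w hw
    have h1 : ContDiffAt ℝ 1 (fderiv ℝ w) x :=
      (hw.contDiffAt (hnhds x hx)).fderiv_right (by norm_num)
    have h2 : gradient w = fun z => vec (fderiv ℝ w z) := funext fun z => gradient_eq_vec w z
    rw [h2]
    exact ((contDiff_vec.contDiffAt).comp x h1).differentiableAt (by norm_num)
  have heq : (fun z => (κ z * Real.exp (-V z)) •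
        vec (fderivWithin ℝ (fun y => u y / Real.exp (-V y)) (closure Ω) z)) =ᶠ[nhds x]
      fun z => κ z • gradient u z + (κ z * u z) • gradient V z := by
    filter_upwards [hΩ.mem_nhds hx] with z hz
    rw [fderivWithin_of_mem_nhds (hnhds z hz)]
    refine ext_inner_right ℝ fun v => ?_
    rw [gradient_eq_vec, gradient_eq_vec, inner_add_left, real_inner_smul_left,
      real_inner_smul_left, real_inner_smul_left, inner_vec, inner_vec, inner_vec]
    -- Since `U = u e^V`, the product rule gives `κ π ∇U = κ ∇u + κ u ∇V`.
    have hE : (fun y => u y / Real.exp (-V y)) = fun y => u y * Real.exp (V y) := by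
      funext y
      rw [Real.exp_neg, div_inv_eq_mul]
    have hder : HasFDerivAt (fun y => u y * Real.exp (V y))
        (u z • (Real.exp (V z) • fderiv ℝ V z) + Real.exp (V z) • fderiv ℝ u z) z :=
      (hud z hz).hasFDerivAt.mul (hVd z hz).hasFDerivAt.exp
    rw [hE, hder.fderiv]
    simp only [add_apply, smul_apply, smul_eq_mul]
    have hexp : Real.exp (-V z) * Real.exp (V z) = 1 := by rw [← Real.exp_add]; simp
    linear_combination (κ z * (u z * fderiv ℝ V z v + fderiv ℝ u z v)) * hexp
  have h1 : DifferentiableAt ℝ (fun z => κ z • gradient u z) x := (hκd x hx).smul (hgrad u hu)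
  have h2 : DifferentiableAt ℝ (fun z => (κ z * u z) • gradient V z) x :=
    ((hκd x hx).mul (hud x hx)).smul (hgrad V hV)
  simp only [divergence]
  rw [heq.fderiv_eq, fderiv_fun_add h1 h2, ← Finset.sum_add_distrib]
  rfl

/-- The mean lies between `a` and `b`, and the interval of radius `B` about `q` is convex. -/
theorem IsSmoothMean.abs_sub_le {S : ℝ → ℝ → ℝ} (hS : IsSmoothMean S) {a b q B : ℝ} (ha : 0 < a)
    (hb : 0 < b) (hqa : |q - a| ≤ B) (hqb : |q - b| ≤ B) : |q - S a b| ≤ B := by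
  have h1 := hS.min_le a b ha hb
  have h2 := hS.le_max a b ha hb
  rw [abs_le] at *
  rcases le_total a b with h | h
  · rw [min_eq_left h] at h1
    rw [max_eq_right h] at h2
    constructor <;> linarith
  · rw [min_eq_right h] at h1
    rw [max_eq_left h] at h2
    constructor <;> linarith

/-! ### Coefficient bounds and flux balance on the cells. -/

namespace Mesh

variable {T : Mesh d} {Ω : Set (Sp d)}

namespace IsAdmissible

/-- Each point lies in a closed cell, a convex set with interior. This makes `fderivWithin` on
`closure Ω` well behaved up to the boundary. -/
theorem uniqueDiffOn_closure (hT : T.IsAdmissible Ω) : UniqueDiffOn ℝ (closure Ω) := by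
  intro x hx
  rw [← hT.cover] at hx
  obtain ⟨i, hi⟩ := Set.mem_iUnion.1 hx
  refine (uniqueDiffOn_convex (hT.convex_cell i).closure ?_ x hi).mono (hT.closure_cell_subset i)
  exact (hT.nonempty i).mono (interior_maximal subset_closure (hT.isOpen_cell i))

theorem kbar_mem (hΩ : IsPolygonalDomain Ω) (hT : T.IsAdmissible Ω) {κ : Sp d → ℝ} {κlo κhi : ℝ}
    (hκ : ContinuousOn κ (closure Ω)) (hκb : ∀ x ∈ Ω, κlo ≤ κ x ∧ κ x ≤ κhi) (i : Fin T.N) :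
    T.kbar κ i ∈ Set.Icc κlo κhi := by
  refine (convex_Icc κlo κhi).set_average_mem isClosed_Icc
    ((hT.isOpen_cell i).measure_pos volume (hT.nonempty i)).ne'
    (hT.isBounded_cell i).measure_lt_top.ne ?_ ?_
  · filter_upwards [ae_restrict_mem (hT.isOpen_cell i).measurableSet] with x hx
    exact hκb x (hT.cell_subset hΩ i hx)
  · exact ((hκ.mono (hT.closure_cell_subset i)).integrableOn_compact
      (hT.isBounded_cell i).isCompact_closure).mono_set subset_closure

/-- As `d_{i,ij} + d_{j,ij} = h_ij`, the denominator is a convex combination of the two cell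
averages. -/
theorem kap_mem (hΩ : IsPolygonalDomain Ω) (hT : T.IsAdmissible Ω) {κ : Sp d → ℝ} {κlo κhi : ℝ}
    (hlo : 0 < κlo) (hκ : ContinuousOn κ (closure Ω)) (hκb : ∀ x ∈ Ω, κlo ≤ κ x ∧ κ x ≤ κhi)
    {i j : Fin T.N} (h : T.Adj i j) :
    T.kap κ i j ∈ Set.Icc (κlo ^ 2 / κhi) (κhi ^ 2 / κlo) := by
  obtain ⟨hi1, hi2⟩ := hT.kbar_mem hΩ hκ hκb i
  obtain ⟨hj1, hj2⟩ := hT.kbar_mem hΩ hκ hκb j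
  obtain ⟨c, -, -, -, -, -, h1, h2⟩ := hT.adj_position h
  have hh := hT.hh_pos h
  have hadd := hT.dist1_add h
  have hhi : 0 < κhi := hlo.trans_le (hi1.trans hi2)
  set a := T.dist1 i j / T.hh i j with ha
  set b := T.dist1 j i / T.hh i j with hb
  have ha0 : 0 ≤ a := div_nonneg h1 hh.le
  have hb0 : 0 ≤ b := div_nonneg h2 hh.le
  have hab : a + b = 1 := by rw [ha, hb, ← add_div, hadd, div_self hh.ne']
  have hden1 : κlo ≤ T.kbar κ i * a + T.kbar κ j * b := by
    calc κlo = κlo * a + κlo * b := by rw [← mul_add, hab, mul_one]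
      _ ≤ _ := by gcongr
  have hden2 : T.kbar κ i * a + T.kbar κ j * b ≤ κhi := by
    calc _ ≤ κhi * a + κhi * b := by gcongr
      _ = κhi := by rw [← mul_add, hab, mul_one]
  have hden0 : 0 < T.kbar κ i * a + T.kbar κ j * b := hlo.trans_le hden1
  have hi0 : 0 < T.kbar κ i := hlo.trans_le hi1
  have hj0 : 0 < T.kbar κ j := hlo.trans_le hj1
  have hnum1 : κlo ^ 2 ≤ T.kbar κ i * T.kbar κ j := by
    rw [sq]; exact mul_le_mul hi1 hj1 hlo.le hi0.le
  have hnum2 : T.kbar κ i * T.kbar κ j ≤ κhi ^ 2 := by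
    rw [sq]; exact mul_le_mul hi2 hj2 hj0.le hhi.le
  constructor
  · exact div_le_div₀ (mul_pos hi0 hj0).le hnum1 hden0 hden2
  · exact div_le_div₀ (by positivity) hnum2 hlo hden1

theorem integrableOn_surf {σ : Set (Sp d)} (hσ : IsCompact σ) (hfin : surf d σ < ⊤) {g : Sp d → ℝ}
    (hg : ContinuousOn g σ) : IntegrableOn g σ (surf d) := by
  have : IsFiniteMeasure ((surf d).restrict σ) := ⟨by rwa [Measure.restrict_apply_univ]⟩
  have h := hg.integrableOn_compact (μ := (surf d).restrict σ) hσ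
  rwa [IntegrableOn, Measure.restrict_restrict hσ.measurableSet, Set.inter_self] at h

/-- Freezing the weight `p` in a flux integral changes it little. -/
theorem abs_weighted_flux_sub_le {σ : Set (Sp d)} (hσ : IsCompact σ) (hfin : surf d σ < ⊤)
    {κ p : Sp d → ℝ} {G : Sp d → Sp d →L[ℝ] ℝ} (hκ : ContinuousOn κ σ) (hp : ContinuousOn p σ)
    (hG : ContinuousOn G σ) {κhi B M s : ℝ} (hκb : ∀ x ∈ σ, |κ x| ≤ κhi)
    (hpB : ∀ x ∈ σ, |p x - s| ≤ B) (hGM : ∀ x ∈ σ, ‖G x‖ ≤ M) {v : Sp d} (hv : ‖v‖ = 1) :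
    |∫ x in σ, κ x * p x * G x v ∂(surf d) - s * ∫ x in σ, κ x * G x v ∂(surf d)| ≤
      κhi * B * M * (surf d).real σ := by
  have hGv : ContinuousOn (fun x => G x v) σ := hG.clm_apply continuousOn_const
  have hi1 : IntegrableOn (fun x => κ x * p x * G x v) σ (surf d) :=
    integrableOn_surf hσ hfin ((hκ.mul hp).mul hGv)
  have hi2 : IntegrableOn (fun x => κ x * G x v) σ (surf d) :=
    integrableOn_surf hσ hfin (hκ.mul hGv)
  rw [← integral_const_mul, ← integral_sub hi1 (hi2.const_mul s), ← Real.norm_eq_abs]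
  refine norm_setIntegral_le_of_norm_le_const hfin fun x hx => ?_
  have h1 : κ x * p x * G x v - s * (κ x * G x v) = κ x * (p x - s) * G x v := by ring
  have h2 : |G x v| ≤ M := by
    have := (G x).le_opNorm v
    rw [hv, mul_one, Real.norm_eq_abs] at this
    exact this.trans (hGM x hx)
  rw [h1, Real.norm_eq_abs, abs_mul, abs_mul]
  have h3 := (abs_nonneg _).trans (hκb x hx)
  have h4 := (abs_nonneg _).trans (hpB x hx)
  exact mul_le_mul (mul_le_mul (hκb x hx) (hpB x hx) (abs_nonneg _) h3) h2 (abs_nonneg _)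
    (mul_nonneg h3 h4)

/-- The continuous fluxes `∫ κ π ∇U · ν` of a cell balance the source term. -/
theorem integral_source_cell (hΩ : IsPolygonalDomain Ω) (hT : T.IsAdmissible Ω) {κ V f u : Sp d → ℝ}
    (hκ : ContDiffOn ℝ 1 κ (closure Ω)) (hV : ContDiffOn ℝ 2 V (closure Ω))
    (hu : ContDiffOn ℝ 2 u (closure Ω)) (hsol : SolvesFPE Ω κ V f u)
    (hU : ContDiffOn ℝ 2 (fun x => u x / Real.exp (-V x)) (closure Ω)) (i : Fin T.N) :
    ∫ x in T.cell i, f x =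
      -(∑ j ∈ T.nbrs i, ∫ x in T.face i j, κ x * Real.exp (-V x) *
          fderivWithin ℝ (fun x => u x / Real.exp (-V x)) (closure Ω) x (T.nrm i j) ∂(surf d) +
        ∑ y ∈ T.bnode i, ∫ x in T.bface Ω i y, κ x * Real.exp (-V x) *
          fderivWithin ℝ (fun x => u x / Real.exp (-V x)) (closure Ω) x (T.bnrm i y) ∂(surf d)) := by
  set U : Sp d → ℝ := fun x => u x / Real.exp (-V x) with hUdef
  -- The derivative within `closure Ω` makes `F` a `C¹` field on the closed cell, with the boundary
  -- values needed on the interfaces.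
  set F : Sp d → Sp d := fun z => (κ z * Real.exp (-V z)) • vec (fderivWithin ℝ U (closure Ω) z)
    with hF
  have hV1 : ContDiffOn ℝ 1 V (closure Ω) := hV.of_le (by norm_num)
  have hG : ContDiffOn ℝ 1 (fderivWithin ℝ U (closure Ω)) (closure Ω) :=
    hU.fderivWithin hT.uniqueDiffOn_closure (by norm_num)
  have hFc : ContDiffOn ℝ 1 F (closure Ω) :=
    (hκ.mul hV1.neg.exp).smul (contDiff_vec.comp_contDiffOn hG)
  obtain ⟨D, hD⟩ := ContDiffOn.exists_lipschitzOnWith_of_isCompact_of_convex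
    (hFc.mono (hT.closure_cell_subset i)) (hT.isBounded_cell i).isCompact_closure
    (hT.convex_cell i).closure
  have hdiff : DifferentiableOn ℝ F (T.cell i) :=
    (hFc.differentiableOn (by norm_num)).mono (subset_closure.trans (hT.closure_cell_subset i))
  have hdiv := hT.integral_divergence_cell hΩ i hD hdiff
  have hf : ∫ x in T.cell i, f x = ∫ x in T.cell i, -divergence F x := by
    refine setIntegral_congr_ae (hT.isOpen_cell i).measurableSet ?_
    have := (ae_restrict_iff' hΩ.isOpen.measurableSet).1 hsol
    filter_upwards [this] with x hx hxc
    have hxΩ := hT.cell_subset hΩ i hxc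
    rw [← hx hxΩ, hF, divergence_flux hΩ.isOpen hκ hV hu hxΩ]
    ring
  rw [hf, integral_neg, hdiv]
  simp only [hF, real_inner_smul_left, inner_vec]

end IsAdmissible

end Mesh

/-! ### The error estimate on a single mesh. -/

namespace Mesh

variable {T : Mesh d} {Ω : Set (Sp d)}

namespace IsAdmissible

/-- The discrete `H¹` seminorm of the error of `u / π` on a single mesh. -/
theorem scheme_error_le (hΩ : IsPolygonalDomain Ω) (hT : T.IsAdmissible Ω) {κlo κhi : ℝ}
    (hlo : 0 < κlo) {κ V f u : Sp d → ℝ} (hκ : ContDiffOn ℝ 1 κ (closure Ω))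
    (hκb : ∀ x ∈ Ω, κlo ≤ κ x ∧ κ x ≤ κhi) (hV : ContDiffOn ℝ 2 V (closure Ω)) (hu : u ∈ C20 Ω)
    (hsol : SolvesFPE Ω κ V f u)
    (hU : ContDiffOn ℝ 2 (fun x => u x / Real.exp (-V x)) (closure Ω)) {M : ℝ}
    (hM : C2NormLE Ω (fun x => u x / Real.exp (-V x)) M) {S : ℝ → ℝ → ℝ} (hS : IsSmoothMean S)
    {v : Fin T.N → ℝ} (hv : T.SolvesScheme Ω κ (fun x => Real.exp (-V x)) f S v)
    {p₁ p₂ L h : ℝ} (hp₁ : 0 < p₁)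
    (hp : ∀ x ∈ closure Ω, p₁ ≤ Real.exp (-V x) ∧ Real.exp (-V x) ≤ p₂) (hL : 0 ≤ L)
    (hpL : ∀ x ∈ closure Ω, ∀ y ∈ closure Ω,
      |Real.exp (-V x) - Real.exp (-V y)| ≤ L * dist x y)
    (hdiam : ∀ i, Metric.diam (T.cell i) ≤ h) {e : Fin T.N → ℝ}
    (he : e = fun i => v i / Real.exp (-V (T.node i)) - u (T.node i) / Real.exp (-V (T.node i))) :
    κlo ^ 2 / κhi * p₁ * T.edgeSum (fun i j => T.m i j / T.hh i j * (e j - e i) ^ 2)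
        (fun i y => T.bm Ω i y / T.bh i y * (0 - e i) ^ 2) ≤
      2 * p₂ * T.consistencyError Ω κ (fun x => u x / Real.exp (-V x)) +
      2 * ((κhi * (L * h) * M) ^ 2 / (κlo ^ 2 / κhi * p₁)) * (d * volume.real (closure Ω)) := by
  set p : Sp d → ℝ := fun x => Real.exp (-V x) with hpdef
  set U : Sp d → ℝ := fun x => u x / Real.exp (-V x) with hUdef
  have hp0 : ∀ x, 0 < p x := fun x => Real.exp_pos _
  obtain ⟨x₀, hx₀⟩ := hΩ.isConnected.nonempty
  have hlohi : κlo ≤ κhi := (hκb x₀ hx₀).1.trans (hκb x₀ hx₀).2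
  have hhi : 0 < κhi := hlo.trans_le hlohi
  have hκcl : ∀ x ∈ closure Ω, |κ x| ≤ κhi := by
    intro x hx
    -- The bounds on `κ` are given in the open set only and pass to the closure by continuity.
    have hκΩ : Ω ⊆ κ ⁻¹' Set.Icc κlo κhi := fun z hz => hκb z hz
    have hmem : κ x ∈ Set.Icc κlo κhi :=
      isClosed_Icc.closure_subset (hκ.continuousOn.image_closure.trans
        (closure_mono (Set.image_subset_iff.2 hκΩ)) ⟨x, hx, rfl⟩)
    rw [abs_of_pos (hlo.trans_le hmem.1)]
    exact hmem.2
  set G := fderivWithin ℝ U (closure Ω) with hGdef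
  have hGc : ContinuousOn G (closure Ω) :=
    (hU.fderivWithin hT.uniqueDiffOn_closure (m := 1) (by norm_num)).continuousOn
  have hGM : ∀ x ∈ closure Ω, ‖G x‖ ≤ M := by
    intro x hx
    have := hM 1 (by norm_num) x hx
    rwa [norm_iteratedFDerivWithin_one _ (hT.uniqueDiffOn_closure x hx)] at this
  have hpc : ContinuousOn p (closure Ω) := (hV.continuousOn.neg).rexp
  have hnode : ∀ i, T.node i ∈ closure Ω := fun i => hT.closure_cell_subset i (hT.node_mem i)
  have hclose : ∀ i, ∀ x ∈ closure (T.cell i), ∀ y ∈ closure (T.cell i), |p x - p y| ≤ L * h := by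
    intro i x hx y hy
    refine (hpL x (hT.closure_cell_subset i hx) y (hT.closure_cell_subset i hy)).trans ?_
    gcongr
    refine le_trans ?_ (hdiam i)
    rw [← Metric.diam_closure]
    exact Metric.dist_le_diam_of_mem (hT.isBounded_cell i).closure hx hy
  have hbnode : ∀ i, ∀ y ∈ T.bnode i, y ∈ closure (T.cell i) := fun i y hy =>
    bface_subset_closure T Ω i y (hT.bnode_mem i y hy)
  have hSmem : ∀ x ∈ closure Ω, ∀ y ∈ closure Ω, p₁ ≤ S (p x) (p y) ∧ S (p x) (p y) ≤ p₂ :=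
    fun x hx y hy => ⟨(le_min (hp x hx).1 (hp y hy).1).trans (hS.min_le _ _ (hp0 x) (hp0 y)),
      (hS.le_max _ _ (hp0 x) (hp0 y)).trans (max_le (hp x hx).2 (hp y hy).2)⟩
  have hface_cpt : ∀ i j, IsCompact (T.face i j) := fun i j =>
    Metric.isCompact_of_isClosed_isBounded (isClosed_frontier.inter isClosed_frontier)
      ((hT.isBounded_cell i).closure.subset (face_subset_closure T i j))
  have hbface_cpt : ∀ i y, IsCompact (T.bface Ω i y) := fun i y =>
    Metric.isCompact_of_isClosed_isBounded (isClosed_bface T Ω i y)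
      ((hT.isBounded_cell i).closure.subset (bface_subset_closure T Ω i y))
  set s : Fin T.N → Fin T.N → ℝ := fun i j => S (p (T.node i)) (p (T.node j)) with hs
  set sb : Fin T.N → Sp d → ℝ := fun i y => S (p (T.node i)) (p y) with hsb
  set fl : Fin T.N → Fin T.N → ℝ := fun i j =>
    ∫ x in T.face i j, κ x * p x * G x (T.nrm i j) ∂(surf d) with hfl
  set flb : Fin T.N → Sp d → ℝ := fun i y =>
    ∫ x in T.bface Ω i y, κ x * p x * G x (T.bnrm i y) ∂(surf d) with hflb
  set a : Fin T.N → Fin T.N → ℝ := fun i j => T.m i j / T.hh i j * T.kap κ i j with ha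
  set ab : Fin T.N → Sp d → ℝ := fun i y => T.bm Ω i y / T.bh i y * T.kbar κ i with hab
  -- The residual `r` is the flux defect of `U` in the scheme and `c` its consistency error; their
  -- discrete parts cancel in `r - s c = ∫ κ (π - s) ∇U · ν`.
  refine hT.energy_estimate hΩ (s := s) (sb := sb)
    (r := fun i j => fl i j - a i j * s i j * (U (T.node j) - U (T.node i)))
    (rb := fun i y => flb i y - ab i y * sb i y * (U y - U (T.node i)))
    (c := fun i j => T.flux Ω κ U i j - T.kap κ i j * (T.m i j / T.hh i j) *
      (U (T.node j) - U (T.node i)))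
    (cb := fun i y => T.bflux Ω κ U i y - T.kbar κ i * (T.bm Ω i y / T.bh i y) *
      (U y - U (T.node i)))
    (by positivity) hp₁ (fun i j hij => (hT.kap_mem hΩ hlo hκ.continuousOn hκb hij).1) ?_
    (fun i j _ => hSmem _ (hnode i) _ (hnode j))
    (fun i y hy => hSmem _ (hnode i) _ (hT.closure_cell_subset i (hbnode i y hy)))
    (fun i j => hS.symm _ _ (hp0 _) (hp0 _)) ?_ ?_ ?_ ?_
  · intro i
    refine le_trans ?_ (hT.kbar_mem hΩ hκ.continuousOn hκb i).1
    rw [div_le_iff₀ hhi, sq]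
    gcongr
  · intro i j _
    have h1 : fl j i = -fl i j := by
      simp only [hfl]
      rw [T.face_comm j i, T.nrm_comm i j, ← integral_neg]
      simp only [map_neg, mul_neg]
    have h2 : a j i = a i j := by
      simp only [ha]
      rw [T.m_comm j i, T.hh_comm j i, T.kap_comm κ j i]
    have h3 : s j i = s i j := hS.symm _ _ (hp0 _) (hp0 _)
    simp only [h1, h2, h3]
    ring
  · intro i j hij
    have hsub : T.face i j ⊆ closure Ω := (face_subset_closure T i j).trans (hT.closure_cell_subset i)
    -- A point of the interface lies in both closed cells, so `π` there is within `L h` of both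
    -- nodal values and hence of their mean.
    have key := abs_weighted_flux_sub_le (hface_cpt i j) (hT.surf_face_lt_top hij)
      (hκ.continuousOn.mono hsub) (hpc.mono hsub) (hGc.mono hsub) (s := s i j) (B := L * h)
      (fun x hx => hκcl x (hsub hx))
      (fun x hx => hS.abs_sub_le (hp0 _) (hp0 _)
        (hclose i x (face_subset_closure T i j hx) _ (hT.node_mem i))
        (hclose j x (face_subset_closure_right T i j hx) _ (hT.node_mem j)))
      (fun x hx => hGM x (hsub hx)) (hT.norm_nrm hij)
    convert key using 2
    · simp only [hfl, ha, flux, nrm, hGdef]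
      ring
    · rfl
  · intro i y hy
    have hsub : T.bface Ω i y ⊆ closure Ω :=
      (bface_subset_closure T Ω i y).trans (hT.closure_cell_subset i)
    have key := abs_weighted_flux_sub_le (hbface_cpt i y) (hT.surf_bface_lt_top hy)
      (hκ.continuousOn.mono hsub) (hpc.mono hsub) (hGc.mono hsub) (s := sb i y) (B := L * h)
      (fun x hx => hκcl x (hsub hx))
      (fun x hx => hS.abs_sub_le (hp0 _) (hp0 _)
        (hclose i x (bface_subset_closure T Ω i y hx) _ (hT.node_mem i))
        (hclose i x (bface_subset_closure T Ω i y hx) _ (hbnode i y hy)))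
      (fun x hx => hGM x (hsub hx)) (hT.norm_bnrm hy)
    convert key using 2
    · simp only [hflb, hab, bflux, bnrm, hGdef]
      ring
    · rfl
  · intro i
    have h1 := hv i
    rw [hT.integral_source_cell hΩ hκ hV hu.1 hsol hU i, neg_inj] at h1
    have hint : ∑ j ∈ T.nbrs i, T.m i j / T.hh i j * T.kap κ i j * s i j * (e j - e i) =
        ∑ j ∈ T.nbrs i, T.m i j / T.hh i j * T.kap κ i j * S (p (T.node i)) (p (T.node j)) *
          (v j / p (T.node j) - v i / p (T.node i)) -
        ∑ j ∈ T.nbrs i, a i j * s i j * (U (T.node j) - U (T.node i)) := by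
      rw [← Finset.sum_sub_distrib]
      refine Finset.sum_congr rfl fun j _ => ?_
      simp only [he, ha, hs, hUdef, hpdef]
      ring
    have hbd : ∑ y ∈ T.bnode i, T.bm Ω i y / T.bh i y * T.kbar κ i * sb i y * (0 - e i) =
        ∑ y ∈ T.bnode i, T.bm Ω i y / T.bh i y * T.kbar κ i * S (p (T.node i)) (p y) *
          (0 / p y - v i / p (T.node i)) -
        ∑ y ∈ T.bnode i, ab i y * sb i y * (U y - U (T.node i)) := by
      rw [← Finset.sum_sub_distrib]
      refine Finset.sum_congr rfl fun y hy => ?_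
      -- Boundary nodes lie on the frontier of `Ω`, so the exact solution has the value that the
      -- scheme prescribes.
      have hUy : U y = 0 := by
        simp only [hUdef, hu.2 y (hT.bnode_mem i y hy).1.2, zero_div]
      rw [hUy]
      simp only [he, hab, hsb, hUdef, hpdef]
      ring
    rw [hint, hbd, Finset.sum_sub_distrib, Finset.sum_sub_distrib]
    linarith

end IsAdmissible

end Mesh

end StolarskyFV
end

/-! ### The theorem for families of meshes. -/

open StolarskyFV in
theorem mainTheorem1 {d : ℕ} (hd : 0 < d) (Ω : Set (Sp d)) (hΩ : IsPolygonalDomain Ω)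
    (κlo κhi : ℝ) (hκlo : 0 < κlo)
    (V : Sp d → ℝ) (hV : ContDiffOn ℝ 2 V (closure Ω))
    (M K : ℝ) :
    ∃ C : ℝ, 0 ≤ C ∧
      ∀ (κ : Sp d → ℝ), ContDiffOn ℝ 1 κ (closure Ω) → (∀ x ∈ Ω, κlo ≤ κ x ∧ κ x ≤ κhi) →
      ∀ (S : ℝ → ℝ → ℝ), IsSmoothMean S →
      ∀ (H : Set ℝ), (∀ h ∈ H, 0 < h) →
      ∀ (T : ℝ → Mesh d), (∀ h ∈ H, (T h).IsAdmissible Ω) →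
        (∀ h ∈ H, ∀ i, Metric.diam ((T h).cell i) ≤ h) →
      ∀ (φ : ℝ → ℝ), (∀ t, 0 ≤ t → 0 ≤ φ t) →
      ∀ (B : Set (Sp d → ℝ)) (c : (Sp d → ℝ) → ℝ), B ⊆ C20 Ω →
        IsPhiConsistent Ω κ H T φ B c →
      ∀ (u f : Sp d → ℝ), u ∈ C20 Ω → SolvesFPE Ω κ V f u →
        (fun x => u x / Real.exp (-V x)) ∈ B →
        C2NormLE Ω (fun x => u x / Real.exp (-V x)) M →
        c (fun x => u x / Real.exp (-V x)) ≤ K →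
      ∀ (uT : ∀ h : ℝ, Fin (T h).N → ℝ),
        (∀ h ∈ H, (T h).SolvesScheme Ω κ (fun x => Real.exp (-V x)) f S (uT h)) →
      ∀ h ∈ H,
        (T h).normSq Ω κ (fun i => uT h i - u ((T h).node i)) ≤ C * (φ h ^ 2 + h ^ 2) := by
  obtain ⟨x₀, hx₀⟩ := hΩ.isConnected.nonempty
  have hcpt := hΩ.isCompact_closure
  have hne : (closure Ω).Nonempty := ⟨x₀, subset_closure hx₀⟩
  have hpC : ContDiffOn ℝ 1 (fun x => Real.exp (-V x)) (closure Ω) :=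
    (hV.of_le (by norm_num)).neg.exp
  obtain ⟨L, hL, hpL⟩ := hΩ.exists_lipschitz hpC
  obtain ⟨xmin, -, hmin⟩ := hcpt.exists_isMinOn hne hpC.continuousOn
  obtain ⟨xmax, -, hmax⟩ := hcpt.exists_isMaxOn hne hpC.continuousOn
  set p₁ := Real.exp (-V xmin) with hp₁
  set p₂ := Real.exp (-V xmax) with hp₂
  set D := Metric.diam (closure Ω) with hD
  set k₁ := κlo ^ 2 / κhi with hk₁
  set k₂ := κhi ^ 2 / κlo with hk₂
  set R := k₂ * (2 * p₂ ^ 2 + 44 * L ^ 2 * D ^ 2) with hR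
  set Q₁ := 2 * p₂ * K with hQ₁
  set Q₂ := 2 * ((κhi * L * M) ^ 2 / (k₁ * p₁)) * (d * volume.real (closure Ω)) with hQ₂
  -- The constant is fixed before any data are given, when `κhi` and `K` may still have either sign;
  -- the absolute value makes it nonnegative in every case.
  refine ⟨|R / (k₁ * p₁) * (Q₁ + Q₂)|, abs_nonneg _, ?_⟩
  intro κ hκ hκb S hS H hH T hT hdiam φ hφ B c hB hcons u f hu hsol hUB hM hcK uT huT h hh
  have hT := hT h hh
  have hlohi : κlo ≤ κhi := (hκb x₀ hx₀).1.trans (hκb x₀ hx₀).2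
  have hhi : 0 < κhi := hκlo.trans_le hlohi
  have hp₁0 : 0 < p₁ := Real.exp_pos _
  have hp₂0 : 0 < p₂ := Real.exp_pos _
  have hk₁0 : 0 < k₁ := by positivity
  have hk₂0 : 0 < k₂ := by positivity
  have hK0 : 0 ≤ K := (hcons _ hUB).1.trans hcK
  have hp : ∀ x ∈ closure Ω, p₁ ≤ Real.exp (-V x) ∧ Real.exp (-V x) ≤ p₂ :=
    fun x hx => ⟨hmin hx, hmax hx⟩
  set e : Fin (T h).N → ℝ := fun i => uT h i / Real.exp (-V ((T h).node i)) -
    u ((T h).node i) / Real.exp (-V ((T h).node i)) with he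
  have henergy := hT.scheme_error_le hΩ hκlo hκ hκb hV hu hsol (hB hUB).1 hM hS (huT h hh) hp₁0 hp hL
    hpL (hdiam h hh) he
  have hkb : ∀ i, (T h).kbar κ i ≤ k₂ := by
    intro i
    refine (hT.kbar_mem hΩ hκ.continuousOn hκb i).2.trans ?_
    rw [hk₂, le_div_iff₀ hκlo, sq]
    gcongr
  have hnorm := hT.normSq_mul_le hΩ (κ := κ) (p := fun x => Real.exp (-V x)) (p₂ := p₂) (D := D)
    (fun x hx y hy => Metric.dist_le_diam_of_mem hcpt.isBounded hx hy) hk₂0.le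
    (fun i j hij => (hT.kap_mem hΩ hκlo hκ.continuousOn hκb hij).2) hkb
    (fun x hx => by rw [abs_of_pos (Real.exp_pos _)]; exact (hp x hx).2) hpL e
  have heq : (fun i => Real.exp (-V ((T h).node i)) * e i) =
      fun i => uT h i - u ((T h).node i) := by
    funext i
    have := (Real.exp_pos (-V ((T h).node i))).ne'
    simp only [he]
    field_simp
  rw [heq] at hnorm
  set Y := (T h).edgeSum (fun i j => (T h).m i j / (T h).hh i j * (e j - e i) ^ 2)
    (fun i y => (T h).bm Ω i y / (T h).bh i y * (0 - e i) ^ 2) with hY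
  have hcE := (hcons _ hUB).2 h hh
  have hQ₁0 : 0 ≤ Q₁ := by positivity
  have hQ₂0 : 0 ≤ Q₂ := by positivity
  have hR0 : 0 ≤ R := by positivity
  -- `Q₁` collects the consistency error and `Q₂` the error from replacing `π` by the mean on the
  -- interfaces; the cross terms are added for a common factor.
  have hYle : k₁ * p₁ * Y ≤ (Q₁ + Q₂) * (φ h ^ 2 + h ^ 2) := by
    have g1 : 2 * p₂ * (T h).consistencyError Ω κ (fun x => u x / Real.exp (-V x)) ≤
        Q₁ * φ h ^ 2 := by
      rw [hQ₁, mul_assoc (2 * p₂)]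
      gcongr
      exact hcE.trans (by gcongr)
    have g2 : 2 * ((κhi * (L * h) * M) ^ 2 / (k₁ * p₁)) *
        (d * volume.real (closure Ω)) = Q₂ * h ^ 2 := by
      rw [hQ₂]; ring
    rw [g2] at henergy
    have g3 : 0 ≤ Q₁ * h ^ 2 := by positivity
    have g4 : 0 ≤ Q₂ * φ h ^ 2 := by positivity
    linarith
  have hfin : R * Y ≤ R / (k₁ * p₁) * (Q₁ + Q₂) * (φ h ^ 2 + h ^ 2) := by
    have hpos : 0 < k₁ * p₁ := mul_pos hk₁0 hp₁0
    calc R * Y = R / (k₁ * p₁) * (k₁ * p₁ * Y) := by field_simp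
      _ ≤ R / (k₁ * p₁) * ((Q₁ + Q₂) * (φ h ^ 2 + h ^ 2)) := by gcongr
      _ = _ := by ring
  calc _ ≤ R * Y := hnorm
    _ ≤ R / (k₁ * p₁) * (Q₁ + Q₂) * (φ h ^ 2 + h ^ 2) := hfin
    _ ≤ _ := by
      gcongr
      exact le_abs_self _
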